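/- **Definitions.** A parallelogram polyomino, considered up to translation, is the set of unit cells between two lattice paths with North ($N$) and East ($E$) unit steps that have the same starting point and the same end point and meet only there. A periodic parallelogram polyomino (PPP) is a parallelogram polyomino with a marked cell in its first (leftmost) column whose height (its position in that column, counted from $1$ at the bottom) is at most the number of cells of the last column. Copies of it are glued into an infinite strip by placing the marked cell of each copy immediately to the right of the topmost cell of the last column of the preceding copy; rows joined by the gluing count as one. The width is the number of columns, the height is the number of rows above the marked cell. A PPP is degenerated if it is a rectangle and the marked cell is the topmost cell of the first column. For a non-degenerated PPP $P$, consider the graph $\Phi(P)$ whose vertices are the topmost cells of the columns and the rightmost cells of the (glued) rows; the father of the topmost cell of a column is the rightmost cell of its row, and the father of the rightmost cell of a row is the topmost cell of its column. Delete recursively the leaves of $\Phi(P)$ together with the corresponding columns and rows of $P$. What remains is, up to rotation of columns, a PPP (the trunk of $P$) with upper path $N^k(NE)^l$ and lower path $(EN)^lN^k$ for some positive integers $k,l$; the integer $k$ is uniquely determined by $P$ and is called the intrinsic thickness of $P$. Let $\mathcal A_\bullet(z_\bullet,z_\circ)$ (resp. $\mathcal A_\circ(z_\bullet,z_\circ)$)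 be the generating function of finite ordered rooted trees whose vertices are colored black and white, alternating along every edge, with black (resp. white) root, where $z_\bullet$ counts the black and $z_\circ$ the white non-root vertices. **Theorem.** The intrinsic thickness is well defined for every non-degenerated PPP, and all the generating functions below count finite sets. One has $$\mathcal A_\bullet(z_\bullet,z_\circ)=\frac{z_\bullet-z_\circ+1-\sqrt{(z_\bullet-z_\circ+1)^2-4z_\bullet}}{2z_\bullet}=\mathcal A_\circ(z_\circ,z_\bullet),$$ where the square root is the formal power series with constant term $1$. The generating function of non-degenerated PPPs, in which $z_\bullet$ counts the width, $z_\circ$ the height and $t$ the intrinsic thickness, is the formal power series $$P(z_\bullet,z_\circ,t)=\frac{t}{1-t}\cdot\frac{z_\bullet\,\partial_{z_\bullet}\!\left(z_\bullet z_\circ\,\mathcal A_\bullet(z_\bullet,z_\circ)^2\mathcal A_\circ(z_\bullet,z_\circ)^2\right)}{1-z_\bullet z_\circ\,\mathcal A_\bullet(z_\bullet,z_\circ)^2\mathcal A_\circ(z_\bullet,z_\circ)^2}.$$ -/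

import Mathlib

namespace PPP

/-! ### Lattice paths and parallelogram polyominoes -/

/-- The two kinds of unit steps, North and East. -/
inductive Step
  | N
  | E
  deriving DecidableEq

open Step

/-- The lattice point (number of East steps, number of North steps) reached after the first `i`
steps of a path that starts at the origin. -/
def pointAt (p : List Step) (i : ℕ) : ℕ × ℕ :=
  ((p.take i).count E, (p.take i).count N)

/-- `eastHeight p x` is the height of the `x`-th East step of the path `p` (counted from `0`),
that is, the number of North steps before it. -/
def eastHeight : List Step → ℕ → ℕ
  | [], _ => 0
  | N :: p, x => eastHeight p x + 1
  | E :: _, 0 => 0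
  | E :: p, x + 1 => eastHeight p x

/-- A parallelogram polyomino, up to translation: two paths with North and East steps from the
origin to a common end point, which meet only at their starting and ending points. The upper path
is the one that starts with a North step, the lower path the one that starts with an East step. -/
@[ext]
structure ParallelogramPolyomino where
  upper : List Step
  lower : List Step
  upper_start : upper.head? = some N
  lower_start : lower.head? = some E
  same_end : pointAt upper upper.length = pointAt lower lower.length
  meet_only_at_ends : ∀ i ≤ upper.length, ∀ j ≤ lower.length,
    pointAt upper i = pointAt lower j →
      (i = 0 ∧ j = 0) ∨ (i = upper.length ∧ j = lower.length)

namespace ParallelogramPolyomino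

variable (P : ParallelogramPolyomino)

/-- The number of columns. -/
def width : ℕ := P.upper.count E

/-- The number of rows of the polyomino (before any gluing). -/
def numRows : ℕ := P.upper.count N

/-- Column `x` consists of the cells `(x, y)` with `P.bot x ≤ y < P.top x`. -/
def top (x : ℕ) : ℕ := eastHeight P.upper x

/-- Column `x` consists of the cells `(x, y)` with `P.bot x ≤ y < P.top x`. -/
def bot (x : ℕ) : ℕ := eastHeight P.lower x

/-- The cells between the two paths; `(x, y)` is the unit square with lower left corner
`(x, y)`. -/
def cells : Set (ℕ × ℕ) := {c | c.1 < P.width ∧ P.bot c.1 ≤ c.2 ∧ c.2 < P.top c.1}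

/-- The polyomino is a full rectangle. -/
def IsRectangular : Prop :=
  ∃ a b : ℕ, P.upper = List.replicate a N ++ List.replicate b E ∧
    P.lower = List.replicate b E ++ List.replicate a N

end ParallelogramPolyomino

/-- A periodic parallelogram polyomino: a parallelogram polyomino with a marked cell in the first
column whose height `mark` (counted from `1`, the bottom cell of the first column) is at most the
size of the last column. -/
@[ext]
structure PeriodicPP extends ParallelogramPolyomino where
  mark : ℕ
  one_le_mark : 1 ≤ mark
  mark_le_top : mark ≤ toParallelogramPolyomino.top 0
  admissible : mark ≤ toParallelogramPolyomino.top (toParallelogramPolyomino.width - 1)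
    - toParallelogramPolyomino.bot (toParallelogramPolyomino.width - 1)

namespace PeriodicPP

variable (P : PeriodicPP)

/-- The height of a periodic parallelogram polyomino: the number of rows above the marked cell. -/
def height : ℕ := P.numRows - P.mark

/-- Degenerated: rectangular, with the topmost cell of the first column marked. -/
def IsDegenerate : Prop := P.IsRectangular ∧ P.mark = P.top 0

/-- The infinite strip obtained by gluing copies of `P`: the marked cell of each copy is put
immediately to the right of the topmost cell of the last column of the preceding copy. Consecutive
copies thus differ by the translation `(P.width, P.height)`, and rows of `P` that are joined by the
gluing are parts of one row of the strip. -/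
def strip : Set (ℤ × ℤ) :=
  {c | ∃ q : ℤ, ∃ d ∈ P.cells,
    c = ((d.1 : ℤ) + q * (P.width : ℤ), (d.2 : ℤ) + q * (P.height : ℤ))}

/-! ### The ordered cyclic forest, pruning and the trunk

Columns, rows and vertices are taken in the infinite strip. Those of the glued polyomino are their
classes modulo the translation `(P.width, P.height)`, under which everything below is invariant. -/

/-- The cell `c` is the topmost cell of its column. -/
def IsTopmost (c : ℤ × ℤ) : Prop := c ∈ P.strip ∧ ∀ y : ℤ, (c.1, y) ∈ P.strip → y ≤ c.2

/-- The cell `c` is the rightmost cell of its row. -/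
def IsRightmost (c : ℤ × ℤ) : Prop := c ∈ P.strip ∧ ∀ x : ℤ, (x, c.2) ∈ P.strip → x ≤ c.1

/-- The vertices of the ordered cyclic forest. -/
def IsVertex (c : ℤ × ℤ) : Prop := P.IsTopmost c ∨ P.IsRightmost c

/-- `s'` is the father of `s`: if `s` is the topmost cell of its column, its father is the rightmost
cell of its row; if `s` is the rightmost cell of its row, its father is the topmost cell of its
column. -/
def IsFather (s' s : ℤ × ℤ) : Prop :=
  (P.IsTopmost s ∧ P.IsRightmost s' ∧ s'.2 = s.2) ∨
  (P.IsRightmost s ∧ P.IsTopmost s' ∧ s'.1 = s.1)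

/-- The vertices deleted by the pruning, that is, by deleting leaves recursively: a vertex is
deleted as soon as all its sons have been deleted. -/
inductive Pruned : ℤ × ℤ → Prop
  | leaf (s : ℤ × ℤ) (hs : P.IsVertex s) (h : ∀ u : ℤ × ℤ, P.IsFather s u → Pruned u) : Pruned s

/-- The columns that remain after the pruning. -/
def remainingColumns : Set ℤ := {x | ∃ y : ℤ, P.IsTopmost (x, y) ∧ ¬ P.Pruned (x, y)}

/-- The rows that remain after the pruning. -/
def remainingRows : Set ℤ := {y | ∃ x : ℤ, P.IsRightmost (x, y) ∧ ¬ P.Pruned (x, y)}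

/-- `Q` is a trunk of `P` (it is determined by `P` up to rotation of columns): `Q` is what is left
of `P` when the pruned columns and rows are deleted. The maps `f` and `g` send the columns and rows
of the strip of `Q`, in order, to the remaining columns and rows of the strip of `P`, and carry the
period of `Q` to that of `P`. -/
def IsTrunk (Q P : PeriodicPP) : Prop :=
  ∃ f g : ℤ → ℤ, StrictMono f ∧ StrictMono g ∧
    Set.range f = P.remainingColumns ∧ Set.range g = P.remainingRows ∧
    (∀ x : ℤ, f (x + (Q.width : ℤ)) = f x + (P.width : ℤ)) ∧
    (∀ y : ℤ, g (y + (Q.height : ℤ)) = g y + (P.height : ℤ)) ∧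
    ∀ x y : ℤ, (x, y) ∈ Q.strip ↔ (f x, g y) ∈ P.strip

/-- The trunk of `P` has upper path `N^k (NE)^l` and lower path `(EN)^l N^k`, for the given positive
integer `k` and some positive integer `l`. -/
def HasIntrinsicThickness (k : ℕ) : Prop :=
  0 < k ∧ ∃ Q : PeriodicPP, ∃ l : ℕ, 0 < l ∧ IsTrunk Q P ∧
    Q.upper = List.replicate k N ++ (List.replicate l [N, E]).flatten ∧
    Q.lower = (List.replicate l [E, N]).flatten ++ List.replicate k N

/-- The intrinsic thickness: the integer `k` above. -/
noncomputable def intrinsicThickness : ℕ := sInf {k | P.HasIntrinsicThickness k}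

end PeriodicPP

/-- Non-degenerated periodic parallelogram polyominoes. -/
abbrev NondegeneratePPP : Type := {P : PeriodicPP // ¬ P.IsDegenerate}

/-! ### Ordered trees -/

/-- Finite ordered rooted trees: a root with a (possibly empty) list of subtrees. In a bicolored
tree the color of a vertex is determined by the color of the root and the parity of its height. -/
inductive OrderedTree
  | node (subtrees : List OrderedTree)

mutual

/-- Number of vertices at odd height. -/
def OrderedTree.numOdd : OrderedTree → ℕ
  | .node ts => forestRootParity ts

/-- Number of non-root vertices at even height. -/
def OrderedTree.numEven : OrderedTree → ℕ
  | .node ts => forestOtherParity ts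

/-- Number of vertices of a list of trees that are at even height in their tree (roots included). -/
def forestRootParity : List OrderedTree → ℕ
  | [] => 0
  | t :: ts => (1 + t.numEven) + forestRootParity ts

/-- Number of vertices of a list of trees that are at odd height in their tree. -/
def forestOtherParity : List OrderedTree → ℕ
  | [] => 0
  | t :: ts => t.numOdd + forestOtherParity ts

end

/-! ### Generating functions -/

/-- The variables `z•`, `z∘` and `t`. -/
inductive Var
  | black
  | white
  | t
  deriving DecidableEq

/-- The generating function of a class of objects with weight `wt`: the coefficient of the monomial
with exponent `n` is the number of objects of weight `n`. -/
noncomputable def genFun {α : Type} (wt : α → (Var →₀ ℕ)) : MvPowerSeries Var ℚ :=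
  fun n => (Nat.card {a : α // wt a = n} : ℚ)

/-- There are finitely many objects of each weight. -/
def FinitelyManyOfEachWeight {α : Type} (wt : α → (Var →₀ ℕ)) : Prop :=
  ∀ n : Var →₀ ℕ, Finite {a : α // wt a = n}

/-- Weight of a tree with black root: `z•` counts the black, `z∘` the white non-root vertices. -/
noncomputable def blackRootedWeight (T : OrderedTree) : Var →₀ ℕ :=
  Finsupp.single Var.black T.numEven + Finsupp.single Var.white T.numOdd

/-- Weight of a tree with white root: `z•` counts the black, `z∘` the white non-root vertices. -/
noncomputable def whiteRootedWeight (T : OrderedTree) : Var →₀ ℕ :=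
  Finsupp.single Var.black T.numOdd + Finsupp.single Var.white T.numEven

/-- Weight of a non-degenerated periodic parallelogram polyomino: `z•` counts the width, `z∘` the
height and `t` the intrinsic thickness. -/
noncomputable def pppWeight (P : NondegeneratePPP) : Var →₀ ℕ :=
  Finsupp.single Var.black P.1.width + Finsupp.single Var.white P.1.height
    + Finsupp.single Var.t P.1.intrinsicThickness

/-- The variable `z•`. -/
noncomputable def zb : MvPowerSeries Var ℚ := MvPowerSeries.X Var.black

/-- The variable `z∘`. -/
noncomputable def zw : MvPowerSeries Var ℚ := MvPowerSeries.X Var.white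

/-- The variable `t`. -/
noncomputable def tvar : MvPowerSeries Var ℚ := MvPowerSeries.X Var.t

/-- The generating function `A•` of bicolored ordered trees with black root. -/
noncomputable def Ablack : MvPowerSeries Var ℚ := genFun blackRootedWeight

/-- The generating function `A∘` of bicolored ordered trees with white root. -/
noncomputable def Awhite : MvPowerSeries Var ℚ := genFun whiteRootedWeight

/-- The generating function `P(z•, z∘, t)` of non-degenerated periodic parallelogram polyominoes. -/
noncomputable def pppGenFun : MvPowerSeries Var ℚ := genFun pppWeight

end PPP

/-!
The strip of a non-degenerated periodic parallelogram polyomino is encoded by the two father maps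
of `Φ(P)`: columns to rows and rows to columns. Both are monotone and quasi-periodic
(`CyclicForest`), and the pairs of maps that occur are those for which every column precedes its
grandfather, normalized so that the row `0` is the bottom row of the column `0`
(`NondegeneratePPP.forest_injective`, `NondegeneratePPP.exists_forest_eq`).

The vertices that survive the pruning are those with descendants in every generation. On them the
father maps are bijective and monotone, and so, after enumerating the `l` surviving columns and the
`l` surviving rows of a period, they become translations `i ↦ i + k` and `i ↦ i`
(`CyclicForest.exists_isTrunk`). The surviving columns and rows then form the polyomino with upper
path `N^k (NE)^l` and lower path `(EN)^l N^k`, and `k` is determined by `P`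
(`NondegeneratePPP.hasIntrinsicThickness_iff`). Moreover `k` is positive exactly when every column
precedes its grandfather (`CyclicForest.IsTrunk.one_le_iff`), so for given `l` and `k ≥ 1` this
condition does not restrict the rest of the structure.

What has been pruned consists of ordered trees: the sons of a trunk vertex lie to the left and to
the right of its trunk son, and each of the two sides is the sequence of subtrees of an ordered
tree. So each of the `l` components of the trunk, made of one column and one row, carries a
`Decoration` by four trees, two with black and two with white root. Conversely, `l`, `k` and the
decorations determine the forest up to translations of its columns and of its rows: the linear order
of the vertices is recovered by comparing lexicographically the trunk ancestors of a given order and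
then the positions on the ways to them. This gives uniqueness
(`CyclicForest.IsDecorated.forest_unique`), and existence, by building the forest on such keys
(`CyclicForest.exists_forest_isDecorated`).

The translation of the rows is fixed by the normalization, that of the columns by prescribing the
column of the trunk component with index `0`. Hence, for each `c`, the polyominoes with parameters
`l`, `k` and a trunk column at `c` correspond to the `l`-tuples of decorations. Counting pairs of a
polyomino and one of its `l` trunk columns in the period `0 ≤ c < width` in both ways
(`exists_pointed_equiv`) gives `l G = z• ∂ (F ^ l)`, where `G` is the generating function of these
polyominoes and `F = z• z∘ A• ^ 2 A∘ ^ 2` that of decorations. So `G = F ^ (l - 1) z• ∂ F`,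
independently of `k`, and the sum over `l` and `k` is the formula of the theorem. The decomposition
of a tree into its first subtree and the rest gives `A• = 1 + z∘ A∘ A•` and `A∘ = 1 + z• A• A∘`,
whence a quadratic equation for each of the two series.
-/

namespace PPP

/-! ### Quasi-periodic maps of the integers -/

theorem quasiperiodic_mul {G : ℤ → ℤ} {a b : ℤ} (h : ∀ x, G (x + a) = G x + b) (x q : ℤ) :
    G (x + a * q) = G x + b * q := by
  induction q using Int.induction_on with
  | zero => simp
  | succ i ih => rw [mul_add, mul_one, ← add_assoc, h, ih]; ring
  | pred i ih =>
    have := h (x + a * (-(i : ℤ) - 1))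
    rw [show x + a * (-(i : ℤ) - 1) + a = x + a * (-(i : ℤ)) by ring, ih] at this
    linarith

/-- Representative of an integer in a window of length `a`. -/
theorem exists_window {a : ℤ} (ha : 0 < a) (s x : ℤ) : ∃ q r, s ≤ r ∧ r < s + a ∧ x = r + a * q := by
  refine ⟨(x - s) / a, s + (x - s) % a, ?_, ?_, ?_⟩
  · have := Int.emod_nonneg (x - s) ha.ne'; linarith
  · have := Int.emod_lt_of_pos (x - s) ha; linarith
  · have := Int.emod_add_mul_ediv (x - s) a; linarith

theorem exists_le_of_quasiperiodic {G : ℤ → ℤ} {a b : ℤ} (h : ∀ x, G (x + a) = G x + b) (hb : 0 < b)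
    (w : ℤ) : ∃ x, w ≤ G x := by
  refine ⟨0 + a * |w - G 0|, ?_⟩
  rw [quasiperiodic_mul h]
  have := le_abs_self (w - G 0)
  nlinarith [abs_nonneg (w - G 0)]

theorem exists_lt_of_quasiperiodic {G : ℤ → ℤ} {a b : ℤ} (h : ∀ x, G (x + a) = G x + b) (hb : 0 < b)
    (w : ℤ) : ∃ x, G x < w := by
  refine ⟨0 + a * (-(|w - G 0| + 1)), ?_⟩
  rw [quasiperiodic_mul h]
  have := neg_abs_le (w - G 0)
  nlinarith [abs_nonneg (w - G 0)]

/-- A monotone quasi-periodic map has a lower adjoint. -/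
theorem exists_lowerAdjoint {G : ℤ → ℤ} {a b : ℤ} (hm : Monotone G)
    (h : ∀ x, G (x + a) = G x + b) (hb : 0 < b) :
    ∃ lo : ℤ → ℤ, ∀ w x, lo w ≤ x ↔ w ≤ G x := by
  have key : ∀ w, ∃ m, ∀ x, m ≤ x ↔ w ≤ G x := by
    intro w
    obtain ⟨y, hy⟩ := exists_lt_of_quasiperiodic h hb w
    obtain ⟨m, hm1, hm2⟩ := Int.exists_least_of_bdd (P := fun x => w ≤ G x)
      ⟨y, fun z hz => by
        by_contra hc
        have := hm (le_of_not_ge hc)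
        linarith⟩ (exists_le_of_quasiperiodic h hb w)
    exact ⟨m, fun x => ⟨fun hx => hm1.trans (hm hx), fun hx => hm2 x hx⟩⟩
  exact ⟨fun w => (key w).choose, fun w => (key w).choose_spec⟩

/-- A monotone quasi-periodic map has an upper adjoint. -/
theorem exists_upperAdjoint {G : ℤ → ℤ} {a b : ℤ} (hm : Monotone G)
    (h : ∀ x, G (x + a) = G x + b) (hb : 0 < b) :
    ∃ up : ℤ → ℤ, ∀ w x, x ≤ up w ↔ G x ≤ w := by
  obtain ⟨lo, hlo⟩ := exists_lowerAdjoint hm h hb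
  refine ⟨fun w => lo (w + 1) - 1, fun w x => ?_⟩
  change x ≤ lo (w + 1) - 1 ↔ _
  have := hlo (w + 1) x
  constructor
  · intro h1
    by_contra h2
    have := this.2 (not_le.1 h2)
    omega
  · intro h1
    by_contra h2
    have := this.1 (by omega)
    omega

/-- An order automorphism of the integers is a translation. -/
theorem strictMono_surjective_int {g : ℤ → ℤ} (hm : StrictMono g) (hs : Function.Surjective g)
    (x : ℤ) : g x = x + g 0 := by
  have step : ∀ x, g (x + 1) = g x + 1 := by
    intro x
    obtain ⟨y, hy⟩ := hs (g x + 1)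
    have h1 : g x < g (x + 1) := hm (by omega)
    have h2 : g x < g y := by omega
    have h3 : x < y := hm.lt_iff_lt.1 h2
    have h4 : g (x + 1) ≤ g y := hm.monotone (by omega)
    omega
  have := quasiperiodic_mul step 0 x
  simp at this
  linarith

theorem strictMono_eq_shift_of_range_eq {α : Type*} [LinearOrder α] {e e' : ℤ → α}
    (he : StrictMono e) (he' : StrictMono e') (h : Set.range e = Set.range e') :
    ∃ s, ∀ x, e' x = e (x + s) := by
  have h1 : ∀ x, ∃ y, e y = e' x := fun x => by
    have : e' x ∈ Set.range e := h ▸ Set.mem_range_self x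
    exact this
  choose g hg using h1
  have hgm : StrictMono g := fun x y hxy => he.lt_iff_lt.1 (by rw [hg, hg]; exact he' hxy)
  have hgs : Function.Surjective g := fun y => by
    have : e y ∈ Set.range e' := h ▸ Set.mem_range_self y
    obtain ⟨x, hx⟩ := this
    exact ⟨x, he.injective (by rw [hg, hx])⟩
  exact ⟨g 0, fun x => by rw [← hg, strictMono_surjective_int hgm hgs]⟩

theorem strictMono_eq_of_range_eq {α : Type*} [LinearOrder α] {e e' : ℤ → α}
    (he : StrictMono e) (he' : StrictMono e') (h : Set.range e = Set.range e') (h0 : e 0 = e' 0) :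
    e = e' := by
  obtain ⟨s, hs⟩ := strictMono_eq_shift_of_range_eq he he' h
  have : s = 0 := by
    have := he.injective (h0.trans (hs 0))
    omega
  subst this
  funext x
  simpa using (hs x).symm

open Classical in
/-- A periodic set of integers is enumerated by the integers in increasing order, and its period is
carried by a translation of the indices. -/
theorem exists_periodic_enumeration (S : Set ℤ) {L c : ℤ} (hL : 0 < L) (hc : c ∈ S)
    (hS : ∀ x, x + L ∈ S ↔ x ∈ S) :
    ∃ (e : ℤ → ℤ) (n : ℕ), 0 < n ∧ StrictMono e ∧ Set.range e = S ∧ e 0 = c ∧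
      ∀ x, e (x + n) = e x + L := by
  let _ := LinearLocallyFiniteOrder.succOrder S
  let _ := LinearLocallyFiniteOrder.predOrder S
  have hS' : ∀ x, x ∈ S → x - L ∈ S := fun x hx => (hS (x - L)).1 (by simpa using hx)
  have : NoMaxOrder S := ⟨fun x => ⟨⟨x + L, (hS x).2 x.2⟩, by
    rw [← Subtype.coe_lt_coe]; simpa using hL⟩⟩
  have : NoMinOrder S := ⟨fun x => ⟨⟨x - L, hS' x x.2⟩, by
    rw [← Subtype.coe_lt_coe]; simpa using hL⟩⟩
  have : Nonempty S := ⟨⟨c, hc⟩⟩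
  let φ : S ≃o ℤ := orderIsoIntOfLinearSuccPredArch
  let e : ℤ → ℤ := fun x => (φ.symm (x + φ ⟨c, hc⟩) : ℤ)
  have hem : StrictMono e := fun x y hxy => by
    have : φ.symm (x + φ ⟨c, hc⟩) < φ.symm (y + φ ⟨c, hc⟩) := φ.symm.strictMono (by omega)
    exact this
  have her : Set.range e = S := by
    ext x
    constructor
    · rintro ⟨y, rfl⟩
      exact (φ.symm (y + φ ⟨c, hc⟩)).2
    · intro hx
      refine ⟨φ ⟨x, hx⟩ - φ ⟨c, hc⟩, ?_⟩
      simp [e]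
  have he0 : e 0 = c := by simp [e]
  have hem' : StrictMono (fun x => e x + L) := fun x y hxy => by
    have := hem hxy
    simpa using this
  have her' : Set.range e = Set.range (fun x => e x + L) := by
    rw [her]
    ext x
    constructor
    · intro hx
      have := hS' x hx
      rw [← her] at this
      obtain ⟨y, hy⟩ := this
      exact ⟨y, by simp [hy]⟩
    · rintro ⟨y, rfl⟩
      exact (hS _).2 (her ▸ Set.mem_range_self y)
  obtain ⟨s, hs⟩ := strictMono_eq_shift_of_range_eq hem hem' her'
  have hspos : 0 < s := by
    have h1 := hs 0
    simp only [zero_add] at h1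
    have : e 0 < e s := by omega
    exact hem.lt_iff_lt.1 this
  refine ⟨e, s.toNat, by omega, hem, her, he0, fun x => ?_⟩
  rw [Int.toNat_of_nonneg hspos.le]
  exact (hs x).symm

theorem strictMono_int_add_le {g : ℤ → ℤ} (hm : StrictMono g) (x : ℤ) (j : ℕ) :
    g x + j ≤ g (x + j) := by
  induction j with
  | zero => simp
  | succ j ih =>
    have : g (x + j) < g (x + (j + 1 : ℕ)) := hm (by push_cast; omega)
    push_cast at *
    omega

/-- A monotone surjection does not skip values, so it advances by at most one at each step. -/
theorem le_of_monotone_surjective {g : ℤ → ℤ} (hm : Monotone g) (hs : Function.Surjective g)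
    (x : ℤ) (j : ℕ) : g (x + j) ≤ g x + j := by
  induction j with
  | zero => simp
  | succ j ih =>
    obtain ⟨y, hy⟩ := hs (g (x + j) + 1)
    have h1 : x + j < y := by
      by_contra hc
      have := hm (not_lt.1 hc)
      omega
    have : g (x + (j + 1 : ℕ)) ≤ g y := hm (by push_cast; omega)
    push_cast at *
    omega

/-- A monotone surjection that is quasi-periodic with equal periods is a translation. -/
theorem eq_shift_of_monotone_surjective {g : ℤ → ℤ} (hm : Monotone g) (hs : Function.Surjective g)
    {l : ℕ} (hl : 0 < l) (h : ∀ x, g (x + l) = g x + l) (x : ℤ) : g x = x + g 0 := by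
  refine strictMono_surjective_int (strictMono_int_of_lt_succ fun x => ?_) hs x
  have h1 := le_of_monotone_surjective hm hs (x + 1) (l - 1)
  have h2 := h x
  have : x + 1 + ((l - 1 : ℕ) : ℤ) = x + l := by omega
  rw [this, h2] at h1
  omega

end PPP

namespace PPP

/-! ### Cyclic forests and their trunks -/

/-- The father map of the infinite strip, in terms of the indices of columns (`true`) and rows
(`false`): `father true X` is the row of the father of the vertex of column `X`, and
`father false Y` is the column of the father of the vertex of row `Y`. A strip with `size true`
columns and `size false` rows per period has quasi-periodic father maps. -/
@[ext]
structure CyclicForest where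
  size : Bool → ℕ
  father : Bool → ℤ → ℤ
  size_pos : ∀ b, 0 < size b
  mono : ∀ b, Monotone (father b)
  periodic : ∀ b x, father b (x + size b) = father b x + size (!b)

namespace CyclicForest

variable (S : CyclicForest)

/-- The father map on the set of all vertices. -/
def up (v : Bool × ℤ) : Bool × ℤ := (!v.1, S.father v.1 v.2)

/-- The vertex `v` translated by `q` periods. -/
def translate (q : ℤ) (v : Bool × ℤ) : Bool × ℤ := (v.1, v.2 + S.size v.1 * q)

theorem up_translate (q : ℤ) (v : Bool × ℤ) : S.up (S.translate q v) = S.translate q (S.up v) := by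
  obtain ⟨b, x⟩ := v
  simp [up, translate, quasiperiodic_mul (S.periodic b)]

theorem up_iterate_translate (j : ℕ) (q : ℤ) (v : Bool × ℤ) :
    S.up^[j] (S.translate q v) = S.translate q (S.up^[j] v) := by
  induction j generalizing v with
  | zero => rfl
  | succ j ih => rw [Function.iterate_succ_apply, Function.iterate_succ_apply, up_translate, ih]

theorem translate_mem_range_iterate (j : ℕ) (q : ℤ) {v : Bool × ℤ} (hv : v ∈ Set.range S.up^[j]) :
    S.translate q v ∈ Set.range S.up^[j] := by
  obtain ⟨u, rfl⟩ := hv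
  exact ⟨S.translate q u, S.up_iterate_translate j q u⟩

theorem translate_neg_translate (q : ℤ) (v : Bool × ℤ) : S.translate (-q) (S.translate q v) = v := by
  simp [translate]

/-- The displacement of trunk indices along the father map: `k` from columns to rows, and `0` from
rows to columns. -/
def turn (k : ℤ) (b : Bool) : ℤ := if b then k else 0

@[simp] theorem turn_true (k : ℤ) : turn k true = k := rfl
@[simp] theorem turn_false (k : ℤ) : turn k false = 0 := rfl

/-- The trunk of a cyclic forest: `f b` enumerates the trunk vertices of colour `b` in increasing
order, `l` of them in each period; the father of the trunk row `i` is the trunk column `i`, and the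
father of the trunk column `i` is the trunk row `i + k`; every vertex has an ancestor in the
trunk. -/
structure IsTrunk (l : ℕ) (k : ℤ) (f : Bool → ℤ → ℤ) : Prop where
  l_pos : 0 < l
  strictMono : ∀ b, StrictMono (f b)
  periodic : ∀ b i, f b (i + l) = f b i + S.size b
  father : ∀ b i, S.father b (f b i) = f (!b) (i + turn k b)
  absorbing : ∃ H : ℕ, ∀ v, (S.up^[H] v).2 ∈ Set.range (f (S.up^[H] v).1)

open Classical in
/-- The images of the iterates of the father map stabilize. -/
theorem exists_stable_image : ∃ H : ℕ, Set.range S.up^[H] ⊆ Set.range S.up^[H + 1] := by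
  let W : Finset (Bool × ℤ) := Finset.univ ×ˢ Finset.Ico 0 (S.size true + S.size false : ℤ)
  let c : ℕ → ℕ := fun j => (W.filter (· ∈ Set.range S.up^[j])).card
  have hsub : ∀ j, Set.range S.up^[j + 1] ⊆ Set.range S.up^[j] := by
    rintro j _ ⟨u, rfl⟩
    exact ⟨S.up u, by rw [Function.iterate_succ_apply]⟩
  obtain ⟨H, hH⟩ : ∃ H, c H ≤ c (H + 1) := by
    by_contra! hc
    have : ∀ j, c j + j ≤ c 0 := by
      intro j
      induction j with
      | zero => simp
      | succ j ih => have := hc j; omega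
    have := this (c 0 + 1)
    omega
  refine ⟨H, fun v hv => ?_⟩
  have hfil : W.filter (· ∈ Set.range S.up^[H + 1]) = W.filter (· ∈ Set.range S.up^[H]) :=
    Finset.eq_of_subset_of_card_le (Finset.monotone_filter_right _ fun v _ hv => hsub H hv) hH
  obtain ⟨q, r, h0, h1, h2⟩ := exists_window (a := S.size v.1) (by exact_mod_cast S.size_pos _) 0 v.2
  have hv' : S.translate (-q) v ∈ Set.range S.up^[H] := S.translate_mem_range_iterate H _ hv
  have hr : (S.translate (-q) v).2 = r := by simp [translate, h2]
  have hW : S.translate (-q) v ∈ W := by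
    have : (S.size v.1 : ℤ) ≤ S.size true + S.size false := by
      cases v.1 <;> simp
    simp only [W, Finset.mem_product, Finset.mem_univ, Finset.mem_Ico, true_and, hr]
    omega
  have : S.translate (-q) v ∈ W.filter (· ∈ Set.range S.up^[H + 1]) := by
    rw [hfil]
    exact Finset.mem_filter.2 ⟨hW, hv'⟩
  have := S.translate_mem_range_iterate (H + 1) q (Finset.mem_filter.1 this).2
  have hv2 := S.translate_neg_translate (-q) v
  rw [neg_neg] at hv2
  rwa [hv2] at this

/-- The trunk is the stable image of the father map, enumerated colour by colour. There the father maps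
are monotone bijections, hence translations of the indices; the numbering of the columns is chosen
so that the one from rows to columns is the identity. -/
theorem exists_isTrunk : ∃ l k f, S.IsTrunk l k f := by
  obtain ⟨H, hH⟩ := S.exists_stable_image
  set J := Set.range S.up^[H] with hJ
  have hJup : ∀ v ∈ J, S.up v ∈ J := by
    rintro _ ⟨u, rfl⟩
    exact ⟨S.up u, by rw [← Function.iterate_succ_apply, Function.iterate_succ_apply']⟩
  have hJson : ∀ v ∈ J, ∃ u ∈ J, S.up u = v := by
    intro v hv
    obtain ⟨u, hu⟩ := hH hv
    exact ⟨S.up^[H] u, ⟨u, rfl⟩, by rw [← hu, Function.iterate_succ_apply']⟩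
  have hne : ∀ b, ∃ x, (b, x) ∈ J := by
    have h1 : S.up^[H] (true, 0) ∈ J := ⟨_, rfl⟩
    have h2 := hJup _ h1
    intro b
    by_cases hb : (S.up^[H] (true, 0)).1 = b
    · exact ⟨(S.up^[H] (true, 0)).2, by rw [← hb]; exact h1⟩
    · have : (S.up (S.up^[H] (true, 0))).1 = b := by
        simp only [up]
        revert hb
        cases (S.up^[H] (true, 0)).1 <;> cases b <;> simp
      exact ⟨(S.up (S.up^[H] (true, 0))).2, by rw [← this]; exact h2⟩
  have henum : ∀ b, ∃ (e : ℤ → ℤ) (n : ℕ), 0 < n ∧ StrictMono e ∧ Set.range e = {x | (b, x) ∈ J} ∧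
      ∀ x, e (x + n) = e x + S.size b := by
    intro b
    obtain ⟨c, hc⟩ := hne b
    obtain ⟨e, n, h1, h2, h3, -, h4⟩ := exists_periodic_enumeration {x | (b, x) ∈ J}
      (L := S.size b) (c := c) (by exact_mod_cast S.size_pos b) hc (fun x => by
        constructor
        · intro hx
          have h1 := S.translate_mem_range_iterate H (-1) hx
          have h2 : S.translate (-1) (b, x + S.size b) = (b, x) := by simp [translate]
          rwa [h2] at h1
        · intro hx
          have h1 := S.translate_mem_range_iterate H 1 hx
          have h2 : S.translate 1 (b, x) = (b, x + S.size b) := by simp [translate]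
          rwa [h2] at h1)
    exact ⟨e, n, h1, h2, h3, h4⟩
  choose e n hn hmono hrange hper using henum
  have hmem : ∀ b x, (b, e b x) ∈ J := fun b x => by
    have : e b x ∈ {x | (b, x) ∈ J} := hrange b ▸ Set.mem_range_self x
    exact this
  have hex : ∀ b x, (b, x) ∈ J → ∃ i, e b i = x := fun b x hx => by
    have : x ∈ Set.range (e b) := hrange b ▸ hx
    exact this
  have hφ : ∀ b x, ∃ y, e (!b) y = S.father b (e b x) := fun b x => hex _ _ (hJup _ (hmem b x))
  -- the father map in terms of the indices
  choose φ hφ using hφ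
  have hφm : ∀ b, Monotone (φ b) := fun b x y hxy => by
    rw [← (hmono (!b)).le_iff_le, hφ, hφ]
    exact S.mono b ((hmono b).monotone hxy)
  have hφs : ∀ b, Function.Surjective (φ b) := fun b y => by
    obtain ⟨⟨b', x⟩, hu, hu2⟩ := hJson _ (hmem (!b) y)
    simp only [up, Prod.mk.injEq, Bool.not_inj_iff] at hu2
    obtain ⟨rfl, hu2⟩ := hu2
    obtain ⟨i, rfl⟩ := hex _ _ hu
    exact ⟨i, (hmono (!b')).injective (by rw [hφ, hu2])⟩
  have hφp : ∀ b x, φ b (x + n b) = φ b x + n (!b) := fun b x => by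
    apply (hmono (!b)).injective
    rw [hφ, hper, hper, hφ, S.periodic]
  -- monotone surjections in both directions force equal numbers of rows and columns
  have hle : ∀ b, n (!b) ≤ n b := fun b => by
    have := le_of_monotone_surjective (hφm b) (hφs b) 0 (n b)
    rw [hφp] at this
    omega
  have hnn : ∀ b, n b = n true := fun b => by
    cases b
    · exact le_antisymm (hle true) (hle false)
    · rfl
  have hshift : ∀ b x, φ b x = x + φ b 0 := fun b =>
    eq_shift_of_monotone_surjective (hφm b) (hφs b) (hn true) (fun x => by
      have := hφp b x
      rwa [hnn b, hnn (!b)] at this)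
  refine ⟨n true, φ true 0 + φ false 0, fun b i => e b (i + if b then φ false 0 else 0), hn true,
    fun b x y hxy => hmono b (by omega), fun b i => ?_, fun b i => ?_, H, fun v => ?_⟩
  · rw [add_right_comm, ← hnn b, hper]
  · rw [← hφ, hshift]
    congr 1
    cases b <;> simp
    ring
  · obtain ⟨i, hi⟩ := hex _ _ (show ((S.up^[H] v).1, (S.up^[H] v).2) ∈ J from ⟨v, rfl⟩)
    exact ⟨i - if (S.up^[H] v).1 then φ false 0 else 0, by simpa using hi⟩

variable {S}

namespace IsTrunk

variable {l l' : ℕ} {k k' : ℤ} {f f' : Bool → ℤ → ℤ}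

/-- The father map is bijective on the trunk, so trunk vertices have descendants of every order. -/
theorem mem_range_iterate (h : S.IsTrunk l k f) {v : Bool × ℤ} (hv : v.2 ∈ Set.range (f v.1))
    (j : ℕ) : v ∈ Set.range S.up^[j] := by
  induction j generalizing v with
  | zero => exact ⟨v, rfl⟩
  | succ j ih =>
    obtain ⟨i, hi⟩ := hv
    obtain ⟨w, hw⟩ := ih (v := (!v.1, f (!v.1) (i - turn k (!v.1)))) ⟨_, rfl⟩
    refine ⟨w, ?_⟩
    rw [Function.iterate_succ_apply', hw]
    simp [up, h.father, hi]

/-- The trunk consists of the vertices that have descendants of all orders. -/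
theorem mem_iff (h : S.IsTrunk l k f) (b : Bool) (x : ℤ) :
    x ∈ Set.range (f b) ↔ ∀ j, (b, x) ∈ Set.range S.up^[j] := by
  refine ⟨fun hx j => h.mem_range_iterate (v := (b, x)) hx j, fun hx => ?_⟩
  obtain ⟨H, hH⟩ := h.absorbing
  obtain ⟨u, hu⟩ := hx H
  have := hH u
  rwa [hu] at this

/-- The trunk is determined by the forest, up to the origin of the numbering of its components. -/
theorem unique (h : S.IsTrunk l k f) (h' : S.IsTrunk l' k' f') :
    l = l' ∧ k = k' ∧ ∃ s, ∀ b i, f' b i = f b (i + s) := by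
  have hr : ∀ b, Set.range (f b) = Set.range (f' b) := fun b => by
    ext x
    rw [h.mem_iff, h'.mem_iff]
  choose s hs using fun b => strictMono_eq_shift_of_range_eq (h.strictMono b) (h'.strictMono b) (hr b)
  have hl : (l : ℤ) = l' := by
    have h1 := h'.periodic true 0
    rw [hs, hs, ← h.periodic] at h1
    have := (h.strictMono true).injective h1
    omega
  have hk : ∀ b, turn k' b + s (!b) = s b + turn k b := fun b => by
    have h1 := h'.father b 0
    rw [hs, hs, h.father] at h1
    have := (h.strictMono _).injective h1
    omega
  have h1 := hk true
  have h2 := hk false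
  simp only [turn_true, turn_false, Bool.not_true, Bool.not_false] at h1 h2
  refine ⟨by exact_mod_cast hl, by omega, s true, fun b i => ?_⟩
  rw [hs]
  cases b
  · rw [show s false = s true by omega]
  · rfl

theorem shift_index (h : S.IsTrunk l k f) (s : ℤ) : S.IsTrunk l k (fun b i => f b (i + s)) where
  l_pos := h.l_pos
  strictMono b x y hxy := h.strictMono b (by omega)
  periodic b i := by rw [add_right_comm, h.periodic]
  father b i := by rw [h.father]; congr 1; ring
  absorbing := by
    obtain ⟨H, hH⟩ := h.absorbing
    refine ⟨H, fun v => ?_⟩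
    obtain ⟨i, hi⟩ := hH v
    exact ⟨i - s, by simpa using hi⟩

/-- The trunk moves forward exactly when all columns do. -/
theorem one_le_iff (h : S.IsTrunk l k f) :
    1 ≤ k ↔ ∀ x, x < S.father false (S.father true x) := by
  have h2 : ∀ i, S.father false (S.father true (f true i)) = f true (i + k) := fun i => by
    rw [h.father, Bool.not_true, h.father]; simp
  constructor
  · intro hk x
    by_contra! hx
    have hm : Monotone fun x => S.father false (S.father true x) :=
      (S.mono false).comp (S.mono true)
    set g := fun x => S.father false (S.father true x) with hg
    -- the orbit of `x` stays below `x`, although it dominates an unbounded trunk orbit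
    have h3 : ∀ j : ℕ, g^[j] x ≤ x := fun j => by
      induction j with
      | zero => simp
      | succ j ih =>
        rw [Function.iterate_succ_apply']
        exact (hm ih).trans hx
    obtain ⟨i, hi⟩ := exists_lt_of_quasiperiodic (h.periodic true) (by exact_mod_cast S.size_pos true) x
    have h4 : ∀ j : ℕ, f true i + j ≤ g^[j] x := fun j => by
      have h5 : ∀ j : ℕ, g^[j] (f true i) = f true (i + k * j) := fun j => by
        induction j with
        | zero => simp
        | succ j ih =>
          rw [Function.iterate_succ_apply', ih]
          simp only [hg, h2]
          congr 1
          push_cast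
          ring
      have h6 := hm.iterate j hi.le
      rw [h5] at h6
      have h7 := strictMono_int_add_le (h.strictMono true) i j
      have h8 : f true (i + j) ≤ f true (i + k * j) := (h.strictMono true).monotone (by nlinarith)
      omega
    have h9 := h3 (x - f true i + 1).toNat
    have h10 := h4 (x - f true i + 1).toNat
    omega
  · intro hx
    have := hx (f true 0)
    rw [h2] at this
    have := (h.strictMono true).lt_iff_lt.1 this
    omega

end IsTrunk

/-- Translation of the indices of columns and rows. -/
def shift (S : CyclicForest) (a : Bool → ℤ) : CyclicForest where
  size := S.size
  father b x := S.father b (x + a b) - a (!b)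
  size_pos := S.size_pos
  mono b x y hxy := by
    have := S.mono b (show x + a b ≤ y + a b by omega)
    simpa using this
  periodic b x := by
    rw [add_right_comm, S.periodic]
    ring

theorem shift_up_iterate (a : Bool → ℤ) (j : ℕ) (v : Bool × ℤ) :
    ((S.shift a).up^[j] v) = ((S.up^[j] (v.1, v.2 + a v.1)).1,
      (S.up^[j] (v.1, v.2 + a v.1)).2 - a (S.up^[j] (v.1, v.2 + a v.1)).1) := by
  induction j with
  | zero => simp
  | succ j ih =>
    rw [Function.iterate_succ_apply', ih, Function.iterate_succ_apply']
    simp [up, shift]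

theorem IsTrunk.shift {l : ℕ} {k : ℤ} {f : Bool → ℤ → ℤ} (h : S.IsTrunk l k f) (a : Bool → ℤ) :
    (S.shift a).IsTrunk l k (fun b i => f b i - a b) where
  l_pos := h.l_pos
  strictMono b x y hxy := by
    have := h.strictMono b hxy
    simpa using this
  periodic b i := by
    rw [h.periodic]
    simp only [CyclicForest.shift]
    ring
  father b i := by
    simp [CyclicForest.shift, h.father]
  absorbing := by
    obtain ⟨H, hH⟩ := h.absorbing
    refine ⟨H, fun v => ?_⟩
    rw [shift_up_iterate]
    obtain ⟨i, hi⟩ := hH (v.1, v.2 + a v.1)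
    exact ⟨i, by simp only [hi]⟩

end CyclicForest
end PPP

namespace PPP

open Step

/-! ### Lattice paths and their height sequences -/

@[simp] theorem eastHeight_nil (x : ℕ) : eastHeight [] x = 0 := rfl
@[simp] theorem eastHeight_north (p : List Step) (x : ℕ) :
    eastHeight (N :: p) x = eastHeight p x + 1 := by cases x <;> rfl
@[simp] theorem eastHeight_east_zero (p : List Step) : eastHeight (E :: p) 0 = 0 := rfl
@[simp] theorem eastHeight_east_succ (p : List Step) (x : ℕ) :
    eastHeight (E :: p) (x + 1) = eastHeight p x := rfl

theorem eastHeight_of_count_le (p : List Step) {x : ℕ} (h : p.count E ≤ x) :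
    eastHeight p x = p.count N := by
  induction p generalizing x with
  | nil => rfl
  | cons s p ih =>
    cases s
    · simp at h ⊢
      exact ih h
    · cases x with
      | zero => simp at h
      | succ x =>
        simp at h ⊢
        exact ih h

theorem eastHeight_le_succ (p : List Step) (x : ℕ) : eastHeight p x ≤ eastHeight p (x + 1) := by
  induction p generalizing x with
  | nil => rfl
  | cons s p ih =>
    cases s
    · simpa using ih x
    · cases x with
      | zero => simp
      | succ x => simpa using ih x

theorem eastHeight_mono (p : List Step) : Monotone (eastHeight p) :=
  monotone_nat_of_le_succ (eastHeight_le_succ p)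

theorem eastHeight_le (p : List Step) (x : ℕ) : eastHeight p x ≤ p.count N := by
  rw [← eastHeight_of_count_le p (le_max_right x (p.count E))]
  exact eastHeight_mono p (le_max_left _ _)

@[simp] theorem eastHeight_replicate_append (a : ℕ) (p : List Step) (x : ℕ) :
    eastHeight (List.replicate a N ++ p) x = a + eastHeight p x := by
  induction a with
  | zero => simp
  | succ a ih => simp [List.replicate_succ, ih]; omega

theorem eastHeight_replicate_east (a b x : ℕ) :
    eastHeight (List.replicate b E ++ List.replicate a N) x = if x < b then 0 else a := by
  induction b generalizing x with
  | zero =>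
    have := eastHeight_replicate_append a [] x
    simpa using this
  | succ b ih =>
    cases x with
    | zero => simp [List.replicate_succ]
    | succ x => simp [List.replicate_succ, ih]

/-- A lattice path is determined by the heights of its East steps and their number. -/
theorem path_ext {p q : List Step} (hc : p.count E = q.count E)
    (h : ∀ x, eastHeight p x = eastHeight q x) : p = q := by
  induction p generalizing q with
  | nil =>
    cases q with
    | nil => rfl
    | cons s q =>
      cases s
      · have := h 0
        simp at this
      · simp at hc
  | cons s p ih =>
    cases s
    · cases q with
      | nil => have := h 0; simp at this
      | cons s q =>
        cases s
        · rw [ih (by simpa using hc) (fun x => by simpa using h x)]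
        · have := h 0; simp at this
    · cases q with
      | nil => simp at hc
      | cons s q =>
        cases s
        · have := h 0; simp at this
        · rw [ih (by simpa using hc) (fun x => by simpa using h (x + 1))]

/-- Every monotone sequence of heights, constant from `w` on, is that of a path with `w` East steps; its
value at `w` is the total number of North steps. -/
theorem exists_path (w : ℕ) (h : ℕ → ℕ) (hm : Monotone h) (hw : ∀ x, w ≤ x → h x = h w) :
    ∃ p : List Step, p.count E = w ∧ (∀ x, eastHeight p x = h x) ∧ p.count N = h w := by
  suffices ∃ p : List Step, p.count E = w ∧ ∀ x, eastHeight p x = h x by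
    obtain ⟨p, h1, h2⟩ := this
    exact ⟨p, h1, h2, by rw [← eastHeight_of_count_le p h1.le, h2]⟩
  induction w generalizing h with
  | zero =>
    refine ⟨List.replicate (h 0) N, by simp [List.count_replicate], fun x => ?_⟩
    have := eastHeight_replicate_append (h 0) [] x
    rw [hw x (Nat.zero_le x)]
    simpa using this
  | succ w ih =>
    obtain ⟨p, h1, h2⟩ := ih (fun x => h (x + 1) - h 0)
      (fun x y hxy => Nat.sub_le_sub_right (hm (by omega)) _)
      (fun x hx => by simp only [hw (x + 1) (by omega)])
    refine ⟨List.replicate (h 0) N ++ E :: p, by simp [List.count_replicate, h1], fun x => ?_⟩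
    rw [eastHeight_replicate_append]
    cases x with
    | zero => simp
    | succ x =>
      have := hm (Nat.zero_le (x + 1))
      simp only [eastHeight_east_succ, h2]
      omega

theorem pointAt_add (p : List Step) {i : ℕ} (hi : i ≤ p.length) :
    (pointAt p i).1 + (pointAt p i).2 = i := by
  have : ∀ q : List Step, q.count E + q.count N = q.length := by
    intro q
    induction q with
    | nil => rfl
    | cons s q ih => cases s <;> simp <;> omega
  simp [pointAt, this, hi]

theorem pointAt_length (p : List Step) : pointAt p p.length = (p.count E, p.count N) := by
  simp [pointAt]

/-- The lattice points on a path: those of abscissa `x` lie between two consecutive East steps. -/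
theorem exists_pointAt_eq_iff (p : List Step) (x y : ℕ) :
    (∃ i ≤ p.length, pointAt p i = (x, y)) ↔
      x ≤ p.count E ∧ (∀ x', x = x' + 1 → eastHeight p x' ≤ y) ∧ y ≤ eastHeight p x := by
  induction p generalizing x y with
  | nil =>
    simp only [pointAt, List.length_nil, Nat.le_zero_eq, List.take_nil, List.count_nil,
      exists_eq_left, eastHeight_nil, Prod.mk.injEq]
    constructor
    · rintro ⟨rfl, rfl⟩; simp
    · rintro ⟨h1, -, h2⟩; omega
  | cons s p ih =>
    have key : (∃ i ≤ (s :: p).length, pointAt (s :: p) i = (x, y)) ↔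
        (x = 0 ∧ y = 0) ∨ ∃ i ≤ p.length, pointAt (s :: p) (i + 1) = (x, y) := by
      constructor
      · rintro ⟨i, hi, h⟩
        cases i with
        | zero =>
          simp [pointAt] at h
          exact Or.inl ⟨h.1.symm, h.2.symm⟩
        | succ i => exact Or.inr ⟨i, by simpa using hi, h⟩
      · rintro (⟨rfl, rfl⟩ | ⟨i, hi, h⟩)
        · exact ⟨0, by simp, by simp [pointAt]⟩
        · exact ⟨i + 1, by simpa using hi, h⟩
    rw [key]
    cases s
    · have : (∃ i ≤ p.length, pointAt (N :: p) (i + 1) = (x, y)) ↔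
          ∃ y', y = y' + 1 ∧ ∃ i ≤ p.length, pointAt p i = (x, y') := by
        constructor
        · rintro ⟨i, hi, h⟩
          simp [pointAt] at h
          exact ⟨_, h.2.symm, i, hi, by simp [pointAt, h.1]⟩
        · rintro ⟨y', rfl, i, hi, h⟩
          simp [pointAt] at h
          exact ⟨i, hi, by simp [pointAt, h.1, h.2]⟩
      rw [this]
      simp only [ih, eastHeight_north]
      constructor
      · rintro (⟨rfl, rfl⟩ | ⟨y', rfl, h1, h2, h3⟩)
        · simp
        · refine ⟨by simpa using h1, fun x' hx' => ?_, by omega⟩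
          have := h2 x' hx'
          omega
      · rintro ⟨h1, h2, h3⟩
        cases y with
        | zero =>
          left
          refine ⟨?_, rfl⟩
          by_contra hx
          have := h2 (x - 1) (by omega)
          omega
        | succ y =>
          right
          refine ⟨y, rfl, by simpa using h1, fun x' hx' => ?_, by omega⟩
          have := h2 x' hx'
          omega
    · have : (∃ i ≤ p.length, pointAt (E :: p) (i + 1) = (x, y)) ↔
          ∃ x', x = x' + 1 ∧ ∃ i ≤ p.length, pointAt p i = (x', y) := by
        constructor
        · rintro ⟨i, hi, h⟩
          simp [pointAt] at h
          exact ⟨_, h.1.symm, i, hi, by simp [pointAt, h.2]⟩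
        · rintro ⟨x', rfl, i, hi, h⟩
          simp [pointAt] at h
          exact ⟨i, hi, by simp [pointAt, h.1, h.2]⟩
      rw [this]
      simp only [ih]
      constructor
      · rintro (⟨rfl, rfl⟩ | ⟨x', rfl, h1, h2, h3⟩)
        · simp
        · refine ⟨by simpa using h1, fun x'' hx'' => ?_, by simpa using h3⟩
          obtain rfl : x' = x'' := by omega
          cases x' with
          | zero => simp
          | succ x => simpa using h2 x rfl
      · rintro ⟨h1, h2, h3⟩
        cases x with
        | zero =>
          left
          simpa using h3
        | succ x =>
          right
          refine ⟨x, rfl, by simpa using h1, ?_, by simpa using h3⟩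
          rintro x' rfl
          simpa using h2 _ rfl

/-! ### Parallelogram polyominoes and their column heights -/

namespace ParallelogramPolyomino

variable (P : ParallelogramPolyomino)

theorem count_lower : P.lower.count E = P.width ∧ P.lower.count N = P.numRows := by
  have := P.same_end
  rw [pointAt_length, pointAt_length, Prod.mk.injEq] at this
  exact ⟨this.1.symm, this.2.symm⟩

theorem width_pos : 0 < P.width := by
  rw [← P.count_lower.1]
  have := P.lower_start
  cases h : P.lower with
  | nil => simp [h] at this
  | cons s p =>
    rw [h] at this
    simp at this
    simp [this]

theorem bot_zero : P.bot 0 = 0 := by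
  have := P.lower_start
  cases h : P.lower with
  | nil => simp [h] at this
  | cons s p =>
    rw [h] at this
    simp at this
    simp [bot, h, this]

theorem top_mono : Monotone P.top := eastHeight_mono _

theorem bot_mono : Monotone P.bot := eastHeight_mono _

theorem top_le (x : ℕ) : P.top x ≤ P.numRows := eastHeight_le _ _

theorem top_of_width_le {x : ℕ} (h : P.width ≤ x) : P.top x = P.numRows :=
  eastHeight_of_count_le _ h

theorem bot_of_width_le {x : ℕ} (h : P.width ≤ x) : P.bot x = P.numRows := by
  rw [← P.count_lower.2]
  exact eastHeight_of_count_le _ (P.count_lower.1 ▸ h)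

/-- A lattice point on both paths is one of their end points; the hypotheses say, by
`exists_pointAt_eq_iff`, that `(x, y)` is on the upper and on the lower path. -/
theorem meet {x y : ℕ} (h1 : x ≤ P.width) (h2 : ∀ x', x = x' + 1 → P.top x' ≤ y)
    (h3 : y ≤ P.top x) (h4 : ∀ x', x = x' + 1 → P.bot x' ≤ y) (h5 : y ≤ P.bot x) :
    (x = 0 ∧ y = 0) ∨ (x = P.width ∧ y = P.numRows) := by
  obtain ⟨i, hi, hi'⟩ := (exists_pointAt_eq_iff P.upper x y).2 ⟨h1, h2, h3⟩
  obtain ⟨j, hj, hj'⟩ := (exists_pointAt_eq_iff P.lower x y).2 ⟨P.count_lower.1 ▸ h1, h4, h5⟩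
  rcases P.meet_only_at_ends i hi j hj (hi'.trans hj'.symm) with ⟨rfl, -⟩ | ⟨rfl, -⟩
  · simp [pointAt] at hi'
    exact Or.inl ⟨hi'.1.symm, hi'.2.symm⟩
  · rw [pointAt_length, Prod.mk.injEq] at hi'
    exact Or.inr ⟨hi'.1.symm, hi'.2.symm⟩

/-- Consecutive columns share an edge. -/
theorem bot_succ_lt_top {x : ℕ} (h : x + 1 < P.width) : P.bot (x + 1) < P.top x := by
  induction x with
  | zero =>
    by_contra! hc
    have := P.meet (x := 1) (y := P.top 0) h.le
      (by rintro x' hx; obtain rfl : x' = 0 := by omega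
          exact le_rfl)
      (P.top_mono (by simp))
      (by rintro x' hx; obtain rfl : x' = 0 := by omega
          rw [P.bot_zero]; exact Nat.zero_le _) hc
    omega
  | succ x ih =>
    by_contra! hc
    have h1 := ih (by omega)
    have h2 := P.top_mono (show x ≤ x + 1 by omega)
    have := P.meet (x := x + 1 + 1) (y := P.top (x + 1)) h.le
      (by rintro x' hx; obtain rfl : x' = x + 1 := by omega
          exact le_rfl)
      (P.top_mono (by simp))
      (by
        rintro x' hx
        obtain rfl : x + 1 = x' := by omega
        omega) hc
    omega

end ParallelogramPolyomino

namespace PeriodicPP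

variable (P : PeriodicPP)

/-- The upper path ends with an East step. -/
theorem top_width_sub_one : P.top (P.width - 1) = P.numRows := by
  have h0 := P.width_pos
  have h1 := P.admissible
  have h2 := P.one_le_mark
  have := P.meet (x := P.width) (y := P.top (P.width - 1)) le_rfl
    (by
      rintro x' hx
      obtain rfl : P.width - 1 = x' := by omega
      rfl)
    (P.top_mono (by simp))
    (by
      rintro x' hx
      obtain rfl : P.width - 1 = x' := by omega
      omega)
    (by rw [P.bot_of_width_le le_rfl]; exact P.top_le _)
  omega

theorem height_add_mark : P.height + P.mark = P.numRows := by
  have := P.mark_le_top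
  have := P.top_le 0
  unfold height
  omega

/-- The height vanishes only if the marked cell is in the top row, which forces a rectangle. -/
theorem height_pos (h : ¬ P.IsDegenerate) : 0 < P.height := by
  by_contra! h0
  apply h
  have h1 := P.height_add_mark
  have h2 := P.mark_le_top
  have h3 := P.top_le 0
  have h4 := P.admissible
  have h5 := P.top_width_sub_one
  have h6 := P.width_pos
  have h7 := P.one_le_mark
  have ht : ∀ x, P.top x = P.numRows := fun x => by
    have := P.top_mono (Nat.zero_le x)
    have := P.top_le x
    omega
  have hb : ∀ x < P.width, P.bot x = 0 := fun x hx => by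
    have := P.bot_mono (show x ≤ P.width - 1 by omega)
    omega
  refine ⟨⟨P.numRows, P.width, path_ext ?_ fun x => ?_, path_ext ?_ fun x => ?_⟩, by omega⟩
  · simp [List.count_replicate, ParallelogramPolyomino.width]
  · have h := ht x
    have h' := eastHeight_replicate_east 0 P.width x
    simp at h'
    simp only [ParallelogramPolyomino.top] at h
    simp [h, h']
  · simp [List.count_replicate, P.count_lower.1]
  · rw [eastHeight_replicate_east]
    split_ifs with hx
    · exact hb x hx
    · exact P.bot_of_width_le (not_lt.1 hx)

theorem not_isDegenerate (h : 0 < P.height) : ¬ P.IsDegenerate := by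
  rintro ⟨⟨a, b, h1, h2⟩, h3⟩
  have h4 := P.height_add_mark
  have h5 : P.top 0 = a := by
    have h' := eastHeight_replicate_east 0 b 0
    simp at h'
    simp [ParallelogramPolyomino.top, h1, h']
  have h6 : P.numRows = a := by simp [ParallelogramPolyomino.numRows, h1, List.count_replicate]
  omega

end PeriodicPP
end PPP

namespace PPP

open Step

namespace PeriodicPP

variable (P : PeriodicPP)

/-! ### The columns of the infinite strip -/

/-- Column `X` of the strip consists of the cells `(X, Y)` with `P.stripBot X ≤ Y < P.stripTop X`. -/
def stripTop (X : ℤ) : ℤ := P.top (X % P.width).toNat + P.height * (X / P.width)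

/-- Column `X` of the strip consists of the cells `(X, Y)` with `P.stripBot X ≤ Y < P.stripTop X`. -/
def stripBot (X : ℤ) : ℤ := P.bot (X % P.width).toNat + P.height * (X / P.width)

theorem stripTop_eq {r : ℕ} (hr : r < P.width) (q : ℤ) :
    P.stripTop (r + P.width * q) = P.top r + P.height * q := by
  have h : (0 : ℤ) < P.width := by exact_mod_cast P.width_pos
  simp only [stripTop]
  rw [Int.add_mul_emod_self_left, Int.add_mul_ediv_left _ _ h.ne',
    Int.emod_eq_of_lt (by omega) (by omega), Int.ediv_eq_zero_of_lt (by omega) (by omega)]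
  simp

theorem stripBot_eq {r : ℕ} (hr : r < P.width) (q : ℤ) :
    P.stripBot (r + P.width * q) = P.bot r + P.height * q := by
  have h : (0 : ℤ) < P.width := by exact_mod_cast P.width_pos
  simp only [stripBot]
  rw [Int.add_mul_emod_self_left, Int.add_mul_ediv_left _ _ h.ne',
    Int.emod_eq_of_lt (by omega) (by omega), Int.ediv_eq_zero_of_lt (by omega) (by omega)]
  simp

theorem exists_column (X : ℤ) : ∃ (r : ℕ) (q : ℤ), r < P.width ∧ X = r + P.width * q := by
  obtain ⟨q, r, h0, h1, h2⟩ :=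
    exists_window (a := P.width) (by exact_mod_cast P.width_pos) 0 X
  exact ⟨r.toNat, q, by omega, by rw [Int.toNat_of_nonneg h0, h2]⟩

theorem stripTop_natCast {r : ℕ} (hr : r < P.width) : P.stripTop r = P.top r := by
  simpa using P.stripTop_eq hr 0

theorem stripBot_natCast {r : ℕ} (hr : r < P.width) : P.stripBot r = P.bot r := by
  simpa using P.stripBot_eq hr 0

theorem stripTop_periodic (X : ℤ) : P.stripTop (X + P.width) = P.stripTop X + P.height := by
  obtain ⟨r, q, hr, rfl⟩ := P.exists_column X
  rw [show (r : ℤ) + P.width * q + P.width = r + P.width * (q + 1) by ring, P.stripTop_eq hr,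
    P.stripTop_eq hr]
  ring

theorem stripBot_periodic (X : ℤ) : P.stripBot (X + P.width) = P.stripBot X + P.height := by
  obtain ⟨r, q, hr, rfl⟩ := P.exists_column X
  rw [show (r : ℤ) + P.width * q + P.width = r + P.width * (q + 1) by ring, P.stripBot_eq hr,
    P.stripBot_eq hr]
  ring

theorem stripBot_zero : P.stripBot 0 = 0 := by
  have := P.stripBot_natCast P.width_pos
  simpa [P.bot_zero] using this

/-- Consecutive columns of the strip: the last column of a copy is followed by the first column of
the next copy. -/
theorem strip_step (X : ℤ) : P.stripTop X ≤ P.stripTop (X + 1) ∧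
    P.stripBot X ≤ P.stripBot (X + 1) ∧ P.stripBot (X + 1) < P.stripTop X := by
  obtain ⟨r, q, hr, rfl⟩ := P.exists_column X
  by_cases h : r + 1 < P.width
  · have e : (r : ℤ) + P.width * q + 1 = ((r + 1 : ℕ) : ℤ) + P.width * q := by push_cast; ring
    rw [e, P.stripTop_eq hr, P.stripTop_eq h, P.stripBot_eq hr, P.stripBot_eq h]
    have h1 := P.top_mono (show r ≤ r + 1 by omega)
    have h2 := P.bot_mono (show r ≤ r + 1 by omega)
    have h3 := P.bot_succ_lt_top h
    omega
  · have hw := P.width_pos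
    have hr' : r = P.width - 1 := by omega
    have e : (r : ℤ) + P.width * q + 1 = ((0 : ℕ) : ℤ) + P.width * (q + 1) := by
      rw [mul_add, hr']
      push_cast [Nat.cast_sub (show 1 ≤ P.width from hw)]
      ring
    rw [e, P.stripTop_eq hr, P.stripTop_eq hw, P.stripBot_eq hr, P.stripBot_eq hw, hr',
      P.top_width_sub_one, P.bot_zero, mul_add, mul_one]
    have h1 := P.height_add_mark
    have h2 := P.mark_le_top
    have h3 := P.admissible
    have h4 := P.top_width_sub_one
    have h5 := P.one_le_mark
    omega

theorem stripTop_mono : Monotone P.stripTop := monotone_int_of_le_succ fun X => (P.strip_step X).1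

theorem stripBot_mono : Monotone P.stripBot := monotone_int_of_le_succ fun X => (P.strip_step X).2.1

theorem mem_strip (X Y : ℤ) : (X, Y) ∈ P.strip ↔ P.stripBot X ≤ Y ∧ Y < P.stripTop X := by
  constructor
  · rintro ⟨q, ⟨x, y⟩, ⟨h1, h2, h3⟩, h⟩
    simp only [Prod.mk.injEq] at h h1 h2 h3
    obtain ⟨rfl, rfl⟩ := h
    rw [mul_comm q, P.stripTop_eq h1, P.stripBot_eq h1, mul_comm q]
    omega
  · obtain ⟨r, q, hr, rfl⟩ := P.exists_column X
    rw [P.stripTop_eq hr, P.stripBot_eq hr]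
    rintro ⟨h1, h2⟩
    refine ⟨q, (r, (Y - P.height * q).toNat), ⟨hr, ?_, ?_⟩, ?_⟩
    · simp only; omega
    · simp only; omega
    · simp only [Prod.mk.injEq]
      have : 0 ≤ Y - P.height * q := by omega
      rw [Int.toNat_of_nonneg this]
      constructor <;> ring

end PeriodicPP

namespace NondegeneratePPP

theorem height_pos (P : NondegeneratePPP) : 0 < P.1.height := P.1.height_pos P.2

theorem exists_rowEnd (P : NondegeneratePPP) :
    ∃ up : ℤ → ℤ, ∀ Y X, X ≤ up Y ↔ P.1.stripBot X ≤ Y :=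
  exists_upperAdjoint P.1.stripBot_mono P.1.stripBot_periodic (by exact_mod_cast P.height_pos)

/-- The column of the rightmost cell of row `Y` of the strip. -/
noncomputable def rowEnd (P : NondegeneratePPP) : ℤ → ℤ := P.exists_rowEnd.choose

theorem le_rowEnd (P : NondegeneratePPP) (X Y : ℤ) : X ≤ P.rowEnd Y ↔ P.1.stripBot X ≤ Y :=
  P.exists_rowEnd.choose_spec Y X

/-- The father maps of the strip of a non-degenerated periodic parallelogram polyomino. -/
noncomputable def forest (P : NondegeneratePPP) : CyclicForest where
  size b := if b then P.1.width else P.1.height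
  father b x := if b then P.1.stripTop x - 1 else P.rowEnd x
  size_pos b := by
    cases b
    · exact P.height_pos
    · exact P.1.width_pos
  mono b := by
    cases b
    · intro x y hxy
      simp only [Bool.false_eq_true, if_false]
      rw [P.le_rowEnd]
      exact ((P.le_rowEnd _ _).1 le_rfl).trans hxy
    · intro x y hxy
      have := P.1.stripTop_mono hxy
      simp only [if_true]
      omega
  periodic b x := by
    cases b
    · simp only [Bool.false_eq_true, if_false, Bool.not_false, if_true]
      refine le_antisymm ?_ ?_
      · rw [← sub_le_iff_le_add, P.le_rowEnd]
        have h1 := (P.le_rowEnd _ _).1 (le_refl (P.rowEnd (x + P.1.height)))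
        have h2 := P.1.stripBot_periodic (P.rowEnd (x + P.1.height) - P.1.width)
        rw [sub_add_cancel] at h2
        omega
      · rw [P.le_rowEnd, P.1.stripBot_periodic]
        have := (P.le_rowEnd _ _).1 (le_refl (P.rowEnd x))
        omega
    · simp only [if_true, Bool.not_true, Bool.false_eq_true, if_false]
      rw [P.1.stripTop_periodic]
      ring

@[simp] theorem forest_size_true (P : NondegeneratePPP) : P.forest.size true = P.1.width := rfl
@[simp] theorem forest_size_false (P : NondegeneratePPP) : P.forest.size false = P.1.height := rfl
theorem forest_father_true (P : NondegeneratePPP) (X : ℤ) :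
    P.forest.father true X = P.1.stripTop X - 1 := rfl
theorem le_forest_father_false (P : NondegeneratePPP) (X Y : ℤ) :
    X ≤ P.forest.father false Y ↔ P.1.stripBot X ≤ Y := P.le_rowEnd X Y

/-- Consecutive columns of the strip share an edge, so the top row of a column reaches the next one. -/
theorem forest_expanding (P : NondegeneratePPP) (X : ℤ) :
    X < P.forest.father false (P.forest.father true X) := by
  rw [← Int.add_one_le_iff, le_forest_father_false, forest_father_true]
  have := (P.1.strip_step X).2.2
  omega

/-- Row `0` is the bottom row of column `0`. -/
theorem forest_normalized (P : NondegeneratePPP) (Y : ℤ) :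
    0 ≤ P.forest.father false Y ↔ 0 ≤ Y := by
  rw [le_forest_father_false, P.1.stripBot_zero]

/-- The father maps give the tops and the bottoms of all columns of the strip, hence both paths, and
the height gives the mark. -/
theorem forest_injective : Function.Injective forest := by
  intro P P' h
  have hw : P.1.width = P'.1.width := congrArg (fun S => S.size true) h
  have hh : P.1.height = P'.1.height := congrArg (fun S => S.size false) h
  have ht : ∀ X, P.1.stripTop X = P'.1.stripTop X := fun X => by
    have : P.forest.father true X = P'.forest.father true X := by rw [h]
    rw [forest_father_true, forest_father_true] at this
    omega
  have hb : ∀ X, P.1.stripBot X = P'.1.stripBot X := fun X => by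
    apply le_antisymm
    · rw [← le_forest_father_false, h, le_forest_father_false]
    · rw [← le_forest_father_false, ← h, le_forest_father_false]
  have ht' : ∀ x < P.1.width, P.1.top x = P'.1.top x := fun x hx => by
    have := ht x
    rw [P.1.stripTop_natCast hx, P'.1.stripTop_natCast (hw ▸ hx)] at this
    exact_mod_cast this
  have hb' : ∀ x < P.1.width, P.1.bot x = P'.1.bot x := fun x hx => by
    have := hb x
    rw [P.1.stripBot_natCast hx, P'.1.stripBot_natCast (hw ▸ hx)] at this
    exact_mod_cast this
  have hn : P.1.numRows = P'.1.numRows := by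
    rw [← P.1.top_width_sub_one, ← P'.1.top_width_sub_one, ← hw]
    exact ht' _ (by have := P.1.width_pos; omega)
  have hm : P.1.mark = P'.1.mark := by
    have h1 := P.1.height_add_mark
    have h2 := P'.1.height_add_mark
    omega
  have hu : P.1.upper = P'.1.upper := by
    refine path_ext hw fun x => ?_
    by_cases hx : x < P.1.width
    · exact ht' x hx
    · exact (P.1.top_of_width_le (not_lt.1 hx)).trans
        (hn.trans (P'.1.top_of_width_le (hw ▸ not_lt.1 hx)).symm)
  have hl : P.1.lower = P'.1.lower := by
    refine path_ext (P.1.count_lower.1.trans (hw.trans P'.1.count_lower.1.symm)) fun x => ?_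
    by_cases hx : x < P.1.width
    · exact hb' x hx
    · exact (P.1.bot_of_width_le (not_lt.1 hx)).trans
        (hn.trans (P'.1.bot_of_width_le (hw ▸ not_lt.1 hx)).symm)
  exact Subtype.ext (PeriodicPP.ext hu hl hm)

end NondegeneratePPP

theorem head?_of_eastHeight_pos {p : List Step} (h : 0 < eastHeight p 0) : p.head? = some N := by
  cases p with
  | nil => simp at h
  | cons s p =>
    cases s
    · rfl
    · simp at h

theorem head?_of_eastHeight_zero {p : List Step} (h : eastHeight p 0 = 0) (hc : 0 < p.count E) :
    p.head? = some E := by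
  cases p with
  | nil => simp at hc
  | cons s p =>
    cases s
    · simp at h
    · rfl

/-- Periodic sequences of column tops and bottoms come from a periodic parallelogram polyomino,
obtained by cutting the strip to the left of column `0`. -/
theorem exists_periodicPP {w h : ℕ} (hw : 0 < w) (hh : 0 < h) (T B : ℤ → ℤ) (hT : Monotone T)
    (hB : Monotone B) (hTp : ∀ X, T (X + w) = T X + h) (hBp : ∀ X, B (X + w) = B X + h)
    (hB0 : B 0 = 0) (hBT : ∀ X, B (X + 1) < T X) :
    ∃ P : NondegeneratePPP, P.1.width = w ∧ P.1.height = h ∧ P.1.stripTop = T ∧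
      P.1.stripBot = B := by
  have hT1 : 1 ≤ T (-1) := by
    have := hBT (-1)
    simp [hB0] at this
    omega
  have hTn : ∀ x : ℕ, 1 ≤ T x := fun x => hT1.trans (hT (by omega))
  have hBn : ∀ x : ℕ, 0 ≤ B x := fun x => hB0 ▸ hB (show (0 : ℤ) ≤ x by omega)
  have hw1 : ((w - 1 : ℕ) : ℤ) + 1 = w := by omega
  have hTw : T (w - 1 : ℕ) = T (-1) + h := by
    rw [← hTp]; congr 1; omega
  have hBw : B w = h := by
    have := hBp 0
    simpa [hB0] using this
  obtain ⟨u, hu1, hu2, hu3⟩ := exists_path w (fun x => (T (min x (w - 1) : ℕ)).toNat)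
    (fun x y hxy => Int.toNat_le_toNat (hT (by
      have : min x (w - 1) ≤ min y (w - 1) := min_le_min_right _ hxy
      exact_mod_cast this)))
    (fun x hx => by simp only [min_eq_right (show w - 1 ≤ x by omega),
      min_eq_right (show w - 1 ≤ w by omega)])
  obtain ⟨d, hd1, hd2, hd3⟩ := exists_path w
    (fun x => if x < w then (B x).toNat else (T (w - 1 : ℕ)).toNat)
    (fun x y hxy => by
      simp only
      split_ifs with h1 h2
      · exact Int.toNat_le_toNat (hB (by exact_mod_cast hxy))
      · have h3 : B x ≤ B w := hB (by exact_mod_cast h1.le)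
        have h4 := hBT (w - 1 : ℕ)
        rw [hw1] at h4
        omega
      · omega
      · exact le_rfl)
    (fun x hx => by simp [not_lt.2 hx])
  simp only [min_eq_right (show w - 1 ≤ w by omega)] at hu3
  simp only [lt_self_iff_false, if_false] at hd3
  have hu2' : ∀ x < w, eastHeight u x = (T x).toNat := fun x hx => by
    rw [hu2, min_eq_left (show x ≤ w - 1 by omega)]
  have hd2' : ∀ x < w, eastHeight d x = (B x).toNat := fun x hx => by rw [hd2, if_pos hx]
  let Q : ParallelogramPolyomino :=
    { upper := u
      lower := d
      upper_start := head?_of_eastHeight_pos (by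
        rw [hu2' 0 hw]
        have := hTn 0
        omega)
      lower_start := head?_of_eastHeight_zero (by rw [hd2' 0 hw]; simp [hB0]) (hd1 ▸ hw)
      same_end := by rw [pointAt_length, pointAt_length, hu1, hu3, hd1, hd3]
      meet_only_at_ends := by
        intro i hi j hj hij
        have hpi := pointAt_add u hi
        have hpj := pointAt_add d hj
        obtain ⟨x, y, hxy⟩ : ∃ x y, pointAt u i = (x, y) := ⟨_, _, rfl⟩
        obtain ⟨h1, h2, h3⟩ := (exists_pointAt_eq_iff u x y).1 ⟨i, hi, hxy⟩
        obtain ⟨h4, h5, h6⟩ := (exists_pointAt_eq_iff d x y).1 ⟨j, hj, hij ▸ hxy⟩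
        rw [← hij, hxy] at hpj
        rw [hxy] at hpi
        simp only at hpi hpj
        rw [hu1] at h1
        rcases Nat.eq_zero_or_pos x with rfl | hx
        · rw [hd2' 0 hw] at h6
          simp [hB0] at h6
          omega
        · obtain ⟨x, rfl⟩ : ∃ x', x = x' + 1 := ⟨x - 1, by omega⟩
          have h7 := h2 x rfl
          rw [hu2' x (by omega)] at h7
          rcases h1.lt_or_eq with hlt | heq
          · exfalso
            rw [hd2' _ hlt] at h6
            have h8 := hBT x
            have h9 := hTn x
            push_cast at h6
            omega
          · right
            obtain rfl : x = w - 1 := by omega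
            have hlu := pointAt_add u (le_refl u.length)
            have hld := pointAt_add d (le_refl d.length)
            rw [pointAt_length] at hlu hld
            simp only at hlu hld
            have h8 := eastHeight_le u (w - 1 + 1)
            omega }
  have hQw : Q.width = w := hu1
  have hQn : Q.numRows = (T (w - 1 : ℕ)).toNat := hu3
  have hQt : ∀ x < w, Q.top x = (T x).toNat := hu2'
  have hQb : ∀ x < w, Q.bot x = (B x).toNat := hd2'
  let P : PeriodicPP :=
    { toParallelogramPolyomino := Q
      mark := (T (-1)).toNat
      one_le_mark := by omega
      mark_le_top := by
        rw [hQt 0 hw]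
        exact Int.toNat_le_toNat (hT (by simp))
      admissible := by
        rw [hQw, hQt _ (by omega), hQb _ (by omega)]
        have h1 : B (w - 1 : ℕ) ≤ B w := hB (by omega)
        omega }
  have hPh : P.height = h := by
    change Q.numRows - (T (-1)).toNat = h
    rw [hQn]
    omega
  refine ⟨⟨P, P.not_isDegenerate (by omega)⟩, hQw, hPh, ?_, ?_⟩
  · funext X
    obtain ⟨r, q, hr, rfl⟩ := P.exists_column X
    rw [P.stripTop_eq hr, hPh]
    have hr' : r < w := hQw ▸ hr
    have e1 : P.width = w := hQw
    have e2 : P.top r = (T r).toNat := hQt r hr'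
    rw [e1, e2, quasiperiodic_mul hTp]
    have := hTn r
    omega
  · funext X
    obtain ⟨r, q, hr, rfl⟩ := P.exists_column X
    rw [P.stripBot_eq hr, hPh]
    have hr' : r < w := hQw ▸ hr
    have e1 : P.width = w := hQw
    have e2 : P.bot r = (B r).toNat := hQb r hr'
    rw [e1, e2, quasiperiodic_mul hBp]
    have := hBn r
    omega

theorem NondegeneratePPP.exists_forest_eq (S : CyclicForest)
    (h1 : ∀ X, X < S.father false (S.father true X)) (h2 : ∀ Y, 0 ≤ S.father false Y ↔ 0 ≤ Y) :
    ∃ P : NondegeneratePPP, P.forest = S := by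
  have hw := S.size_pos true
  have hh := S.size_pos false
  obtain ⟨B, hB⟩ := exists_lowerAdjoint (S.mono false) (S.periodic false) (by exact_mod_cast hw)
  obtain ⟨P, hP1, hP2, hP3, hP4⟩ := exists_periodicPP hw hh (fun X => S.father true X + 1) B
    (fun X Y hXY => by have := S.mono true hXY; simpa using this)
    (fun X Y hXY => (hB _ _).2 (hXY.trans ((hB _ _).1 le_rfl)))
    (fun X => by rw [S.periodic]; simp; ring)
    (fun X => by
      refine le_antisymm ?_ ?_
      · rw [hB, S.periodic, Bool.not_false, add_le_add_iff_right, ← hB]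
      · rw [← le_sub_iff_add_le, hB]
        have h3 := (hB _ _).1 (le_refl (B (X + S.size true)))
        have h4 := S.periodic false (B (X + S.size true) - S.size false)
        rw [sub_add_cancel, Bool.not_false] at h4
        omega)
    (le_antisymm ((hB _ _).2 ((h2 0).2 le_rfl)) ((h2 _).1 ((hB _ _).1 le_rfl)))
    (fun X => by
      have := (hB _ _).2 (Int.add_one_le_iff.2 (h1 X))
      omega)
  refine ⟨P, CyclicForest.ext ?_ ?_⟩
  · funext b
    cases b
    · exact hP2
    · exact hP1
  · funext b x
    cases b
    · refine le_antisymm ?_ ?_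
      · rw [← hB, ← hP4]
        exact (P.le_forest_father_false _ _).1 le_rfl
      · rw [P.le_forest_father_false, hP4, hB]
    · rw [P.forest_father_true, hP3]
      ring

end PPP

namespace PPP

open Step

namespace NondegeneratePPP

variable (P : NondegeneratePPP)

/-! ### Pruning and the intrinsic thickness -/

theorem isTopmost_iff (X Y : ℤ) : P.1.IsTopmost (X, Y) ↔ Y = P.forest.father true X := by
  have h := P.1.strip_step X
  rw [forest_father_true]
  simp only [PeriodicPP.IsTopmost, P.1.mem_strip]
  constructor
  · rintro ⟨h1, h2⟩
    have := h2 (P.1.stripTop X - 1) (by omega)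
    omega
  · rintro rfl
    exact ⟨by omega, fun y hy => by omega⟩

theorem isRightmost_iff (X Y : ℤ) : P.1.IsRightmost (X, Y) ↔ X = P.forest.father false Y := by
  have h1 := (P.le_forest_father_false _ Y).1 le_rfl
  have h2 := (P.le_forest_father_false (P.forest.father false Y + 1) Y).not.1 (by omega)
  have h3 := (P.1.strip_step (P.forest.father false Y)).2.2
  simp only [PeriodicPP.IsRightmost, P.1.mem_strip]
  constructor
  · rintro ⟨h4, h5⟩
    exact le_antisymm ((P.le_forest_father_false _ _).2 h4.1) (h5 _ ⟨h1, by omega⟩)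
  · rintro rfl
    exact ⟨⟨h1, by omega⟩, fun x hx => (P.le_forest_father_false _ _).2 hx.1⟩

/-- The cell that represents a vertex: the topmost cell of a column or the rightmost cell of a
row. -/
noncomputable def cell (v : Bool × ℤ) : ℤ × ℤ :=
  if v.1 then (v.2, P.forest.father true v.2) else (P.forest.father false v.2, v.2)

theorem isVertex_iff (s : ℤ × ℤ) : P.1.IsVertex s ↔ ∃ v, P.cell v = s := by
  obtain ⟨X, Y⟩ := s
  rw [PeriodicPP.IsVertex, isTopmost_iff, isRightmost_iff]
  constructor
  · rintro (rfl | rfl)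
    · exact ⟨(true, X), rfl⟩
    · exact ⟨(false, Y), rfl⟩
  · rintro ⟨⟨b, x⟩, hv⟩
    cases b <;> simp [cell] at hv <;> obtain ⟨rfl, rfl⟩ := hv <;> simp

/-- No cell is topmost in its column and rightmost in its row. -/
theorem not_topmost_and_rightmost (X : ℤ) :
    X ≠ P.forest.father false (P.forest.father true X) :=
  (P.forest_expanding X).ne

theorem cell_injective : Function.Injective P.cell := by
  rintro ⟨b, x⟩ ⟨b', x'⟩ h
  cases b <;> cases b' <;> simp [cell] at h ⊢
  · exact h.2
  · obtain ⟨h1, rfl⟩ := h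
    exact P.not_topmost_and_rightmost _ h1.symm
  · obtain ⟨h1, rfl⟩ := h
    exact P.not_topmost_and_rightmost _ h1
  · exact h.1

theorem isFather_cell_iff (s : ℤ × ℤ) (v : Bool × ℤ) :
    P.1.IsFather s (P.cell v) ↔ s = P.cell (P.forest.up v) := by
  obtain ⟨X, Y⟩ := s
  obtain ⟨b, x⟩ := v
  cases b
  · simp only [PeriodicPP.IsFather, cell, CyclicForest.up, Bool.false_eq_true, if_false,
      Bool.not_false, if_true, isTopmost_iff, isRightmost_iff, Prod.mk.injEq]
    constructor
    · rintro (⟨h1, -, -⟩ | ⟨-, h2, h3⟩)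
      · exact absurd (congrArg (P.forest.father false) h1) (P.not_topmost_and_rightmost _)
      · exact ⟨h3, h3 ▸ h2⟩
    · rintro ⟨rfl, h⟩
      exact Or.inr ⟨trivial, h, rfl⟩
  · simp only [PeriodicPP.IsFather, cell, CyclicForest.up, if_true,
      Bool.not_true, Bool.false_eq_true, if_false, isTopmost_iff, isRightmost_iff, Prod.mk.injEq]
    constructor
    · rintro (⟨-, h2, h3⟩ | ⟨h1, -, -⟩)
      · exact ⟨h3 ▸ h2, h3⟩
      · exact absurd h1 (P.not_topmost_and_rightmost _)
    · rintro ⟨h, rfl⟩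
      exact Or.inl ⟨trivial, h, rfl⟩

theorem isVertex_of_isFather {s s' : ℤ × ℤ} (h : P.1.IsFather s' s) : P.1.IsVertex s := by
  rcases h with h | h
  · exact Or.inl h.1
  · exact Or.inr h.1

/-- A vertex without descendants of order `j` is deleted after at most `j` rounds of pruning. -/
theorem pruned_of_not_mem_range (j : ℕ) (v : Bool × ℤ)
    (hv : v ∉ Set.range P.forest.up^[j]) : P.1.Pruned (P.cell v) := by
  induction j generalizing v with
  | zero => exact absurd ⟨v, rfl⟩ hv
  | succ j ih =>
    refine .leaf _ ((P.isVertex_iff _).2 ⟨v, rfl⟩) fun u hu => ?_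
    obtain ⟨w, rfl⟩ := (P.isVertex_iff u).1 (P.isVertex_of_isFather hu)
    have h := P.cell_injective ((P.isFather_cell_iff _ _).1 hu)
    refine ih w ?_
    rintro ⟨t, rfl⟩
    exact hv ⟨t, by rw [h, Function.iterate_succ_apply']⟩

variable {P} {l : ℕ} {k : ℤ} {f : Bool → ℤ → ℤ}

/-- Every trunk vertex has a trunk son, so none is ever deleted. -/
theorem not_pruned_of_trunk (h : P.forest.IsTrunk l k f) {s : ℤ × ℤ} (hs : P.1.Pruned s) (b : Bool)
    (i : ℤ) : P.cell (b, f b i) ≠ s := by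
  induction hs generalizing b i with
  | leaf s hs hu ih =>
    intro hc
    refine ih (P.cell (!b, f (!b) (i - CyclicForest.turn k (!b)))) ?_ _ _ rfl
    rw [isFather_cell_iff, CyclicForest.up]
    simp [h.father, hc]

theorem pruned_cell_iff (h : P.forest.IsTrunk l k f) (b : Bool) (x : ℤ) :
    ¬ P.1.Pruned (P.cell (b, x)) ↔ x ∈ Set.range (f b) := by
  constructor
  · intro hx
    rw [h.mem_iff]
    intro j
    by_contra hc
    exact hx (P.pruned_of_not_mem_range j _ hc)
  · rintro ⟨i, rfl⟩ hp
    exact not_pruned_of_trunk h hp b i rfl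

theorem remainingColumns_eq (h : P.forest.IsTrunk l k f) :
    P.1.remainingColumns = Set.range (f true) := by
  ext X
  simp only [PeriodicPP.remainingColumns, Set.mem_ofPred_eq, isTopmost_iff, exists_eq_left]
  exact pruned_cell_iff h true X

theorem remainingRows_eq (h : P.forest.IsTrunk l k f) :
    P.1.remainingRows = Set.range (f false) := by
  ext Y
  simp only [PeriodicPP.remainingRows, Set.mem_ofPred_eq, isRightmost_iff, exists_eq_left]
  exact pruned_cell_iff h false Y

theorem one_le_of_isTrunk (h : P.forest.IsTrunk l k f) : 1 ≤ k :=
  h.one_le_iff.2 P.forest_expanding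

/-- The trunk columns consist of `k + 1` trunk rows. -/
theorem trunk_mem_strip_iff (h : P.forest.IsTrunk l k f) (x y : ℤ) :
    (f true x, f false y) ∈ P.1.strip ↔ x ≤ y ∧ y ≤ x + k := by
  have h1 := h.father false y
  have h2 := h.father true x
  simp only [CyclicForest.turn_false, CyclicForest.turn_true, Bool.not_false, Bool.not_true,
    add_zero] at h1 h2
  rw [P.1.mem_strip, ← le_forest_father_false, h1, (h.strictMono true).le_iff_le]
  rw [forest_father_true] at h2
  rw [show P.1.stripTop (f true x) = f false (x + k) + 1 by omega, Int.lt_add_one_iff,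
    (h.strictMono false).le_iff_le]

end NondegeneratePPP

theorem count_flatten_replicate (l : ℕ) (p : List Step) (s : Step) :
    (List.replicate l p).flatten.count s = l * p.count s := by
  induction l with
  | zero => simp
  | succ l ih => simp [List.replicate_succ, ih]; ring

theorem eastHeight_flatten_NE (l x : ℕ) :
    eastHeight (List.replicate l [N, E]).flatten x = min (x + 1) l := by
  induction l generalizing x with
  | zero => simp
  | succ l ih =>
    cases x with
    | zero => simp [List.replicate_succ]
    | succ x => simp [List.replicate_succ, ih]

theorem eastHeight_flatten_EN (l k x : ℕ) :
    eastHeight ((List.replicate l [E, N]).flatten ++ List.replicate k N) x =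
      if x < l then x else k + l := by
  induction l generalizing x with
  | zero =>
    have := eastHeight_replicate_append k [] x
    simpa using this
  | succ l ih =>
    cases x with
    | zero => simp [List.replicate_succ]
    | succ x =>
      simp only [List.replicate_succ, List.flatten_cons, List.cons_append, List.nil_append,
        eastHeight_east_succ, eastHeight_north, ih]
      split_ifs <;> omega

/-- The trunk as a periodic parallelogram polyomino. -/
theorem exists_trunk_polyomino {k l : ℕ} (hk : 0 < k) (hl : 0 < l) :
    ∃ Q : PeriodicPP, Q.upper = List.replicate k N ++ (List.replicate l [N, E]).flatten ∧
      Q.lower = (List.replicate l [E, N]).flatten ++ List.replicate k N ∧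
      Q.width = l ∧ Q.height = l ∧ ∀ x y : ℤ, (x, y) ∈ Q.strip ↔ x ≤ y ∧ y ≤ x + k := by
  obtain ⟨⟨Q, hQ⟩, h1, h2, h3, h4⟩ := exists_periodicPP hl hl (fun X => X + k + 1) (fun X => X)
    (fun X Y hXY => by simpa using hXY) (fun X Y hXY => hXY) (fun X => by ring) (fun X => rfl) rfl
    (fun X => by omega)
  change Q.width = l at h1
  change Q.height = l at h2
  change Q.stripTop = _ at h3
  change Q.stripBot = _ at h4
  have ht : ∀ x < l, Q.top x = x + k + 1 := fun x hx => by
    have := Q.stripTop_natCast (r := x) (by omega)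
    rw [h3] at this
    simp only at this
    omega
  have hb : ∀ x < l, Q.bot x = x := fun x hx => by
    have := Q.stripBot_natCast (r := x) (by omega)
    rw [h4] at this
    simp only at this
    omega
  have hn : Q.numRows = k + l := by
    rw [← Q.top_width_sub_one, h1, ht _ (by omega)]
    omega
  refine ⟨Q, path_ext ?_ fun x => ?_, path_ext ?_ fun x => ?_, h1, h2, fun x y => ?_⟩
  · change Q.width = _
    rw [h1, List.count_append, count_flatten_replicate]
    simp [List.count_replicate]
  · rw [eastHeight_replicate_append, eastHeight_flatten_NE]
    change Q.top x = _
    by_cases hx : x < l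
    · rw [ht x hx]; omega
    · rw [Q.top_of_width_le (by omega), hn]; omega
  · rw [Q.count_lower.1, h1, List.count_append, count_flatten_replicate]
    simp [List.count_replicate]
  · rw [eastHeight_flatten_EN]
    change Q.bot x = _
    split_ifs with hx
    · exact hb x hx
    · rw [Q.bot_of_width_le (by omega), hn]
  · rw [Q.mem_strip, h3, h4]
    simp only
    omega

theorem NondegeneratePPP.hasIntrinsicThickness_iff {P : NondegeneratePPP} {l : ℕ} {k : ℤ}
    {f : Bool → ℤ → ℤ} (h : P.forest.IsTrunk l k f) (k' : ℕ) :
    P.1.HasIntrinsicThickness k' ↔ (k' : ℤ) = k := by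
  constructor
  · rintro ⟨-, Q, l', hl', ⟨f', g', hf', hg', hfr, hgr, -, -, hs⟩, hu, hd⟩
    rw [remainingColumns_eq h] at hfr
    rw [remainingRows_eq h] at hgr
    obtain ⟨a, ha⟩ := strictMono_eq_shift_of_range_eq (h.strictMono true) hf' hfr.symm
    obtain ⟨c, hc⟩ := strictMono_eq_shift_of_range_eq (h.strictMono false) hg' hgr.symm
    have hw : 0 < Q.width := Q.width_pos
    have ht : Q.stripTop (0 : ℕ) = k' + 1 := by
      rw [Q.stripTop_natCast hw, ParallelogramPolyomino.top, hu, eastHeight_replicate_append,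
        eastHeight_flatten_NE]
      push_cast
      omega
    -- column `0` of `Q` has `k' + 1` cells, and it is a trunk column of `P`
    have key : ∀ y : ℤ, (0 ≤ y ∧ y < k' + 1) ↔ (a ≤ y + c ∧ y + c ≤ a + k) := fun y => by
      have h1 := hs 0 y
      rw [Q.mem_strip, Q.stripBot_zero, show Q.stripTop 0 = k' + 1 from ht, ha, hc,
        trunk_mem_strip_iff h] at h1
      simpa using h1
    have h1 := (key 0).1 (by omega)
    have h2 := (key k').1 (by omega)
    have h3 := (key (a - c)).2 (by omega)
    have h4 := (key (a + k - c)).2 (by omega)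
    omega
  · intro hk
    have hk1 := one_le_of_isTrunk h
    obtain ⟨Q, hu, hd, hQw, hQh, hs⟩ := exists_trunk_polyomino (k := k') (by omega) h.l_pos
    refine ⟨by omega, Q, l, h.l_pos, ⟨f true, f false, h.strictMono true, h.strictMono false,
      (remainingColumns_eq h).symm, (remainingRows_eq h).symm, ?_, ?_, ?_⟩, hu, hd⟩
    · intro x
      rw [hQw, h.periodic]
      rfl
    · intro y
      rw [hQh, h.periodic]
      rfl
    · intro x y
      rw [hs, trunk_mem_strip_iff h, hk]

theorem NondegeneratePPP.existsUnique_thickness (P : NondegeneratePPP) :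
    ∃! k : ℕ, P.1.HasIntrinsicThickness k := by
  obtain ⟨l, k, f, h⟩ := P.forest.exists_isTrunk
  have hk := one_le_of_isTrunk h
  refine ⟨k.toNat, (hasIntrinsicThickness_iff h _).2 (by omega), fun k' hk' => ?_⟩
  have := (hasIntrinsicThickness_iff h k').1 hk'
  omega

theorem NondegeneratePPP.intrinsicThickness_eq {P : NondegeneratePPP} {l : ℕ} {k : ℤ}
    {f : Bool → ℤ → ℤ} (h : P.forest.IsTrunk l k f) : (P.1.intrinsicThickness : ℤ) = k := by
  have hk := one_le_of_isTrunk h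
  have h1 : {k | P.1.HasIntrinsicThickness k} = {k.toNat} := by
    ext k'
    rw [Set.mem_ofPred_eq, hasIntrinsicThickness_iff h, Set.mem_singleton_iff]
    omega
  rw [PeriodicPP.intrinsicThickness, h1, csInf_singleton]
  omega

end PPP

namespace PPP

/-! ### Decorated trunks -/

/-- The list of the subtrees at the root. -/
def OrderedTree.children : OrderedTree → List OrderedTree
  | .node ts => ts

@[simp] theorem OrderedTree.children_node (ts : List OrderedTree) :
    (OrderedTree.node ts).children = ts := rfl

@[simp] theorem OrderedTree.node_children (t : OrderedTree) : .node t.children = t := by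
  cases t; rfl

theorem OrderedTree.sizeOf_children_lt {t u : OrderedTree} (h : u ∈ t.children) :
    sizeOf u < sizeOf t := by
  cases t with
  | node ts =>
    have := List.sizeOf_lt_of_mem h
    simp at this ⊢
    omega

/-- What is attached to one component of the trunk, that is, to a trunk column (`true`) and a trunk
row (`false`): `d b true` is the tree of the pruned descendants of the trunk vertex of colour `b` to
the right of its trunk son, and `d b false` the tree of those to the left. The sons of the trunk
vertex are listed outwards from the trunk son. -/
abbrev Decoration : Type := Bool → Bool → OrderedTree

/-- The state of a vertex: its index, if it is a trunk vertex, and the tree of its descendants,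
otherwise. -/
abbrev State : Type := ℤ ⊕ OrderedTree

/-- The state of the son in position `j` of a vertex of colour `b` of given state, if it exists. The
sons of a trunk vertex are numbered from the trunk son, which has position `0`. -/
def sonState (D : ℤ → Decoration) (k : ℤ) (b : Bool) : State → ℤ → Option State
  | .inl i, j =>
    if j = 0 then some (.inl (i - CyclicForest.turn k (!b)))
    else if 0 < j then ((D i b true).children[j.toNat - 1]?).map .inr
    else ((D i b false).children[(-j).toNat - 1]?).map .inr
  | .inr t, j => if 0 ≤ j then (t.children[j.toNat]?).map .inr else none

namespace CyclicForest

variable {S : CyclicForest} {l : ℕ} {k : ℤ} {f : Bool → ℤ → ℤ} {D : ℤ → Decoration}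
  {st : Bool → ℤ → State} {base : Bool → ℤ → ℤ}

/-- The forest with trunk `f` is described by the decorations `D`: the vertex `x` of colour `b` has
state `st b x`, and the sons of this vertex are numbered from `base b x`. -/
structure IsDecorated (S : CyclicForest) (k : ℤ) (f : Bool → ℤ → ℤ) (D : ℤ → Decoration)
    (st : Bool → ℤ → State) (base : Bool → ℤ → ℤ) : Prop where
  state_trunk : ∀ b i, st b (f b i) = .inl i
  eq_of_state : ∀ b x i, st b x = .inl i → x = f b i
  base_trunk : ∀ b i, base b (f b i) = f (!b) (i - turn k (!b))
  son : ∀ b x, sonState D k (!b) (st (!b) (S.father b x)) (x - base (!b) (S.father b x)) =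
    some (st b x)
  father : ∀ b w j s, sonState D k b (st b w) j = some s → S.father (!b) (base b w + j) = w

theorem sub_lt_size (S : CyclicForest) {b : Bool} {x y : ℤ} (h : S.father b x = S.father b y) :
    x - y < S.size b := by
  by_contra! hc
  have h1 := S.mono b (show y + S.size b ≤ x by omega)
  have h2 := S.size_pos (!b)
  rw [S.periodic] at h1
  omega

namespace IsTrunk

/-- The ordered trees of the descendants of the vertices outside the trunk. The sons of `w` are the
vertices from `lo b w` to `lo b (w + 1) - 1`. -/
theorem exists_trees (h : S.IsTrunk l k f) {lo : Bool → ℤ → ℤ}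
    (hlo : ∀ b w x, S.father (!b) x = w ↔ lo b w ≤ x ∧ x < lo b (w + 1))
    (hlop : ∀ b w, lo b (w + S.size b) = lo b w + S.size (!b)) :
    ∃ T : Bool → ℤ → OrderedTree, (∀ b w, T b (w + S.size b) = T b w) ∧
      ∀ b w, w ∉ Set.range (f b) →
        T b w = .node ((List.range (lo b (w + 1) - lo b w).toNat).map
          fun j : ℕ => T (!b) (lo b w + j)) := by
  -- the tree of the descendants of order less than `n`
  let tree : ℕ → Bool → ℤ → OrderedTree := fun n => n.rec (fun _ _ => .node []) fun _ g b w =>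
    .node ((List.range (lo b (w + 1) - lo b w).toNat).map fun j : ℕ => g (!b) (lo b w + j))
  have hsucc : ∀ n b w, tree (n + 1) b w = .node ((List.range (lo b (w + 1) - lo b w).toNat).map
      fun j : ℕ => tree n (!b) (lo b w + j)) := fun _ _ _ => rfl
  have hper : ∀ n b w, tree n b (w + S.size b) = tree n b w := by
    intro n
    induction n with
    | zero => intro b w; rfl
    | succ n ih =>
      intro b w
      rw [hsucc, hsucc, add_right_comm, hlop, hlop]
      congr 1
      rw [add_sub_add_right_eq_sub]
      refine List.map_congr_left fun j _ => ?_
      rw [add_right_comm, ih]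
  have hstable : ∀ n b w, (∀ v, S.up^[n] v ≠ (b, w)) → tree (n + 1) b w = tree n b w := by
    intro n
    induction n with
    | zero => intro b w hv; exact absurd rfl (hv (b, w))
    | succ n ih =>
      intro b w hv
      rw [hsucc (n + 1), hsucc n]
      congr 1
      refine List.map_congr_left fun j hj => ih _ _ fun v hv' => hv v ?_
      rw [Function.iterate_succ_apply', hv']
      rw [List.mem_range] at hj
      simp only [up, Bool.not_not, Prod.mk.injEq, true_and]
      rw [hlo]
      omega
  obtain ⟨H, hH⟩ := h.absorbing
  refine ⟨tree H, hper H, fun b w hw => ?_⟩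
  rw [← hsucc, hstable]
  intro v hv
  have := hH v
  rw [hv] at this
  exact hw this

open Classical in
/-- The decorations of a forest are the trees of its pruned vertices. -/
theorem exists_isDecorated (h : S.IsTrunk l k f) :
    ∃ D st base, (∀ i, D (i + l) = D i) ∧ S.IsDecorated k f D st base := by
  choose lo hlo using fun b : Bool => exists_lowerAdjoint (S.mono (!b)) (S.periodic (!b))
    (by exact_mod_cast S.size_pos _)
  have hson : ∀ b w x, S.father (!b) x = w ↔ lo b w ≤ x ∧ x < lo b (w + 1) := fun b w x => by
    have h1 := hlo b w x
    have h2 := hlo b (w + 1) x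
    omega
  have hlop : ∀ b w, lo b (w + S.size b) = lo b w + S.size (!b) := fun b w => by
    refine le_antisymm ?_ ?_
    · rw [hlo, S.periodic, Bool.not_not, add_le_add_iff_right, ← hlo]
    · rw [← le_sub_iff_add_le, hlo]
      have h3 := (hlo b _ _).1 (le_refl (lo b (w + S.size b)))
      have h4 := S.periodic (!b) (lo b (w + S.size b) - S.size (!b))
      rw [sub_add_cancel, Bool.not_not] at h4
      omega
  obtain ⟨T, hTp, hT⟩ := h.exists_trees hson hlop
  have hinj : ∀ b i j, f b i = f b j ↔ i = j := fun b i j => (h.strictMono b).injective.eq_iff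
  -- the trunk son of a trunk vertex
  let x0 : Bool → ℤ → ℤ := fun b i => f (!b) (i - turn k (!b))
  have hx0 : ∀ b i, S.father (!b) (x0 b i) = f b i := fun b i => by
    simp only [x0, h.father, Bool.not_not, sub_add_cancel]
  let D : ℤ → Decoration := fun i b side => if side then
      .node ((List.range (lo b (f b i + 1) - (x0 b i + 1)).toNat).map
        fun j : ℕ => T (!b) (x0 b i + 1 + j))
    else .node ((List.range (x0 b i - lo b (f b i)).toNat).map fun j : ℕ => T (!b) (x0 b i - 1 - j))
  let st : Bool → ℤ → State := fun b x =>
    if hx : ∃ i, f b i = x then .inl hx.choose else .inr (T b x)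
  let base : Bool → ℤ → ℤ := fun b x =>
    if hx : ∃ i, f b i = x then x0 b hx.choose else lo b x
  have hst : ∀ b i, st b (f b i) = .inl i := fun b i => by
    have hx : ∃ j, f b j = f b i := ⟨i, rfl⟩
    simp only [st, dif_pos hx]
    rw [(hinj b _ _).1 hx.choose_spec]
  have hbase : ∀ b i, base b (f b i) = x0 b i := fun b i => by
    have hx : ∃ j, f b j = f b i := ⟨i, rfl⟩
    simp only [base, dif_pos hx]
    rw [(hinj b _ _).1 hx.choose_spec]
  have hst' : ∀ b x, x ∉ Set.range (f b) → st b x = .inr (T b x) := fun b x hx => dif_neg hx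
  have hbase' : ∀ b x, x ∉ Set.range (f b) → base b x = lo b x := fun b x hx => dif_neg hx
  refine ⟨D, st, base, fun i => ?_, hst, fun b x i hx => ?_, hbase, fun b x => ?_,
    fun b w j s hs => ?_⟩
  · have e1 : ∀ b, x0 b (i + l) = x0 b i + S.size (!b) := fun b => by
      simp only [x0]
      rw [add_sub_right_comm, h.periodic]
    funext b side
    simp only [D]
    rw [e1, h.periodic, add_right_comm (f b i), hlop, hlop]
    cases side
    · simp only [Bool.false_eq_true, if_false, add_sub_add_right_eq_sub]
      congr 1
      refine List.map_congr_left fun j _ => ?_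
      rw [← hTp (!b) (x0 b i - 1 - j)]
      congr 1
      ring
    · simp only [if_true]
      congr 1
      rw [show lo b (f b i + 1) + (S.size (!b) : ℤ) - (x0 b i + S.size (!b) + 1) =
        lo b (f b i + 1) - (x0 b i + 1) by ring]
      refine List.map_congr_left fun j _ => ?_
      rw [← hTp (!b) (x0 b i + 1 + j)]
      congr 1
      ring
  · by_cases hc : ∃ i, f b i = x
    · obtain ⟨j, rfl⟩ := hc
      rw [hst] at hx
      rw [Sum.inl.inj hx]
    · rw [hst' b x hc] at hx
      exact absurd hx (by simp)
  · -- the position of a vertex among its brothers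
    obtain ⟨w, hw⟩ : ∃ w, w = S.father b x := ⟨_, rfl⟩
    have hw' := (hson (!b) w x).1 (by rw [Bool.not_not, hw])
    rw [← hw]
    by_cases hc : w ∈ Set.range (f (!b))
    · obtain ⟨i, rfl⟩ := hc
      rw [hst, hbase]
      simp only [sonState]
      split_ifs with h1 h2
      · have : x = f b (i - turn k b) := by
          rw [sub_eq_zero.1 h1]
          simp only [x0, Bool.not_not]
        rw [this, hst, Bool.not_not]
      · have hx : x ∉ Set.range (f b) := by
          rintro ⟨j, rfl⟩
          rw [h.father, hinj] at hw
          subst hw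
          simp [x0] at h1
        rw [hst' b x hx]
        simp only [D, if_true, OrderedTree.children_node, List.getElem?_map, Bool.not_not]
        rw [List.getElem?_range (by omega)]
        simp only [Option.map_some, Option.some.injEq, Sum.inr.injEq]
        congr 1
        omega
      · have hx : x ∉ Set.range (f b) := by
          rintro ⟨j, rfl⟩
          rw [h.father, hinj] at hw
          subst hw
          simp [x0] at h1
        rw [hst' b x hx]
        simp only [D, Bool.false_eq_true, if_false, OrderedTree.children_node, List.getElem?_map,
          Bool.not_not]
        rw [List.getElem?_range (by omega)]
        simp only [Option.map_some, Option.some.injEq, Sum.inr.injEq]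
        congr 1
        omega
    · have hx : x ∉ Set.range (f b) := by
        rintro ⟨j, rfl⟩
        exact hc ⟨j + turn k b, by rw [hw, h.father]⟩
      rw [hst' _ _ hc, hbase' _ _ hc, hst' b x hx]
      simp only [sonState]
      rw [if_pos (by omega), hT _ _ hc]
      simp only [OrderedTree.children_node, List.getElem?_map, Bool.not_not]
      rw [List.getElem?_range (by omega)]
      simp only [Option.map_some, Option.some.injEq, Sum.inr.injEq]
      congr 1
      omega
  · rw [hson]
    by_cases hc : w ∈ Set.range (f b)
    · obtain ⟨i, rfl⟩ := hc
      have h0 := (hson b _ _).1 (hx0 b i)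
      rw [hst] at hs
      rw [hbase]
      simp only [sonState] at hs
      split_ifs at hs with h1 h2
      · omega
      · simp only [D, if_true, OrderedTree.children_node, List.getElem?_map,
          Option.map_eq_some_iff] at hs
        obtain ⟨_, ⟨m, hm, -⟩, -⟩ := hs
        obtain ⟨hm, -⟩ := List.getElem?_eq_some_iff.1 hm
        simp only [List.length_range] at hm
        omega
      · simp only [D, Bool.false_eq_true, if_false, OrderedTree.children_node, List.getElem?_map,
          Option.map_eq_some_iff] at hs
        obtain ⟨_, ⟨m, hm, -⟩, -⟩ := hs
        obtain ⟨hm, -⟩ := List.getElem?_eq_some_iff.1 hm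
        simp only [List.length_range] at hm
        omega
    · rw [hst' _ _ hc] at hs
      rw [hbase' _ _ hc]
      simp only [sonState] at hs
      split_ifs at hs with h1
      rw [hT _ _ hc] at hs
      simp only [OrderedTree.children_node, List.getElem?_map, Option.map_eq_some_iff] at hs
      obtain ⟨_, ⟨m, hm, -⟩, -⟩ := hs
      obtain ⟨hm, -⟩ := List.getElem?_eq_some_iff.1 hm
      simp only [List.length_range] at hm
      omega

end IsTrunk
end CyclicForest
end PPP

namespace PPP

theorem sonState_inr_eq_some {D : ℤ → Decoration} {k : ℤ} {b : Bool} {t : OrderedTree} {j : ℤ}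
    {s : State} (h : sonState D k b (.inr t) j = some s) :
    0 ≤ j ∧ ∃ u, t.children[j.toNat]? = some u ∧ s = .inr u := by
  simp only [sonState] at h
  split_ifs at h with h1
  rw [Option.map_eq_some_iff] at h
  obtain ⟨u, hu, rfl⟩ := h
  exact ⟨h1, u, hu, rfl⟩

theorem sonState_inr_of_getElem? {D : ℤ → Decoration} {k : ℤ} {b : Bool} {t u : OrderedTree} {j : ℕ}
    (h : t.children[j]? = some u) : sonState D k b (.inr t) j = some (.inr u) := by
  simp [sonState, h]

/-- The position of the `m`-th son of a trunk vertex on a given side of the trunk son. -/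
def sidePosition (side : Bool) (m : ℕ) : ℤ := if side then m + 1 else -(m + 1)

theorem sonState_inl_sidePosition (D : ℤ → Decoration) (k : ℤ) (b : Bool) (i : ℤ) (side : Bool)
    (m : ℕ) : sonState D k b (.inl i) (sidePosition side m) =
      ((D i b side).children[m]?).map .inr := by
  cases side
  · simp only [sonState, sidePosition, Bool.false_eq_true, if_false]
    rw [if_neg (by omega), if_neg (by omega)]
    congr 2
  · simp only [sonState, sidePosition, if_true]
    rw [if_neg (by omega), if_pos (by omega)]
    congr 2

theorem sonState_inl_eq_some {D : ℤ → Decoration} {k : ℤ} {b : Bool} {i : ℤ} {j : ℤ}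
    {s : State} (h : sonState D k b (.inl i) j = some s) :
    (j = 0 ∧ s = .inl (i - CyclicForest.turn k (!b))) ∨ ∃ side m u,
      j = sidePosition side m ∧ (D i b side).children[m]? = some u ∧ s = .inr u := by
  by_cases h0 : j = 0
  · subst h0
    simp only [sonState, if_true, Option.some.injEq] at h
    exact Or.inl ⟨rfl, h.symm⟩
  · right
    obtain ⟨side, m, rfl⟩ : ∃ side m, j = sidePosition side m := by
      by_cases h1 : 0 < j
      · exact ⟨true, (j - 1).toNat, by simp only [sidePosition, if_true]; omega⟩
      · exact ⟨false, (-j - 1).toNat, by simp [sidePosition]; omega⟩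
    rw [sonState_inl_sidePosition, Option.map_eq_some_iff] at h
    obtain ⟨u, hu, rfl⟩ := h
    exact ⟨side, m, u, rfl, hu, rfl⟩

theorem sonState_zero {D : ℤ → Decoration} {k : ℤ} {b : Bool} {s s' : State} {j : ℤ}
    (h : sonState D k b s j = some s') : ∃ r, sonState D k b s 0 = some r := by
  cases s with
  | inl i => exact ⟨.inl (i - CyclicForest.turn k (!b)), by simp [sonState]⟩
  | inr t =>
    obtain ⟨h1, u, hu, rfl⟩ := sonState_inr_eq_some h
    obtain ⟨h2, -⟩ := List.getElem?_eq_some_iff.1 hu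
    exact ⟨_, sonState_inr_of_getElem? (j := 0) (List.getElem?_eq_getElem (by omega))⟩

namespace CyclicForest

variable {S S' : CyclicForest} {l : ℕ} {k : ℤ} {f f' : Bool → ℤ → ℤ} {D D' : ℤ → Decoration}
  {st st' : Bool → ℤ → State} {base base' : Bool → ℤ → ℤ}

/-! ### Uniqueness of the decorations -/

namespace IsDecorated

theorem state_of_sonState (h : S.IsDecorated k f D st base) {b : Bool} {w j : ℤ} {s : State}
    (hs : sonState D k b (st b w) j = some s) : st (!b) (base b w + j) = s := by
  have h1 := h.father b w j s hs
  have h2 := h.son (!b) (base b w + j)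
  rw [h1, Bool.not_not, add_sub_cancel_left, hs] at h2
  exact (Option.some.inj h2).symm

theorem sonState_of_father (h : S.IsDecorated k f D st base) {b : Bool} {w x : ℤ}
    (hx : S.father (!b) x = w) : sonState D k b (st b w) (x - base b w) = some (st (!b) x) := by
  have := h.son (!b) x
  rwa [hx, Bool.not_not] at this

theorem father_base (h : S.IsDecorated k f D st base) {b : Bool} {w x : ℤ}
    (hx : S.father (!b) x = w) : S.father (!b) (base b w) = w := by
  obtain ⟨r, hr⟩ := sonState_zero (h.sonState_of_father hx)
  simpa using h.father b w 0 r hr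

theorem base_le (h : S.IsDecorated k f D st base) {b : Bool} {w x : ℤ} {t : OrderedTree}
    (ht : st b w = .inr t) (hx : S.father (!b) x = w) : base b w ≤ x := by
  have := h.sonState_of_father hx
  rw [ht] at this
  have := (sonState_inr_eq_some this).1
  omega

/-- If two descriptions of one forest number the sons of a vertex from the same base, then a son in the
first description is a son in the second, in the same position. -/
theorem sonState_transfer (h : S.IsDecorated k f D st base) (h' : S.IsDecorated k f D' st' base')
    {b : Bool} {w j : ℤ} {s : State} (hb : base b w = base' b w)
    (hs : sonState D k b (st b w) j = some s) :
    st (!b) (base b w + j) = s ∧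
      sonState D' k b (st' b w) j = some (st' (!b) (base b w + j)) := by
  refine ⟨h.state_of_sonState hs, ?_⟩
  have := h'.sonState_of_father (h.father b w j s hs)
  rwa [hb, add_sub_cancel_left, ← hb] at this

/-- For a pruned vertex with a son, the base is its leftmost son. -/
theorem base_eq (h : S.IsDecorated k f D st base) (h' : S.IsDecorated k f D' st' base')
    {b : Bool} {w x : ℤ} {t t' : OrderedTree} (ht : st b w = .inr t) (ht' : st' b w = .inr t')
    (hx : S.father (!b) x = w) : base b w = base' b w :=
  le_antisymm (h.base_le ht (h'.father_base hx)) (h'.base_le ht' (h.father_base hx))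

/-- The tree of a pruned vertex is read off the forest, by induction on the tree. -/
theorem tree_unique (h : S.IsDecorated k f D st base) (h' : S.IsDecorated k f D' st' base')
    (t : OrderedTree) {b : Bool} {w : ℤ} {t' : OrderedTree} (ht : st b w = .inr t)
    (ht' : st' b w = .inr t') : t = t' := by
  rw [← t.node_children, ← t'.node_children]
  congr 1
  refine List.ext_getElem? fun j => ?_
  cases hu : t.children[j]? with
  | some u =>
    have hs : sonState D k b (st b w) j = some (.inr u) := ht ▸ sonState_inr_of_getElem? hu
    have hb := base_eq h h' ht ht' (h.father b w j _ hs)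
    obtain ⟨h1, h2⟩ := sonState_transfer h h' hb hs
    rw [ht'] at h2
    obtain ⟨-, u', hu', h3⟩ := sonState_inr_eq_some h2
    have := OrderedTree.sizeOf_children_lt (List.mem_of_getElem? hu)
    rw [tree_unique h h' u h1 h3]
    simpa using hu'.symm
  | none =>
    cases hu' : t'.children[j]? with
    | none => rfl
    | some u' =>
      have hs : sonState D' k b (st' b w) j = some (.inr u') := ht' ▸ sonState_inr_of_getElem? hu'
      have hb := base_eq h h' ht ht' (h'.father b w j _ hs)
      obtain ⟨h1, h2⟩ := sonState_transfer h' h hb.symm hs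
      rw [ht] at h2
      obtain ⟨-, u, hu'', -⟩ := sonState_inr_eq_some h2
      simp [hu] at hu''
termination_by sizeOf t

theorem decoration_unique (h : S.IsDecorated k f D st base) (h' : S.IsDecorated k f D' st' base') :
    D = D' := by
  have key : ∀ {D D' : ℤ → Decoration} {st st' : Bool → ℤ → State} {base base' : Bool → ℤ → ℤ},
      S.IsDecorated k f D st base → S.IsDecorated k f D' st' base' →
      ∀ i b side (m : ℕ) u, (D i b side).children[m]? = some u →
        (D' i b side).children[m]? = some u := by
    intro D D' st st' base base' h h' i b side m u hu
    have hs : sonState D k b (st b (f b i)) (sidePosition side m) = some (.inr u) := by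
      rw [h.state_trunk, sonState_inl_sidePosition, hu, Option.map_some]
    obtain ⟨h1, h2⟩ := sonState_transfer h h' (by rw [h.base_trunk, h'.base_trunk]) hs
    rw [h'.state_trunk, sonState_inl_sidePosition, Option.map_eq_some_iff] at h2
    obtain ⟨u', hu', h3⟩ := h2
    rw [hu', tree_unique h h' u h1 h3.symm]
  funext i b side
  rw [← (D i b side).node_children, ← (D' i b side).node_children]
  congr 1
  refine List.ext_getElem? fun m => ?_
  cases hu : (D i b side).children[m]? with
  | some u => exact (key h h' i b side m u hu).symm
  | none =>
    cases hu' : (D' i b side).children[m]? with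
    | none => rfl
    | some u' => rw [key h' h i b side m u' hu'] at hu; exact absurd hu (by simp)

/-! ### Lexicographic keys -/

theorem abs_sub_base_lt (h : S.IsDecorated k f D st base) (b : Bool) (x : ℤ) :
    |x - base (!b) (S.father b x)| < S.size b := by
  have h1 : S.father b (base (!b) (S.father b x)) = S.father b x := by
    simpa using h.father_base (b := !b) (w := S.father b x) (x := x) (by simp)
  rw [abs_lt]
  have h2 := S.sub_lt_size h1
  have h3 := S.sub_lt_size h1.symm
  omega

end IsDecorated

/-- The keys `(p, o)` of the vertices of a forest with decorations `D`, with their states: the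
vertex of index `i` in the trunk has key `(i, 0)`, and the son in position `j` of a vertex of key
`(p, o)` has key `(p - turn k b, M * o + j)`, where `b` is the colour of the son. If `M` exceeds
twice all positions, the order of the vertices of each colour is the lexicographic order of their
keys. -/
inductive IsKey (D : ℤ → Decoration) (k M : ℤ) : Bool → ℤ → ℤ → State → Prop
  | trunk (b : Bool) (i : ℤ) : IsKey D k M b i 0 (.inl i)
  | son {b : Bool} {p o : ℤ} {s : State} {j : ℤ} {s' : State} (h : IsKey D k M b p o s)
      (hs : sonState D k b s j = some s') : IsKey D k M (!b) (p - turn k (!b)) (M * o + j) s'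

theorem lex_lt_of_lt {M p o o' j j' : ℤ} (ho : o < o') (hj : 2 * |j| < M) (hj' : 2 * |j'| < M) :
    toLex (p, M * o + j) < toLex (p, M * o' + j') := by
  rw [Prod.Lex.toLex_lt_toLex]
  right
  refine ⟨rfl, ?_⟩
  have := neg_abs_le j'
  have := le_abs_self j
  have := abs_nonneg j
  have := mul_nonneg (show 0 ≤ o' - o - 1 by omega) (show 0 ≤ M by omega)
  simp only
  nlinarith

/-- The vertices of a decorated forest can be given keys that depend only on the decorations: every
vertex has a trunk ancestor, from which its key is computed. The keys are ordered as the vertices,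
since the father maps are monotone and the sons of one vertex are ordered by position. -/
theorem IsDecorated.exists_keys (hf : S.IsTrunk l k f) (h : S.IsDecorated k f D st base) {M : ℤ}
    (hM : ∀ b, 2 * (S.size b : ℤ) ≤ M) :
    ∃ key : Bool → ℤ → ℤ ×ₗ ℤ, (∀ b, StrictMono (key b)) ∧ (∀ b i, key b (f b i) = toLex (i, 0)) ∧
      (∀ b x, ∃ j, 2 * |j| < M ∧ key b x =
        toLex ((ofLex (key (!b) (S.father b x))).1 - turn k b,
          M * (ofLex (key (!b) (S.father b x))).2 + j)) ∧
      ∀ b, Set.range (key b) = {q | ∃ s, IsKey D k M b (ofLex q).1 (ofLex q).2 s} := by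
  have hj : ∀ b x, 2 * |x - base (!b) (S.father b x)| < M := fun b x => by
    have := h.abs_sub_base_lt b x
    have := hM b
    omega
  -- the key of `x`, provided that `x` has an ancestor of order at most `n` in the trunk
  let K : ℕ → Bool → ℤ → ℤ ×ₗ ℤ := fun n => n.rec
    (fun b x => toLex (match st b x with
      | .inl i => (i, 0)
      | .inr _ => (0, 0)))
    fun _ g b x => toLex ((ofLex (g (!b) (S.father b x))).1 - turn k b,
      M * (ofLex (g (!b) (S.father b x))).2 + (x - base (!b) (S.father b x)))
  have hK0 : ∀ b i, K 0 b (f b i) = toLex (i, 0) := fun b i => by simp [K, h.state_trunk]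
  have hKs : ∀ n b x, K (n + 1) b x = toLex ((ofLex (K n (!b) (S.father b x))).1 - turn k b,
      M * (ofLex (K n (!b) (S.father b x))).2 + (x - base (!b) (S.father b x))) :=
    fun _ _ _ => rfl
  have hKf : ∀ n b i, K n b (f b i) = toLex (i, 0) := fun n => by
    induction n with
    | zero => exact hK0
    | succ n ih =>
      intro b i
      rw [hKs, hf.father, ih, h.base_trunk]
      simp
  have hstab : ∀ n b x, (S.up^[n] (b, x)).2 ∈ Set.range (f (S.up^[n] (b, x)).1) →
      K (n + 1) b x = K n b x := fun n => by
    induction n with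
    | zero =>
      intro b x hx
      obtain ⟨i, rfl⟩ : ∃ i, f b i = x := hx
      exact (hKf 1 b i).trans (hKf 0 b i).symm
    | succ n ih =>
      intro b x hx
      rw [hKs (n + 1), ih (!b) (S.father b x) hx, ← hKs]
  have hmono : ∀ n b x y, (S.up^[n] (b, x)).2 ∈ Set.range (f (S.up^[n] (b, x)).1) →
      (S.up^[n] (b, y)).2 ∈ Set.range (f (S.up^[n] (b, y)).1) → x < y → K n b x < K n b y :=
      fun n => by
    induction n with
    | zero =>
      intro b x y hx hy hij
      obtain ⟨i, rfl⟩ : ∃ i, f b i = x := hx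
      obtain ⟨j, rfl⟩ : ∃ i, f b i = y := hy
      rw [hK0, hK0, Prod.Lex.toLex_lt_toLex]
      exact Or.inl ((hf.strictMono b).lt_iff_lt.1 hij)
    | succ n ih =>
      intro b x y hx hy hxy
      rw [hKs, hKs]
      rcases (S.mono b hxy.le).lt_or_eq with hlt | heq
      · have h1 : K n (!b) (S.father b x) < K n (!b) (S.father b y) := ih (!b) _ _ hx hy hlt
        rw [Prod.Lex.lt_iff] at h1
        rcases h1 with h1 | ⟨h1, h2⟩
        · rw [Prod.Lex.toLex_lt_toLex]
          left
          simp only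
          omega
        · rw [h1]
          exact lex_lt_of_lt h2 (hj b x) (hj b y)
      · rw [heq, Prod.Lex.toLex_lt_toLex]
        right
        refine ⟨rfl, ?_⟩
        simp only
        omega
  have hkey : ∀ n b x, (S.up^[n] (b, x)).2 ∈ Set.range (f (S.up^[n] (b, x)).1) →
      IsKey D k M b (ofLex (K n b x)).1 (ofLex (K n b x)).2 (st b x) := fun n => by
    induction n with
    | zero =>
      intro b x hx
      obtain ⟨i, rfl⟩ : ∃ i, f b i = x := hx
      rw [hK0, h.state_trunk]
      exact .trunk b i
    | succ n ih =>
      intro b x hx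
      have h1 := IsKey.son (ih (!b) _ hx) (h.son b x)
      rw [Bool.not_not] at h1
      exact h1
  obtain ⟨H, hH⟩ := hf.absorbing
  refine ⟨K H, fun b x y => hmono H b x y (hH _) (hH _), hKf H, fun b x => ⟨_, hj b x, ?_⟩,
    fun b => ?_⟩
  · rw [← hstab H b x (hH _), hKs]
  · ext q
    constructor
    · rintro ⟨x, rfl⟩
      exact ⟨_, hkey H b x (hH _)⟩
    · suffices ∀ b p o s, IsKey D k M b p o s → ∃ x, K H b x = toLex (p, o) ∧ st b x = s by
        rintro ⟨s, hs⟩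
        obtain ⟨x, hx, -⟩ := this _ _ _ _ hs
        exact ⟨x, hx⟩
      intro b p o s hs
      induction hs with
      | trunk b i => exact ⟨f b i, hKf H b i, h.state_trunk b i⟩
      | @son b p o s j s' _ hs ih =>
        obtain ⟨w, hw, rfl⟩ := ih
        refine ⟨base b w + j, ?_, h.state_of_sonState hs⟩
        rw [← hstab H (!b) _ (hH _), hKs, h.father b w j _ hs, Bool.not_not, hw]
        simp

/-- A cyclic forest is determined by its decorated trunk: for each colour, the set of keys is
determined by the decorations, it is enumerated in lexicographic order, and the key of the father
is a function of the key. -/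
theorem IsDecorated.forest_unique (hf : S.IsTrunk l k f) (hf' : S'.IsTrunk l k f')
    (h : S.IsDecorated k f D st base) (h' : S'.IsDecorated k f' D st' base')
    (h0 : ∀ b, f b 0 = 0) (h0' : ∀ b, f' b 0 = 0) : S = S' ∧ f = f' := by
  let M : ℤ := 2 * (S.size true + S.size false + S'.size true + S'.size false)
  obtain ⟨key, k1, k2, k3, k4⟩ := h.exists_keys hf (M := M) (by
    intro b; cases b <;> simp only [M] <;> omega)
  obtain ⟨key', k1', k2', k3', k4'⟩ := h'.exists_keys hf' (M := M) (by
    intro b; cases b <;> simp only [M] <;> omega)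
  have hk : key = key' := by
    funext b
    refine strictMono_eq_of_range_eq (k1 b) (k1' b) (by rw [k4, k4']) ?_
    have e1 := k2 b 0
    have e2 := k2' b 0
    rw [h0] at e1
    rw [h0'] at e2
    rw [e1, e2]
  subst hk
  have hff : f = f' := by
    funext b i
    exact (k1 b).injective ((k2 b i).trans (k2' b i).symm)
  refine ⟨CyclicForest.ext ?_ ?_, hff⟩
  · funext b
    have e1 := hf.periodic b 0
    have e2 := hf'.periodic b 0
    rw [hff, h0'] at e1
    rw [h0'] at e2
    omega
  · funext b x
    apply (k1 (!b)).injective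
    obtain ⟨j, hj, e1⟩ := k3 b x
    obtain ⟨j', hj', e2⟩ := k3' b x
    rw [e1] at e2
    have e3 := congrArg (fun q => (ofLex q).1) e2
    have e4 := congrArg (fun q => (ofLex q).2) e2
    simp only [ofLex_toLex] at e3 e4
    apply ofLex.injective
    refine Prod.ext (by omega) ?_
    rcases lt_trichotomy (ofLex (key (!b) (S.father b x))).2 (ofLex (key (!b) (S'.father b x))).2
      with hlt | heq | hlt
    · have := lex_lt_of_lt (p := 0) hlt hj hj'
      rw [e4] at this
      exact absurd this (lt_irrefl _)
    · exact heq
    · have := lex_lt_of_lt (p := 0) hlt hj' hj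
      rw [e4] at this
      exact absurd this (lt_irrefl _)

end CyclicForest
end PPP

namespace PPP

/-! ### The forest with given decorations -/

theorem OrderedTree.length_children_lt (t : OrderedTree) : t.children.length < sizeOf t := by
  cases t with
  | node ts =>
    have : ∀ us : List OrderedTree, us.length < sizeOf us := fun us => by
      induction us with
      | nil => simp
      | cons u us ih => simp; omega
    have := this ts
    simp
    omega

/-- The positions of the sons of a vertex form an interval that contains `0`. -/
theorem sonState_succ {D : ℤ → Decoration} {k : ℤ} {b : Bool} {s s' : State} {j : ℤ} (hj : 0 ≤ j)
    (h : sonState D k b s (j + 1) = some s') : ∃ r, sonState D k b s j = some r := by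
  cases s with
  | inl i =>
    rcases hj.eq_or_lt with rfl | hj
    · exact sonState_zero h
    · rcases sonState_inl_eq_some h with ⟨h1, -⟩ | ⟨side, m, u, h1, h2, -⟩
      · omega
      · cases side
        · simp [sidePosition] at h1; omega
        · simp only [sidePosition, if_true] at h1
          obtain ⟨h3, -⟩ := List.getElem?_eq_some_iff.1 h2
          obtain ⟨v, hv⟩ : ∃ v, (D i b true).children[m - 1]? = some v :=
            ⟨_, List.getElem?_eq_getElem (by omega)⟩
          have hjm : j = sidePosition true (m - 1) := by simp only [sidePosition, if_true]; omega
          exact ⟨.inr v, by rw [hjm, sonState_inl_sidePosition, hv]; rfl⟩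
  | inr t =>
    obtain ⟨h1, u, hu, -⟩ := sonState_inr_eq_some h
    obtain ⟨h3, -⟩ := List.getElem?_eq_some_iff.1 hu
    refine ⟨.inr (t.children[j.toNat]'(by omega)), ?_⟩
    simp only [sonState, if_pos hj]
    rw [List.getElem?_eq_getElem (by omega)]
    rfl

theorem sonState_pred {D : ℤ → Decoration} {k : ℤ} {b : Bool} {s s' : State} {j : ℤ} (hj : j ≤ 0)
    (h : sonState D k b s (j - 1) = some s') : ∃ r, sonState D k b s j = some r := by
  cases s with
  | inl i =>
    rcases hj.eq_or_lt with rfl | hj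
    · exact sonState_zero h
    · rcases sonState_inl_eq_some h with ⟨h1, -⟩ | ⟨side, m, u, h1, h2, -⟩
      · omega
      · cases side
        · simp only [sidePosition, Bool.false_eq_true, if_false] at h1
          obtain ⟨h3, -⟩ := List.getElem?_eq_some_iff.1 h2
          obtain ⟨v, hv⟩ : ∃ v, (D i b false).children[m - 1]? = some v :=
            ⟨_, List.getElem?_eq_getElem (by omega)⟩
          have hjm : j = sidePosition false (m - 1) := by
            simp only [sidePosition, Bool.false_eq_true, if_false]; omega
          exact ⟨.inr v, by rw [hjm, sonState_inl_sidePosition, hv]; rfl⟩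
        · simp only [sidePosition, if_true] at h1; omega
  | inr t =>
    have := (sonState_inr_eq_some h).1
    omega

theorem sonState_translate {D : ℤ → Decoration} {k c : ℤ} (hD : ∀ i, D (i + c) = D i) {b : Bool}
    {s s' : State} {j : ℤ} (h : sonState D k b s j = some s') :
    sonState D k b (s.map (· + c) id) j = some (s'.map (· + c) id) := by
  cases s with
  | inl i =>
    simp only [Sum.map_inl]
    rcases sonState_inl_eq_some h with ⟨rfl, rfl⟩ | ⟨side, n, u, rfl, h2, rfl⟩
    · simp only [sonState, if_true, Sum.map_inl]
      rw [sub_add_eq_add_sub]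
    · rw [sonState_inl_sidePosition, hD, h2]
      rfl
  | inr t =>
    obtain ⟨h1, u, hu, rfl⟩ := sonState_inr_eq_some h
    simp only [Sum.map_inr, id]
    exact h

namespace CyclicForest

section Decode

variable {D : ℤ → Decoration} {k : ℤ} {m : ℕ}

/-- The base of the keys, when all trees of the decorations have size at most `m`. Positions are
then at most `m` in absolute value, and the base, at least `3`, exceeds twice that. -/
def keyBase (m : ℕ) : ℤ := 2 * m + 3

/-- The second coordinate of the key of the father: the quotient by the base, rounded to the nearest
integer. -/
def keyFather (m : ℕ) (o : ℤ) : ℤ := (o + (m + 1)) / keyBase m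

theorem keyFather_mul_add {o j : ℤ} (hj : |j| ≤ m) : keyFather m (keyBase m * o + j) = o := by
  rw [abs_le] at hj
  rw [keyFather, add_assoc, add_comm, Int.add_mul_ediv_left _ _ (by unfold keyBase; omega),
    Int.ediv_eq_zero_of_lt (by omega) (by unfold keyBase; omega), zero_add]

theorem keyFather_zero : keyFather m 0 = 0 := by
  simpa using keyFather_mul_add (m := m) (o := 0) (j := 0) (by simp)

theorem keyFather_mono : Monotone (keyFather m) := fun x y hxy =>
  Int.ediv_le_ediv (by unfold keyBase; omega) (by omega)

/-- Passing to the father brings the second coordinate closer to `0`, the coordinate of the trunk. -/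
theorem abs_keyFather_le (o : ℤ) {c : ℤ} (hc : 0 ≤ c) (h : |o| ≤ c + 1) : |keyFather m o| ≤ c := by
  have h1 := Int.emod_add_mul_ediv (o + (m + 1)) (keyBase m)
  have h2 := Int.emod_nonneg (o + (m + 1)) (show keyBase m ≠ 0 by unfold keyBase; omega)
  have h3 := Int.emod_lt_of_pos (o + (m + 1)) (show 0 < keyBase m by unfold keyBase; omega)
  change _ + _ * keyFather m o = _ at h1
  rw [abs_le] at h ⊢
  have hm : (0 : ℤ) ≤ m := by omega
  unfold keyBase at *
  constructor
  · by_contra hcon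
    have : keyFather m o ≤ -(c + 1) := by omega
    nlinarith [mul_nonneg hm hc]
  · by_contra hcon
    have : c + 1 ≤ keyFather m o := by omega
    nlinarith [mul_nonneg hm hc]

/-- Positions of sons are bounded by the sizes of the trees. -/
theorem abs_position_le (hm : ∀ i b side, sizeOf (D i b side) ≤ m) {b : Bool} {s s' : State} {j : ℤ}
    (hs : ∀ t, s = .inr t → sizeOf t ≤ m) (h : sonState D k b s j = some s') : |j| ≤ m := by
  cases s with
  | inl i =>
    rcases sonState_inl_eq_some h with ⟨rfl, -⟩ | ⟨side, n, u, rfl, h2, -⟩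
    · simp
    · obtain ⟨h3, -⟩ := List.getElem?_eq_some_iff.1 h2
      have h4 := (D i b side).length_children_lt
      have h5 := hm i b side
      rw [abs_le]
      cases side
      · simp only [sidePosition, Bool.false_eq_true, if_false]; omega
      · simp only [sidePosition, if_true]; omega
  | inr t =>
    obtain ⟨h1, u, hu, -⟩ := sonState_inr_eq_some h
    obtain ⟨h3, -⟩ := List.getElem?_eq_some_iff.1 hu
    have h4 := t.length_children_lt
    have h5 := hs t rfl
    rw [abs_le]
    omega

/-- Exactly the trunk vertices have second coordinate `0`. The coordinates are bounded: each step away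
from the trunk multiplies them by about the base, but takes a proper subtree. -/
theorem IsKey.bound (hm : ∀ i b side, sizeOf (D i b side) ≤ m) {b : Bool} {p o : ℤ} {s : State}
    (h : IsKey D k (keyBase m) b p o s) :
    (∀ i, s = .inl i → p = i ∧ o = 0) ∧
    ∀ t, s = .inr t → o ≠ 0 ∧ sizeOf t ≤ m ∧
      (|o| + 1) * keyBase m ^ sizeOf t ≤ keyBase m ^ (m + 1) := by
  have hM : 1 ≤ keyBase m := by unfold keyBase; omega
  induction h with
  | trunk b i => simp
  | @son b p o s j s' h hs ih =>
    have hj := abs_position_le hm (fun t ht => (ih.2 t ht).2.1) hs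
    rw [abs_le] at hj
    cases s with
    | inl i =>
      obtain ⟨rfl, rfl⟩ := ih.1 i rfl
      rcases sonState_inl_eq_some hs with ⟨rfl, rfl⟩ | ⟨side, n, u, rfl, h2, rfl⟩
      · simp
      · refine ⟨fun i hi => by simp at hi, fun t ht => ?_⟩
        obtain rfl := Sum.inr.inj ht
        have h3 := OrderedTree.sizeOf_children_lt (List.mem_of_getElem? h2)
        have h4 := hm p b side
        refine ⟨?_, by omega, ?_⟩
        · cases side <;> simp [sidePosition] <;> omega
        · rw [pow_succ' (keyBase m) m]
          refine mul_le_mul ?_ (pow_le_pow_right₀ hM (by omega)) (by positivity) (by omega)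
          have : |keyBase m * 0 + sidePosition side n| ≤ m := by
            rw [abs_le]
            omega
          unfold keyBase at *
          omega
    | inr t =>
      obtain ⟨h1, u, hu, rfl⟩ := sonState_inr_eq_some hs
      obtain ⟨h2, h3, h4⟩ := ih.2 t rfl
      refine ⟨fun i hi => by simp at hi, fun t' ht => ?_⟩
      obtain rfl := Sum.inr.inj ht
      have h5 := OrderedTree.sizeOf_children_lt (List.mem_of_getElem? hu)
      refine ⟨fun h0 => ?_, by omega, ?_⟩
      · have := keyFather_mul_add (m := m) (o := o) (j := j) (abs_le.2 hj)
        rw [h0, keyFather_zero] at this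
        exact h2 this.symm
      · have h6 : |keyBase m * o + j| + 1 ≤ (|o| + 1) * keyBase m := by
          have h7 := abs_add_le (keyBase m * o) j
          rw [abs_mul, abs_of_pos (show 0 < keyBase m by omega)] at h7
          have h8 := abs_le.2 hj
          unfold keyBase at *
          linarith
        calc _ ≤ (|o| + 1) * keyBase m * keyBase m ^ sizeOf u :=
              mul_le_mul_of_nonneg_right h6 (by positivity)
          _ = (|o| + 1) * keyBase m ^ (sizeOf u + 1) := by ring
          _ ≤ (|o| + 1) * keyBase m ^ sizeOf t :=
              mul_le_mul_of_nonneg_left (pow_le_pow_right₀ hM (by omega)) (by positivity)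
          _ ≤ _ := h4

theorem IsKey.abs_lt (hm : ∀ i b side, sizeOf (D i b side) ≤ m) {b : Bool} {p o : ℤ} {s : State}
    (h : IsKey D k (keyBase m) b p o s) : |o| < keyBase m ^ (m + 1) := by
  have hM : 1 ≤ keyBase m := by unfold keyBase; omega
  have hb := h.bound hm
  cases s with
  | inl i =>
    rw [(hb.1 i rfl).2, abs_zero]
    positivity
  | inr t =>
    have h1 := (hb.2 t rfl).2.2
    have h2 : 1 ≤ keyBase m ^ sizeOf t := one_le_pow₀ hM
    have := abs_nonneg o
    nlinarith

/-- The key of the father is a function of the key, and the position is recovered as a remainder. -/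
theorem IsKey.exists_father (hm : ∀ i b side, sizeOf (D i b side) ≤ m) {b : Bool} {p o : ℤ}
    {s : State} (h : IsKey D k (keyBase m) b p o s) :
    ∃ (s₀ : State) (j : ℤ), |j| ≤ m ∧ IsKey D k (keyBase m) (!b) (p + turn k b) (keyFather m o) s₀ ∧
      sonState D k (!b) s₀ j = some s ∧ o = keyBase m * keyFather m o + j := by
  cases h with
  | trunk b i =>
    refine ⟨.inl (p + turn k b), 0, by simp, ?_, by simp [sonState], by simp [keyFather_zero]⟩
    rw [keyFather_zero]
    exact .trunk _ _
  | @son b p o s₀ j s h hs =>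
    have hj := abs_position_le hm (fun t ht => ((h.bound hm).2 t ht).2.1) hs
    refine ⟨s₀, j, hj, ?_, ?_, ?_⟩
    · rw [keyFather_mul_add hj, Bool.not_not, sub_add_cancel]
      exact h
    · rwa [Bool.not_not]
    · rw [keyFather_mul_add hj]

theorem IsKey.state_unique (hm : ∀ i b side, sizeOf (D i b side) ≤ m) {b : Bool} {p o : ℤ}
    {s s' : State} (h : IsKey D k (keyBase m) b p o s) (h' : IsKey D k (keyBase m) b p o s') :
    s = s' := by
  obtain ⟨c, hc⟩ : ∃ c : ℕ, |o| ≤ c := ⟨o.natAbs, by simp⟩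
  induction c generalizing b p o s s' with
  | zero =>
    have h0 : o = 0 := by simpa using hc
    cases s with
    | inr t => exact absurd h0 ((h.bound hm).2 t rfl).1
    | inl i =>
      cases s' with
      | inr t => exact absurd h0 ((h'.bound hm).2 t rfl).1
      | inl i' => rw [← ((h.bound hm).1 i rfl).1, ← ((h'.bound hm).1 i' rfl).1]
  | succ c ih =>
    obtain ⟨s₀, j, -, h1, h2, h3⟩ := h.exists_father hm
    obtain ⟨s₀', j', -, h1', h2', h3'⟩ := h'.exists_father hm
    obtain rfl := ih h1 h1' (abs_keyFather_le o (by omega) (by exact_mod_cast hc))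
    obtain rfl : j = j' := by omega
    rw [h2] at h2'
    exact Option.some.inj h2'

theorem IsKey.translate {M c : ℤ} (hD : ∀ i, D (i + c) = D i) {b : Bool} {p o : ℤ} {s : State}
    (h : IsKey D k M b p o s) : IsKey D k M b (p + c) o (s.map (· + c) id) := by
  induction h with
  | trunk b i => exact .trunk b (i + c)
  | @son b p o s j s' h hs ih =>
    rw [sub_add_eq_add_sub]
    exact ih.son (sonState_translate hD hs)

/-- The keys of each colour are enumerated by the integers in lexicographic order. -/
theorem exists_key_enumeration (hm : ∀ i b side, sizeOf (D i b side) ≤ m) {l : ℕ} (hl : 0 < l)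
    (hD : ∀ i, D (i + l) = D i) (b : Bool) :
    ∃ (p o : ℤ → ℤ) (s : ℤ → State) (n : ℕ), 0 < n ∧
      (∀ x, IsKey D k (keyBase m) b (p x) (o x) (s x)) ∧
      (∀ p' o' s', IsKey D k (keyBase m) b p' o' s' → ∃ x, p x = p' ∧ o x = o') ∧
      (∀ x y, x < y → p x < p y ∨ p x = p y ∧ o x < o y) ∧
      (∀ x, p (x + n) = p x + l ∧ o (x + n) = o x) ∧ p 0 = 0 ∧ o 0 = 0 := by
  set C := keyBase m ^ (m + 1) with hC
  have hCpos : 0 < C := by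
    have : 0 < keyBase m := by unfold keyBase; omega
    positivity
  -- since `|o| < C` for all keys, the lexicographic order is the order of `2 * C * p + o`
  have hlex : ∀ p o p' o' : ℤ, |o| < C → |o'| < C → 2 * C * p + o < 2 * C * p' + o' →
      p < p' ∨ p = p' ∧ o < o' := by
    intro p o p' o' ho ho' h
    rw [_root_.abs_lt] at ho ho'
    rcases lt_trichotomy p p' with h1 | h1 | h1
    · exact Or.inl h1
    · subst h1
      exact Or.inr ⟨rfl, by omega⟩
    · exfalso
      have : p' + 1 ≤ p := h1
      nlinarith
  have hinj : ∀ p o p' o' : ℤ, |o| < C → |o'| < C → 2 * C * p + o = 2 * C * p' + o' →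
      p = p' ∧ o = o' := by
    intro p o p' o' ho ho' h
    rw [_root_.abs_lt] at ho ho'
    have hp : p = p' := by
      rcases lt_trichotomy p p' with h1 | h1 | h1
      · exfalso
        have : p + 1 ≤ p' := h1
        nlinarith
      · exact h1
      · exfalso
        have : p' + 1 ≤ p := h1
        nlinarith
    subst hp
    exact ⟨rfl, by omega⟩
  have hD' : ∀ i, D (i + -(l : ℤ)) = D i := fun i => by
    rw [← hD (i + -(l : ℤ)), neg_add_cancel_right]
  obtain ⟨e, n, hn, he, hr, he0, hep⟩ := exists_periodic_enumeration
    {x | ∃ p o s, IsKey D k (keyBase m) b p o s ∧ x = 2 * C * p + o} (L := 2 * C * l) (c := 0)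
    (by positivity) ⟨0, 0, _, .trunk b 0, by simp⟩ (fun x => by
      constructor
      · rintro ⟨p, o, s, h, hx⟩
        exact ⟨_, _, _, h.translate hD', by linarith⟩
      · rintro ⟨p, o, s, h, rfl⟩
        exact ⟨_, _, _, h.translate hD, by ring⟩)
  have hmem : ∀ x, ∃ p o s, IsKey D k (keyBase m) b p o s ∧ e x = 2 * C * p + o := fun x => by
    have : e x ∈ Set.range e := ⟨x, rfl⟩
    rw [hr] at this
    exact this
  choose p o s hk hx using hmem
  have ho : ∀ x, |o x| < C := fun x => (hk x).abs_lt hm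
  refine ⟨p, o, s, n, hn, hk, fun p' o' s' h => ?_, fun x y hxy => ?_, fun x => ?_, ?_⟩
  · have : 2 * C * p' + o' ∈ Set.range e := by
      rw [hr]
      exact ⟨_, _, _, h, rfl⟩
    obtain ⟨x, hx'⟩ := this
    rw [hx] at hx'
    exact ⟨x, hinj _ _ _ _ (ho x) (h.abs_lt hm) hx'⟩
  · refine hlex _ _ _ _ (ho x) (ho y) ?_
    rw [← hx, ← hx]
    exact he hxy
  · refine hinj _ _ _ _ (ho _) (ho _) ?_
    rw [← hx, hep, hx]
    ring
  · refine hinj _ _ _ _ (ho _) (by simpa using hCpos) ?_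
    rw [← hx, he0]
    simp

theorem exists_sizeOf_bound {l : ℕ} (hl : 0 < l) (hD : ∀ i, D (i + l) = D i) :
    ∃ m : ℕ, ∀ i b side, sizeOf (D i b side) ≤ m := by
  refine ⟨∑ i ∈ Finset.range l, ∑ b : Bool, ∑ side : Bool, sizeOf (D i b side),
    fun i b side => ?_⟩
  obtain ⟨q, r, h0, h1, rfl⟩ := exists_window (a := l) (by exact_mod_cast hl) 0 i
  have hp : D (r + l * q) = D r := by
    have : Function.Periodic D (l : ℤ) := hD
    have := this.int_mul q r
    rwa [mul_comm] at this
  rw [hp]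
  have h2 := Finset.single_le_sum (f := fun i : ℕ => ∑ b : Bool, ∑ side : Bool, sizeOf (D i b side))
    (fun _ _ => Nat.zero_le _) (Finset.mem_range.2 (show r.toNat < l by omega))
  simp only [Int.toNat_of_nonneg h0] at h2
  refine le_trans ?_ h2
  refine le_trans ?_ (Finset.single_le_sum (f := fun b : Bool => ∑ side : Bool, sizeOf (D r b side))
    (fun _ _ => Nat.zero_le _) (Finset.mem_univ b))
  exact Finset.single_le_sum (f := fun side : Bool => sizeOf (D r b side))
    (fun _ _ => Nat.zero_le _) (Finset.mem_univ side)

/-- Every periodic family of decorations is that of a forest: its vertices are the keys of each colour,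
numbered in lexicographic order, and its father maps are `(p, o) ↦ (p + turn k b, keyFather m o)`. -/
theorem exists_forest_isDecorated {l : ℕ} (hl : 0 < l) (k : ℤ) (hD : ∀ i, D (i + l) = D i) :
    ∃ S f st base, IsTrunk S l k f ∧ (∀ b, f b 0 = 0) ∧ IsDecorated S k f D st base := by
  obtain ⟨m, hm⟩ := exists_sizeOf_bound hl hD
  choose p o s n hn hk hex hlt hper h0p h0o using
    fun b => exists_key_enumeration (k := k) hm hl hD b
  have hinj : ∀ b x y, p b x = p b y → o b x = o b y → x = y := by
    intro b x y hp ho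
    by_contra hne
    rcases lt_or_gt_of_ne hne with h | h
    · have := hlt b x y h; omega
    · have := hlt b y x h; omega
  have hlt' : ∀ b x y, (p b x < p b y ∨ p b x = p b y ∧ o b x < o b y) → x < y := by
    intro b x y h
    by_contra hne
    rcases (not_lt.1 hne).eq_or_lt with rfl | h'
    · omega
    · have := hlt b y x h'; omega
  have hstate : ∀ b x s', IsKey D k (keyBase m) b (p b x) (o b x) s' → s b x = s' :=
    fun b x s' h => (hk b x).state_unique hm h
  -- the father map
  have hfa : ∀ b x, ∃ y, p (!b) y = p b x + turn k b ∧ o (!b) y = keyFather m (o b x) := by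
    intro b x
    obtain ⟨s₀, j, -, h1, -⟩ := (hk b x).exists_father hm
    exact hex _ _ _ _ h1
  choose fa hfap hfao using hfa
  let S : CyclicForest :=
    { size := n
      father := fa
      size_pos := hn
      mono := fun b x y hxy => by
        by_contra hcon
        rcases hxy.eq_or_lt with rfl | hxy
        · exact hcon le_rfl
        · have h1 := hlt (!b) _ _ (not_le.1 hcon)
          rw [hfap, hfap, hfao, hfao] at h1
          rcases hlt b _ _ hxy with h2 | ⟨h2, h3⟩
          · omega
          · have := keyFather_mono (m := m) h3.le
            omega
      periodic := fun b x => by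
        apply hinj (!b)
        · rw [hfap, (hper _ _).1, (hper _ _).1, hfap]; ring
        · rw [hfao, (hper _ _).2, (hper _ _).2, hfao] }
  -- the trunk
  choose f hfp hfo using fun b i => hex b i 0 _ (.trunk b i)
  have hfeq : ∀ b x, o b x = 0 → x = f b (p b x) := fun b x hx =>
    hinj b _ _ (hfp _ _).symm (hx.trans (hfo _ _).symm)
  have hfs : ∀ b i, s b (f b i) = .inl i := fun b i => by
    apply hstate
    rw [hfp, hfo]
    exact .trunk b i
  have htrunk : IsTrunk S l k f :=
    { l_pos := hl
      strictMono := fun b x y hxy => hlt' _ _ _ (Or.inl (by rw [hfp, hfp]; exact hxy))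
      periodic := fun b i => by
        apply hinj b
        · rw [hfp, (hper _ _).1, hfp]
        · rw [hfo, (hper _ _).2, hfo]
      father := fun b i => by
        apply hinj (!b)
        · rw [hfp]
          exact (hfap _ _).trans (by rw [hfp])
        · rw [hfo]
          exact (hfao _ _).trans (by rw [hfo, keyFather_zero])
      absorbing := by
        have key : ∀ (c : ℕ) b x, |o b x| ≤ c →
            o (S.up^[c] (b, x)).1 (S.up^[c] (b, x)).2 = 0 := fun c => by
          induction c with
          | zero =>
            intro b x h
            simpa using h
          | succ c ih =>
            intro b x h
            refine ih (!b) (fa b x) ?_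
            rw [hfao]
            exact abs_keyFather_le _ (by omega) (by exact_mod_cast h)
        refine ⟨(keyBase m ^ (m + 1)).toNat, fun v => ⟨_, (hfeq _ _ (key _ v.1 v.2 ?_)).symm⟩⟩
        have := (hk v.1 v.2).abs_lt hm
        omega }
  -- the first son of each vertex, in the numbering of positions
  have hbase : ∀ b w, ∃ y, ∀ r, sonState D k b (s b w) 0 = some r →
      p (!b) y = p b w - turn k (!b) ∧ o (!b) y = keyBase m * o b w := by
    intro b w
    cases h : sonState D k b (s b w) 0 with
    | none => exact ⟨0, fun r hr => by simp at hr⟩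
    | some r =>
      obtain ⟨y, hy⟩ := hex _ _ _ _ ((hk b w).son h)
      exact ⟨y, fun _ _ => by simpa using hy⟩
  choose base hbase using hbase
  -- consecutive positions are consecutive in the enumeration
  have hstep : ∀ b x y, p b x = p b y → o b y = o b x + 1 → y = x + 1 := by
    intro b x y hp ho
    have h1 : x < y := hlt' _ _ _ (Or.inr ⟨hp, by omega⟩)
    by_contra hne
    have h2 := hlt b (x + 1) y (by omega)
    have h3 := hlt b x (x + 1) (by omega)
    omega
  have hson : ∀ b w j r, sonState D k b (s b w) j = some r →
      p (!b) (base b w + j) = p b w - turn k (!b) ∧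
      o (!b) (base b w + j) = keyBase m * o b w + j := by
    intro b w j
    induction j using Int.induction_on with
    | zero =>
      intro r hr
      simpa using hbase b w r hr
    | succ j ih =>
      intro r hr
      obtain ⟨r', hr'⟩ := sonState_succ (by omega) hr
      obtain ⟨h1, h2⟩ := ih r' hr'
      obtain ⟨y, hy1, hy2⟩ := hex _ _ _ _ ((hk b w).son hr)
      have : y = base b w + j + 1 := hstep (!b) _ _ (h1.trans hy1.symm) (by omega)
      rw [← add_assoc, ← this]
      exact ⟨hy1, by omega⟩
    | pred j ih =>
      intro r hr
      obtain ⟨r', hr'⟩ := sonState_pred (by omega) hr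
      obtain ⟨h1, h2⟩ := ih r' hr'
      obtain ⟨y, hy1, hy2⟩ := hex _ _ _ _ ((hk b w).son hr)
      have : base b w + -(j : ℤ) = y + 1 := hstep (!b) _ _ (hy1.trans h1.symm) (by omega)
      rw [show base b w + (-(j : ℤ) - 1) = y by omega]
      exact ⟨hy1, by omega⟩
  refine ⟨S, f, s, base, htrunk, fun b => ?_, hfs, fun b x i hx => ?_, fun b i => ?_,
    fun b x => ?_, fun b w j r hr => ?_⟩
  · exact hinj b _ _ (by rw [hfp, h0p]) (by rw [hfo, h0o])
  · have := ((hk b x).bound hm).1 i hx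
    rw [hfeq b x this.2, this.1]
  · have h1 : sonState D k b (s b (f b i)) 0 = some (.inl (i - turn k (!b))) := by
      rw [hfs]
      simp [sonState]
    obtain ⟨h2, h3⟩ := hbase _ _ _ h1
    rw [hfp] at h2
    rw [hfo, mul_zero] at h3
    rw [hfeq _ _ h3, h2]
  · obtain ⟨s₀, j, hj, h1, h2, h3⟩ := (hk b x).exists_father hm
    have h4 : s (!b) (fa b x) = s₀ := hstate _ _ _ (by rw [hfap, hfao]; exact h1)
    rw [← h4] at h2
    obtain ⟨h5, h6⟩ := hson _ _ _ _ h2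
    simp only [Bool.not_not, hfap, hfao] at h5 h6
    have h7 : base (!b) (fa b x) + j = x := hinj b _ _ (by omega) (by omega)
    change sonState D k (!b) (s (!b) (fa b x)) (x - base (!b) (fa b x)) = _
    rw [← h2]
    congr 1
    omega
  · obtain ⟨h1, h2⟩ := hson _ _ _ _ hr
    have hj := abs_position_le hm (fun t ht => (((hk b w).bound hm).2 t ht).2.1) hr
    change fa (!b) (base b w + j) = w
    have h3 := hfap (!b) (base b w + j)
    have h4 := hfao (!b) (base b w + j)
    rw [Bool.not_not] at h3 h4
    refine hinj b _ _ ?_ ?_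
    · rw [h3, h1]; ring
    · rw [h4, h2, keyFather_mul_add hj]

end Decode
end CyclicForest
end PPP

namespace PPP

/-! ### Weights -/

/-- The variable that counts the vertices of colour `b`. -/
def colorVar (b : Bool) : Var := if b then .black else .white

/-- The weight of the non-root vertices of a tree whose root has colour `b`. -/
noncomputable def treeWeight (b : Bool) (t : OrderedTree) : Var →₀ ℕ :=
  if b then blackRootedWeight t else whiteRootedWeight t

/-- The weight of one component of a decorated trunk: one trunk column, one trunk row, and the
pruned vertices that are attached to them. -/
noncomputable def decorationWeight (d : Decoration) : Var →₀ ℕ :=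
  ∑ b : Bool, (Finsupp.single (colorVar b) 1 + ∑ side : Bool, treeWeight b (d b side))

/-- The weight of a tree is that of its subtrees together with their roots, which have the other
colour. -/
theorem treeWeight_eq (b : Bool) (t : OrderedTree) : treeWeight b t =
    (t.children.map fun u => Finsupp.single (colorVar (!b)) 1 + treeWeight (!b) u).sum := by
  cases t with
  | node ts =>
    have h : ∀ us : List OrderedTree,
        Finsupp.single (colorVar b) (forestOtherParity us) +
          Finsupp.single (colorVar (!b)) (forestRootParity us) =
        (us.map fun u => Finsupp.single (colorVar (!b)) 1 + treeWeight (!b) u).sum := fun us => by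
      induction us with
      | nil => simp [forestOtherParity, forestRootParity]
      | cons u us ih =>
        rw [List.map_cons, List.sum_cons, ← ih]
        simp only [forestOtherParity, forestRootParity, Finsupp.single_add]
        cases b
        · simp only [treeWeight, colorVar, blackRootedWeight, whiteRootedWeight, Bool.not_false,
            Bool.false_eq_true, if_true, if_false]
          abel
        · simp only [treeWeight, colorVar, blackRootedWeight, whiteRootedWeight, Bool.not_true,
            Bool.false_eq_true, if_true, if_false]
          abel
    rw [OrderedTree.children_node, ← h]
    cases b
    · simp only [treeWeight, colorVar, whiteRootedWeight, Bool.not_false,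
        Bool.false_eq_true, if_true, if_false, OrderedTree.numOdd, OrderedTree.numEven]
      abel
    · simp only [treeWeight, colorVar, blackRootedWeight, Bool.not_true,
        Bool.false_eq_true, if_true, if_false, OrderedTree.numOdd, OrderedTree.numEven]

theorem sum_range_getElem? {α A : Type*} [AddCommMonoid A] (F : α → A) (ts : List α) :
    ∑ j ∈ Finset.range ts.length, ts[j]?.elim 0 F = (ts.map F).sum := by
  induction ts with
  | nil => simp
  | cons t ts ih =>
    rw [List.length_cons, Finset.sum_range_succ']
    simp [ih, add_comm]

theorem sum_Ico_periodic {A : Type*} [AddCommMonoid A] {N : ℕ} {h : ℤ → A} (hN : 0 < N)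
    (hp : ∀ x, h (x + N) = h x) (s : ℤ) :
    ∑ x ∈ Finset.Ico s (s + N), h x = ∑ x ∈ Finset.Ico (0 : ℤ) N, h x := by
  rw [← Int.image_Ico_emod s N (by omega), Finset.sum_image]
  · refine Finset.sum_congr rfl fun x _ => ?_
    have hp' : Function.Periodic h (N : ℤ) := hp
    have h1 := Int.emod_add_mul_ediv x N
    conv_lhs => rw [← h1, mul_comm]
    exact hp'.int_mul (x / N) (x % N)
  · intro x hx y hy hxy
    simp only [Finset.coe_Ico, Set.mem_Ico] at hx hy hxy
    have h1 := Int.emod_add_mul_ediv x N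
    have h2 := Int.emod_add_mul_ediv y N
    rw [hxy] at h1
    have h3 : (N : ℤ) * (x / N - y / N) = x - y := by linarith
    have h4 : x / N - y / N = 0 := by
      have hN' : (0 : ℤ) < N := by exact_mod_cast hN
      by_contra hne
      rcases lt_or_gt_of_ne hne with h | h
      · nlinarith
      · nlinarith
    rw [h4] at h3
    linarith

namespace CyclicForest

variable {S : CyclicForest} {l : ℕ} {k : ℤ} {f : Bool → ℤ → ℤ} {D : ℤ → Decoration}
  {st : Bool → ℤ → State} {base : Bool → ℤ → ℤ}

/-- The weight of a vertex of colour `b` and of its pruned descendants (those whose ancestors up to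
the vertex are pruned). -/
noncomputable def stateWeight (D : ℤ → Decoration) (b : Bool) : State → (Var →₀ ℕ)
  | .inl i => Finsupp.single (colorVar b) 1 + ∑ side : Bool, treeWeight b (D i b side)
  | .inr t => Finsupp.single (colorVar b) 1 + treeWeight b t

/-- The same, for pruned vertices only. -/
noncomputable def prunedWeight (b : Bool) : State → (Var →₀ ℕ)
  | .inl _ => 0
  | .inr t => Finsupp.single (colorVar b) 1 + treeWeight b t

/-- The weight of a vertex is its own weight plus those of its pruned sons. -/
theorem sum_pruned_sons (h : S.IsDecorated k f D st base) (b : Bool) (w : ℤ) (W : Finset ℤ)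
    (hW : ∀ x, x ∈ W ↔ S.father (!b) x = w) :
    stateWeight D b (st b w) = Finsupp.single (colorVar b) 1 +
      ∑ x ∈ W, prunedWeight (!b) (st (!b) x) := by
  cases hs : st b w with
  | inr t =>
    rw [stateWeight, treeWeight_eq, ← sum_range_getElem?]
    congr 1
    have hWe : W = (Finset.range t.children.length).image (fun j : ℕ => base b w + (j : ℤ)) := by
      ext x
      rw [hW, Finset.mem_image]
      constructor
      · intro hx
        have h1 := h.sonState_of_father hx
        rw [hs] at h1
        obtain ⟨h2, u, hu, -⟩ := sonState_inr_eq_some h1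
        obtain ⟨h3, -⟩ := List.getElem?_eq_some_iff.1 hu
        exact ⟨(x - base b w).toNat, Finset.mem_range.2 h3, by omega⟩
      · rintro ⟨j, hj, rfl⟩
        refine h.father b w j (.inr (t.children[j]'(Finset.mem_range.1 hj))) ?_
        rw [hs]
        exact sonState_inr_of_getElem? (List.getElem?_eq_getElem (Finset.mem_range.1 hj))
    rw [hWe, Finset.sum_image (fun x _ y _ hxy => by simpa using hxy)]
    refine Finset.sum_congr rfl fun j hj => ?_
    have hj' : t.children[j]? = some _ := List.getElem?_eq_getElem (Finset.mem_range.1 hj)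
    have h1 : sonState D k b (st b w) j = some (.inr (t.children[j]'(Finset.mem_range.1 hj))) := by
      rw [hs]
      exact sonState_inr_of_getElem? hj'
    rw [h.state_of_sonState h1, hj']
    rfl
  | inl i =>
    have hw : w = f b i := h.eq_of_state b w i hs
    have hinj : Set.InjOn (fun q : Bool × ℕ => base b w + sidePosition q.1 q.2)
        (Set.univ : Set (Bool × ℕ)) := by
      rintro ⟨s1, m1⟩ - ⟨s2, m2⟩ - hq
      cases s1 <;> cases s2 <;> simp [sidePosition] at hq ⊢ <;> omega
    let J : Finset (Bool × ℕ) := Finset.univ.biUnion fun side : Bool =>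
      (Finset.range (D i b side).children.length).image fun m => (side, m)
    have hJ : ∀ side m, (side, m) ∈ J ↔ m < (D i b side).children.length := by
      intro side m
      cases side <;> simp [J]
    have hWe : W = insert (base b w) (J.image (fun q => base b w + sidePosition q.1 q.2)) := by
      ext x
      rw [hW, Finset.mem_insert, Finset.mem_image]
      constructor
      · intro hx
        have h1 := h.sonState_of_father hx
        rw [hs] at h1
        rcases sonState_inl_eq_some h1 with ⟨h2, -⟩ | ⟨side, m, u, h2, hu, -⟩
        · left; omega
        · obtain ⟨h3, -⟩ := List.getElem?_eq_some_iff.1 hu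
          exact Or.inr ⟨(side, m), (hJ _ _).2 h3, by simp only; omega⟩
      · rintro (rfl | ⟨⟨side, m⟩, hq, rfl⟩)
        · have h1 : sonState D k b (st b w) 0 = some (.inl (i - turn k (!b))) := by
            rw [hs]
            simp [sonState]
          simpa using h.father b w 0 _ h1
        · refine h.father b w _ (.inr ((D i b side).children[m]'((hJ _ _).1 hq))) ?_
          rw [hs, sonState_inl_sidePosition, List.getElem?_eq_getElem ((hJ _ _).1 hq)]
          rfl
    have hnot : base b w ∉ J.image (fun q => base b w + sidePosition q.1 q.2) := by
      rw [Finset.mem_image]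
      rintro ⟨⟨side, m⟩, -, hq⟩
      cases side <;> simp [sidePosition] at hq <;> omega
    rw [hWe, Finset.sum_insert hnot, Finset.sum_image (fun x _ y _ hxy => hinj trivial trivial hxy),
      Finset.sum_biUnion]
    · have h0 : prunedWeight (!b) (st (!b) (base b w)) = 0 := by
        rw [hw, h.base_trunk, h.state_trunk]
        rfl
      rw [h0, zero_add, stateWeight]
      congr 1
      refine Finset.sum_congr rfl fun side _ => ?_
      rw [treeWeight_eq, ← sum_range_getElem?, Finset.sum_image (by simp)]
      refine Finset.sum_congr rfl fun m hm => ?_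
      have hm' := List.getElem?_eq_getElem (Finset.mem_range.1 hm)
      have h1 : sonState D k b (st b w) (sidePosition side m) =
          some (.inr ((D i b side).children[m]'(Finset.mem_range.1 hm))) := by
        rw [hs, sonState_inl_sidePosition, hm']
        rfl
      rw [h.state_of_sonState h1, hm']
      rfl
    · intro s1 _ s2 _ hne
      rw [Function.onFun, Finset.disjoint_left]
      rintro ⟨s, m⟩ h1 h2
      simp only [Finset.mem_image, Prod.mk.injEq] at h1 h2
      obtain ⟨_, _, rfl, _⟩ := h1
      obtain ⟨_, _, rfl, _⟩ := h2
      exact hne rfl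

/-- One period further, the trunk index of a trunk vertex increases by `l`, and the tree of a pruned
vertex is the same. -/
theorem IsDecorated.state_add_size (hf : S.IsTrunk l k f) (h : S.IsDecorated k f D st base)
    (hD : ∀ i, D (i + l) = D i) (b : Bool) (x : ℤ) :
    st b (x + S.size b) = (st b x).map (· + (l : ℤ)) id := by
  -- the translated states describe the same forest with the same decorations
  have h' : S.IsDecorated k f D
      (fun b x => (st b (x - S.size b)).map (· + (l : ℤ)) id)
      (fun b x => base b (x - S.size b) + S.size (!b)) :=
    { state_trunk := fun b i => by
        have : f b i - S.size b = f b (i - l) := by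
          have := hf.periodic b (i - l)
          rw [sub_add_cancel] at this
          omega
        simp only [this, h.state_trunk, Sum.map_inl, sub_add_cancel]
      eq_of_state := fun b x i hx => by
        cases hs : st b (x - S.size b) with
        | inl j =>
          simp only [hs, Sum.map_inl, Sum.inl.injEq] at hx
          have := h.eq_of_state b _ j hs
          rw [← hx, hf.periodic, ← this]
          ring
        | inr t =>
          simp only [hs, Sum.map_inr] at hx
          exact absurd hx (by simp)
      base_trunk := fun b i => by
        have : f b i - S.size b = f b (i - l) := by
          have := hf.periodic b (i - l)
          rw [sub_add_cancel] at this
          omega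
        rw [this, h.base_trunk, ← hf.periodic]
        congr 1
        ring
      son := fun b x => by
        have e : S.father b x - S.size (!b) = S.father b (x - S.size b) := by
          have := S.periodic b (x - S.size b)
          rw [sub_add_cancel] at this
          omega
        simp only [Bool.not_not, e]
        have h1 := h.son b (x - S.size b)
        rw [show x - (base (!b) (S.father b (x - S.size b)) + S.size b) =
          x - S.size b - base (!b) (S.father b (x - S.size b)) by ring]
        generalize st (!b) (S.father b (x - S.size b)) = s at h1 ⊢
        exact sonState_translate hD h1
      father := fun b w j s hs => by
        have h1 : ∃ r, sonState D k b (st b (w - S.size b)) j = some r := by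
          have h2 := sonState_translate (c := -(l : ℤ)) (fun i => by
            rw [← hD, neg_add_cancel_right]) hs
          generalize st b (w - S.size b) = s at h2 ⊢
          cases s with
          | inl i =>
            simp only [Sum.map_inl, add_neg_cancel_right] at h2
            exact ⟨_, h2⟩
          | inr t => exact ⟨_, h2⟩
        obtain ⟨r, hr⟩ := h1
        have h3 := h.father _ _ _ _ hr
        have h4 := S.periodic (!b) (base b (w - S.size b) + j)
        rw [h3, Bool.not_not, sub_add_cancel] at h4
        rw [add_right_comm]
        exact h4 }
  cases hs : st b x with
  | inl i =>
    rw [h.eq_of_state b x i hs, ← hf.periodic, h.state_trunk]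
    rfl
  | inr t =>
    cases hs' : st b (x + S.size b) with
    | inl i =>
      have h1 := h.eq_of_state _ _ _ hs'
      have h2 := hf.periodic b (i - l)
      rw [sub_add_cancel] at h2
      have h3 : x = f b (i - l) := by omega
      rw [h3, h.state_trunk] at hs
      exact absurd hs (by simp)
    | inr t' =>
      have h1 := IsDecorated.tree_unique h h' t' hs' (t' := t) (by simp [hs])
      rw [h1]
      rfl

/-- The decorations account for all columns and rows of one period: in the sum of the weights of all
vertices of a period, the weight of every pruned vertex occurs once for itself and once in the
weight of its father. -/
theorem IsDecorated.sum_decorationWeight (hf : S.IsTrunk l k f) (h : S.IsDecorated k f D st base)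
    (hD : ∀ i, D (i + l) = D i) :
    ∑ i ∈ Finset.range l, decorationWeight (D i) =
      ∑ b : Bool, Finsupp.single (colorVar b) (S.size b) := by
  have hper : ∀ b x, stateWeight D b (st b (x + S.size b)) = stateWeight D b (st b x) := by
    intro b x
    rw [h.state_add_size hf hD]
    cases st b x with
    | inl i => simp only [Sum.map_inl, stateWeight, hD]
    | inr t => rfl
  have hper' : ∀ b x, prunedWeight b (st b (x + S.size b)) = prunedWeight b (st b x) := by
    intro b x
    rw [h.state_add_size hf hD]
    cases st b x <;> rfl
  have h1 : ∀ b, ∑ w ∈ Finset.Ico (0 : ℤ) (S.size b), stateWeight D b (st b w) =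
      Finsupp.single (colorVar b) (S.size b) +
        ∑ x ∈ Finset.Ico (0 : ℤ) (S.size (!b)), prunedWeight (!b) (st (!b) x) := by
    intro b
    obtain ⟨lo, hlo⟩ := exists_lowerAdjoint (S.mono (!b)) (S.periodic (!b))
      (by exact_mod_cast S.size_pos _)
    have hmem : ∀ x, x ∈ Finset.Ico (lo 0) (lo 0 + S.size (!b)) ↔
        S.father (!b) x ∈ Finset.Ico (0 : ℤ) (S.size b) := by
      intro x
      have e1 := hlo 0 x
      have e2 := hlo 0 (x - S.size (!b))
      have e3 := S.periodic (!b) (x - S.size (!b))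
      rw [sub_add_cancel, Bool.not_not] at e3
      rw [Finset.mem_Ico, Finset.mem_Ico]
      omega
    rw [← sum_Ico_periodic (h := fun x => prunedWeight (!b) (st (!b) x)) (S.size_pos _)
        (hper' (!b)) (lo 0),
      ← Finset.sum_fiberwise_of_maps_to (fun x hx => (hmem x).1 hx)]
    have e4 : ∀ w ∈ Finset.Ico (0 : ℤ) (S.size b), stateWeight D b (st b w) =
        Finsupp.single (colorVar b) 1 +
          ∑ x ∈ Finset.Ico (lo 0) (lo 0 + S.size (!b)) with S.father (!b) x = w,
            prunedWeight (!b) (st (!b) x) := by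
      intro w hw
      refine sum_pruned_sons h b w _ fun x => ?_
      rw [Finset.mem_filter, hmem]
      constructor
      · exact fun hx => hx.2
      · rintro rfl
        exact ⟨hw, rfl⟩
    rw [Finset.sum_congr rfl e4, Finset.sum_add_distrib]
    congr 1
    simp
  have h2 : ∀ b, ∑ x ∈ Finset.Ico (0 : ℤ) (S.size b), stateWeight D b (st b x) =
      ∑ x ∈ Finset.Ico (0 : ℤ) (S.size b), prunedWeight b (st b x) +
        ∑ i ∈ Finset.range l, stateWeight D b (.inl i) := by
    intro b
    rw [← sum_Ico_periodic (h := fun x => stateWeight D b (st b x)) (S.size_pos _)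
        (hper b) (f b 0),
      ← sum_Ico_periodic (h := fun x => prunedWeight b (st b x)) (S.size_pos _)
        (hper' b) (f b 0)]
    let g : ℤ → (Var →₀ ℕ) := fun x => match st b x with
      | .inl i => stateWeight D b (.inl i)
      | .inr _ => 0
    have e1 : ∀ x, stateWeight D b (st b x) = prunedWeight b (st b x) + g x := by
      intro x
      simp only [g]
      cases st b x <;> simp [prunedWeight, stateWeight]
    rw [Finset.sum_congr rfl fun x _ => e1 x, Finset.sum_add_distrib]
    congr 1
    have e2 : ∀ i : ℤ, stateWeight D b (.inl i) = g (f b i) := by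
      intro i
      simp only [g, h.state_trunk]
    have e3 : ∑ i ∈ Finset.range l, stateWeight D b (.inl (i : ℤ)) =
        ∑ i ∈ Finset.range l, g (f b (i : ℤ)) := Finset.sum_congr rfl fun i _ => e2 i
    rw [e3, ← Finset.sum_image (f := g)
      (g := fun i : ℕ => f b i) (fun x _ y _ hxy => by
        exact_mod_cast (hf.strictMono b).injective hxy)]
    symm
    have e0 := hf.periodic b 0
    rw [zero_add] at e0
    refine Finset.sum_subset (fun x hx => ?_) fun x hx hx' => ?_
    · obtain ⟨i, hi, rfl⟩ := Finset.mem_image.1 hx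
      rw [Finset.mem_Ico, ← e0, (hf.strictMono b).le_iff_le, (hf.strictMono b).lt_iff_lt]
      rw [Finset.mem_range] at hi
      omega
    · simp only [g]
      cases hs : st b x with
      | inr t => rfl
      | inl i =>
        exfalso
        apply hx'
        have hx1 := h.eq_of_state b x i hs
        rw [Finset.mem_Ico, ← e0, hx1, (hf.strictMono b).le_iff_le, (hf.strictMono b).lt_iff_lt]
          at hx
        refine Finset.mem_image.2 ⟨i.toNat, Finset.mem_range.2 (by omega), ?_⟩
        rw [hx1, Int.toNat_of_nonneg hx.1]
  have h3 : ∑ i ∈ Finset.range l, decorationWeight (D i) =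
      ∑ b : Bool, ∑ i ∈ Finset.range l, stateWeight D b (.inl i) := by
    rw [Finset.sum_comm]
    rfl
  rw [h3]
  simp only [Fintype.sum_bool]
  have a1 := (h1 true).symm.trans (h2 true)
  have a2 := (h1 false).symm.trans (h2 false)
  simp only [Bool.not_true, Bool.not_false] at a1 a2
  have a3 := congrArg₂ (· + ·) a1 a2
  generalize ∑ x ∈ Finset.Ico (0 : ℤ) (S.size true), prunedWeight true (st true x) = p at a3
  generalize ∑ x ∈ Finset.Ico (0 : ℤ) (S.size false), prunedWeight false (st false x) = q at a3
  refine add_left_cancel (a := p + q) ?_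
  rw [show p + q + (Finsupp.single (colorVar true) (S.size true) +
    Finsupp.single (colorVar false) (S.size false)) = Finsupp.single (colorVar true) (S.size true) +
      q + (Finsupp.single (colorVar false) (S.size false) + p) by abel, a3]
  abel

end CyclicForest
end PPP

namespace PPP

/-! ### Pointed polyominoes and tuples of decorations -/

namespace CyclicForest

variable {S : CyclicForest} {l : ℕ} {k : ℤ} {f : Bool → ℤ → ℤ} {D : ℤ → Decoration}
  {st : Bool → ℤ → State} {base : Bool → ℤ → ℤ}

theorem IsDecorated.shift (h : S.IsDecorated k f D st base) (a : Bool → ℤ) :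
    (S.shift a).IsDecorated k (fun b i => f b i - a b) D (fun b x => st b (x + a b))
      (fun b x => base b (x + a b) - a (!b)) where
  state_trunk b i := by simp only [sub_add_cancel, h.state_trunk]
  eq_of_state b x i hx := by rw [← h.eq_of_state b _ i hx, add_sub_cancel_right]
  base_trunk b i := by simp only [sub_add_cancel, h.base_trunk]
  son b x := by
    have h1 := h.son b (x + a b)
    simp only [CyclicForest.shift, sub_add_cancel, Bool.not_not]
    rwa [show x - (base (!b) (S.father b (x + a b)) - a b) =
      x + a b - base (!b) (S.father b (x + a b)) by ring]
  father b w j s hs := by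
    have h1 := h.father b (w + a b) j s hs
    simp only [CyclicForest.shift, Bool.not_not]
    rw [show base b (w + a b) - a (!b) + j + a (!b) = base b (w + a b) + j by ring, h1,
      add_sub_cancel_right]

theorem shift_shift_neg (S : CyclicForest) (a : Bool → ℤ) :
    (S.shift a).shift (fun b => -a b) = S := by
  refine CyclicForest.ext rfl ?_
  funext b x
  simp [CyclicForest.shift]

end CyclicForest

/-- The polyomino `P` has a trunk with parameters `l` and `k`, the trunk component with index `0` is
that of the column `c`, and `D` is the family of decorations of the trunk, numbered from there. -/
def IsDecoratedBy (l : ℕ) (k c : ℤ) (P : NondegeneratePPP) (D : ℤ → Decoration) : Prop :=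
  ∃ f st base, P.forest.IsTrunk l k f ∧ f true 0 = c ∧ P.forest.IsDecorated k f D st base

section

variable {l : ℕ} {k c : ℤ} {P P' : NondegeneratePPP} {D D' : ℤ → Decoration}

theorem exists_isDecoratedBy {f : Bool → ℤ → ℤ} (hf : P.forest.IsTrunk l k f) :
    ∃ D, (∀ i, D (i + l) = D i) ∧ IsDecoratedBy l k (f true 0) P D := by
  obtain ⟨D, st, base, hD, h⟩ := hf.exists_isDecorated
  exact ⟨D, hD, f, st, base, hf, rfl, h⟩

theorem IsDecoratedBy.decoration_unique (h : IsDecoratedBy l k c P D)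
    (h' : IsDecoratedBy l k c P D') : D = D' := by
  obtain ⟨f, st, base, hf, hc, hd⟩ := h
  obtain ⟨f', st', base', hf', hc', hd'⟩ := h'
  obtain ⟨-, -, s, hs⟩ := hf.unique hf'
  have h0 : s = 0 := by
    have h1 := hs true 0
    rw [hc', ← hc, zero_add] at h1
    exact ((hf.strictMono true).injective h1).symm
  obtain rfl : f' = f := by
    funext b i
    rw [hs, h0, add_zero]
  exact hd.decoration_unique hd'

/-- The decorations determine the forest up to a translation of the columns and of the rows. The
former is fixed by the column `c`, the latter by the normalization of the polyomino. -/
theorem IsDecoratedBy.polyomino_unique (h : IsDecoratedBy l k c P D)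
    (h' : IsDecoratedBy l k c P' D) : P = P' := by
  obtain ⟨f, st, base, hf, hc, hd⟩ := h
  obtain ⟨f', st', base', hf', hc', hd'⟩ := h'
  let a : Bool → ℤ := fun b => f b 0
  let a' : Bool → ℤ := fun b => f' b 0
  obtain ⟨hS, -⟩ := CyclicForest.IsDecorated.forest_unique (hf.shift a) (hf'.shift a') (hd.shift a)
    (hd'.shift a') (fun b => sub_self _) (fun b => sub_self _)
  have ht : a true = a' true := hc.trans hc'.symm
  have hfa : ∀ y, P.forest.father false (y + a false) = P'.forest.father false (y + a' false) := by
    intro y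
    have h1 : (P.forest.shift a).father false y = (P'.forest.shift a').father false y := by rw [hS]
    simp only [CyclicForest.shift, Bool.not_false] at h1
    omega
  have hr : a false = a' false := by
    have h1 := P.forest_normalized
    have h2 := P'.forest_normalized
    have e1 := hfa (-a false)
    have e2 := hfa (-a' false)
    have n1 := h1 (-a false + a false)
    have n2 := h2 (-a false + a' false)
    have n3 := h1 (-a' false + a false)
    have n4 := h2 (-a' false + a' false)
    rw [e1] at n1
    rw [e2] at n3
    omega
  have haa : a = a' := by
    funext b
    cases b
    · exact hr
    · exact ht
  apply NondegeneratePPP.forest_injective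
  rw [← CyclicForest.shift_shift_neg P.forest a, hS, haa, CyclicForest.shift_shift_neg]

/-- Every periodic family of decorations comes from a polyomino: the forest with these decorations is
translated so that the trunk column `0` becomes the column `c` and the normalization holds, which
leaves the condition on grandfathers, equivalent to `1 ≤ k`. -/
theorem exists_polyomino (hl : 0 < l) (hk : 1 ≤ k) (c : ℤ) (hD : ∀ i, D (i + l) = D i) :
    ∃ P, IsDecoratedBy l k c P D := by
  obtain ⟨S, f, st, base, hf, h0, hd⟩ := CyclicForest.exists_forest_isDecorated hl k hD
  obtain ⟨lo, hlo⟩ := exists_lowerAdjoint (S.mono false) (S.periodic false)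
    (by exact_mod_cast S.size_pos _)
  let a : Bool → ℤ := fun b => if b then -c else lo (-c)
  have hf' := hf.shift a
  obtain ⟨P, hP⟩ := NondegeneratePPP.exists_forest_eq (S.shift a) (hf'.one_le_iff.1 hk) (by
    intro Y
    have h1 := hlo (-c) (Y + lo (-c))
    simp only [CyclicForest.shift, a, Bool.not_false, if_true, Bool.false_eq_true, if_false]
    omega)
  refine ⟨P, _, _, _, hP ▸ hf', ?_, hP ▸ hd.shift a⟩
  simp [h0, a]

end

/-- The periodic extension of a tuple. -/
def periodicExtension {A : Type*} {l : ℕ} (hl : 0 < l) (D : Fin l → A) (i : ℤ) : A :=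
  D ⟨(i % l).toNat, by
    have h1 := Int.emod_nonneg i (b := l) (by omega)
    have h2 := Int.emod_lt_of_pos i (b := l) (by omega)
    omega⟩

section

variable {A : Type*} {l : ℕ} (hl : 0 < l)

theorem periodicExtension_add (D : Fin l → A) (i : ℤ) :
    periodicExtension hl D (i + l) = periodicExtension hl D i := by
  simp [periodicExtension]

theorem periodicExtension_natCast (D : Fin l → A) (i : Fin l) :
    periodicExtension hl D (i : ℕ) = D i := by
  unfold periodicExtension
  congr
  rw [Int.emod_eq_of_lt (by omega) (by omega)]
  rfl

theorem periodicExtension_restrict {D : ℤ → A} (hD : ∀ i, D (i + l) = D i) :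
    periodicExtension hl (fun i : Fin l => D (i : ℕ)) = D := by
  funext i
  have hp : Function.Periodic D (l : ℤ) := hD
  unfold periodicExtension
  simp only
  rw [Int.toNat_of_nonneg (Int.emod_nonneg i (by omega))]
  conv_rhs => rw [← Int.emod_add_mul_ediv i l, mul_comm]
  exact (hp.int_mul (i / l) (i % l)).symm

end

/-- The weight of a polyomino without its thickness. -/
noncomputable def sizeWeight (P : NondegeneratePPP) : Var →₀ ℕ :=
  Finsupp.single Var.black P.1.width + Finsupp.single Var.white P.1.height

theorem sizeWeight_black (P : NondegeneratePPP) : sizeWeight P Var.black = P.1.width := by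
  simp [sizeWeight]

theorem IsDecoratedBy.sum_decorationWeight {l : ℕ} {k c : ℤ} {P : NondegeneratePPP} (hl : 0 < l)
    {D : Fin l → Decoration} (h : IsDecoratedBy l k c P (periodicExtension hl D)) :
    ∑ i, decorationWeight (D i) = sizeWeight P := by
  obtain ⟨f, st, base, hf, hc, hd⟩ := h
  have h1 := hd.sum_decorationWeight hf (periodicExtension_add hl D)
  rw [Finset.sum_range] at h1
  simp only [periodicExtension_natCast] at h1
  rw [h1]
  simp [sizeWeight, colorVar]

/-- The non-degenerated polyominoes whose trunk has parameters `l` and `k`. -/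
abbrev TrunkClass (l k : ℕ) : Type := {P : NondegeneratePPP // ∃ f, P.forest.IsTrunk l (k : ℤ) f}

/-- The objects of a class, pointed at one of the units that are counted by the variable `s`. -/
abbrev Pointed {α : Type} (wt : α → (Var →₀ ℕ)) (s : Var) : Type := {p : α × ℕ // p.2 < wt p.1 s}

/-- There are exactly `l` trunk columns in a period. -/
theorem exists_trunk_enumeration {l k : ℕ} (P : TrunkClass l k) :
    ∃ g : Fin l → ℕ, Function.Injective g ∧ ∀ c : ℕ, (∃ i, g i = c) ↔
      c < P.1.1.width ∧ ∃ f, P.1.forest.IsTrunk l (k : ℤ) f ∧ f true 0 = c := by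
  obtain ⟨P, f, hf⟩ := P
  have hp := hf.periodic true
  simp only [NondegeneratePPP.forest_size_true] at hp
  obtain ⟨lo, hlo⟩ := exists_lowerAdjoint (hf.strictMono true).monotone hp
    (by exact_mod_cast P.1.width_pos)
  have hmem : ∀ i, 0 ≤ f true i ∧ f true i < P.1.width ↔ lo 0 ≤ i ∧ i < lo 0 + l := by
    intro i
    have e1 := hlo 0 i
    have e2 := hlo 0 (i - l)
    have e3 := hp (i - l)
    rw [sub_add_cancel] at e3
    omega
  have hcast : ∀ i : Fin l, ((f true (lo 0 + (i : ℕ))).toNat : ℤ) = f true (lo 0 + (i : ℕ)) :=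
    fun i => Int.toNat_of_nonneg ((hmem _).2 (by omega)).1
  refine ⟨fun i => (f true (lo 0 + (i : ℕ))).toNat, fun i j hij => ?_, fun c => ⟨?_, ?_⟩⟩
  · simp only at hij
    have h1 := hcast i
    rw [hij, hcast j] at h1
    have h2 := (hf.strictMono true).injective h1
    ext
    omega
  · rintro ⟨i, rfl⟩
    have h1 := (hmem (lo 0 + (i : ℕ))).2 (by omega)
    refine ⟨by simp only; omega, _, hf.shift_index (lo 0 + (i : ℕ)), ?_⟩
    rw [hcast, zero_add]
  · rintro ⟨hc, f', hf', hc'⟩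
    obtain ⟨-, -, s, hs⟩ := hf.unique hf'
    rw [hs, zero_add] at hc'
    have h1 := (hmem s).1 (hc' ▸ ⟨Int.natCast_nonneg c, Int.ofNat_lt.2 hc⟩)
    refine ⟨⟨(s - lo 0).toNat, by omega⟩, ?_⟩
    simp only
    rw [Int.toNat_of_nonneg (by omega), add_sub_cancel, hc', Int.toNat_natCast]

/-- Both sides count the polyominoes pointed at a trunk column `c`: there are `l` trunk columns, and,
for each value of `c`, the polyomino amounts to the tuple of the decorations of its trunk. -/
theorem exists_pointed_equiv {l k : ℕ} (hl : 0 < l) (hk : 0 < k) :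
    ∃ e : TrunkClass l k × Fin l ≃
        Pointed (fun D : Fin l → Decoration => ∑ i, decorationWeight (D i)) Var.black,
      ∀ p, ∑ i, decorationWeight ((e p).1.1 i) = sizeWeight p.1.1 := by
  choose g hginj hg using fun P : TrunkClass l k => exists_trunk_enumeration P
  have hdec : ∀ p : TrunkClass l k × Fin l, ∃ D : Fin l → Decoration,
      IsDecoratedBy l k (g p.1 p.2 : ℕ) p.1.1 (periodicExtension hl D) := by
    intro p
    obtain ⟨-, f, hf, hc⟩ := (hg p.1 _).1 ⟨p.2, rfl⟩
    obtain ⟨D, hD, h⟩ := exists_isDecoratedBy hf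
    exact ⟨fun i => D (i : ℕ), by rwa [periodicExtension_restrict hl hD, ← hc]⟩
  choose D hD using hdec
  have hw : ∀ p, ∑ i, decorationWeight (D p i) = sizeWeight p.1.1 :=
    fun p => (hD p).sum_decorationWeight hl
  refine ⟨Equiv.ofBijective (fun p => ⟨(D p, g p.1 p.2), ?_⟩) ⟨?_, ?_⟩, fun p => hw p⟩
  · simp only
    rw [hw, sizeWeight_black]
    exact ((hg p.1 _).1 ⟨p.2, rfl⟩).1
  · rintro ⟨P, i⟩ ⟨P', i'⟩ h
    simp only [Subtype.mk.injEq, Prod.mk.injEq] at h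
    have h1 := hD (P, i)
    rw [h.1, h.2] at h1
    obtain rfl : P = P' := Subtype.ext (h1.polyomino_unique (hD (P', i')))
    rw [hginj P h.2]
  · rintro ⟨⟨E, c⟩, hc⟩
    obtain ⟨P, hP⟩ := exists_polyomino (k := k) hl (by omega) c (periodicExtension_add hl E)
    simp only at hc
    rw [hP.sum_decorationWeight hl, sizeWeight_black] at hc
    obtain ⟨f, st, base, hf, hc', hd⟩ := id hP
    obtain ⟨i, hi⟩ := (hg ⟨P, f, hf⟩ c).2 ⟨hc, f, hf, hc'⟩
    refine ⟨(⟨P, f, hf⟩, i), ?_⟩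
    have h1 := hD (⟨P, f, hf⟩, i)
    simp only [hi] at h1
    have h2 := h1.decoration_unique hP
    simp only [Subtype.mk.injEq, Prod.mk.injEq, hi, and_true]
    funext j
    rw [← periodicExtension_natCast hl (D _) j, h2, periodicExtension_natCast]

end PPP

namespace PPP

/-! ### Generating functions of combinatorial classes -/

section GeneratingFunctions

variable {α β : Type} {w : α → (Var →₀ ℕ)} {w' : β → (Var →₀ ℕ)}

theorem coeff_genFun (w : α → (Var →₀ ℕ)) (n : Var →₀ ℕ) :
    MvPowerSeries.coeff n (genFun w) = (Nat.card {a : α // w a = n} : ℚ) := rfl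

theorem FinitelyManyOfEachWeight.of_injective (h : FinitelyManyOfEachWeight w') {φ : α → β}
    (hφ : Function.Injective φ) (hw : ∀ a, w' (φ a) = w a) : FinitelyManyOfEachWeight w := by
  intro n
  have := h n
  refine Finite.of_injective
    (fun a : {a // w a = n} => (⟨φ a.1, (hw _).trans a.2⟩ : {b // w' b = n})) fun a a' haa => ?_
  exact Subtype.ext (hφ (congrArg Subtype.val haa))

theorem genFun_congr (e : α ≃ β) (he : ∀ a, w' (e a) = w a) : genFun w = genFun w' := by
  ext n
  rw [coeff_genFun, coeff_genFun,
    Nat.card_congr (e.subtypeEquiv (q := fun b => w' b = n) fun a => by rw [he])]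

/-- Classes with equal generating functions are in bijection, weight by weight. -/
theorem exists_equiv_of_genFun_eq (h : FinitelyManyOfEachWeight w)
    (h' : FinitelyManyOfEachWeight w') (hww : genFun w = genFun w') :
    ∃ e : α ≃ β, ∀ a, w' (e a) = w a := by
  have hcard : ∀ n, Nat.card {a // w a = n} = Nat.card {b // w' b = n} := fun n => by
    have h1 := congrArg (MvPowerSeries.coeff n) hww
    rw [coeff_genFun, coeff_genFun] at h1
    exact_mod_cast h1
  let e : ∀ n, {a // w a = n} ≃ {b // w' b = n} := fun n =>
    have := h n
    have := h' n
    (Finite.card_eq.1 (hcard n)).some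
  refine ⟨((Equiv.sigmaFiberEquiv w).symm.trans (Equiv.sigmaCongrRight e)).trans
    (Equiv.sigmaFiberEquiv w'), fun a => ?_⟩
  exact (e (w a) ⟨a, rfl⟩).2

/-- The pairs of given weight, sorted by the weights of their components. -/
def fiberProdEquiv (w : α → (Var →₀ ℕ)) (w' : β → (Var →₀ ℕ)) (n : Var →₀ ℕ) :
    {p : α × β // w p.1 + w' p.2 = n} ≃
      Σ q : Finset.HasAntidiagonal.antidiagonal n, {a // w a = q.1.1} × {b // w' b = q.1.2} where
  toFun p := ⟨⟨(w p.1.1, w' p.1.2), Finset.HasAntidiagonal.mem_antidiagonal.2 p.2⟩, ⟨p.1.1, rfl⟩, ⟨p.1.2, rfl⟩⟩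
  invFun x := ⟨(x.2.1.1, x.2.2.1), by
    rw [x.2.1.2, x.2.2.2]
    exact Finset.HasAntidiagonal.mem_antidiagonal.1 x.1.2⟩
  left_inv _ := rfl
  right_inv := by
    rintro ⟨⟨⟨i, j⟩, hij⟩, ⟨a, ha⟩, ⟨b, hb⟩⟩
    simp only at ha hb
    subst ha hb
    rfl

theorem FinitelyManyOfEachWeight.prod (h : FinitelyManyOfEachWeight w)
    (h' : FinitelyManyOfEachWeight w') :
    FinitelyManyOfEachWeight fun p : α × β => w p.1 + w' p.2 := by
  intro n
  have := fun q : Finset.HasAntidiagonal.antidiagonal n => h q.1.1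
  have := fun q : Finset.HasAntidiagonal.antidiagonal n => h' q.1.2
  exact Finite.of_equiv _ (fiberProdEquiv w w' n).symm

theorem genFun_prod (h : FinitelyManyOfEachWeight w) (h' : FinitelyManyOfEachWeight w') :
    genFun (fun p : α × β => w p.1 + w' p.2) = genFun w * genFun w' := by
  ext n
  have := fun q : Finset.HasAntidiagonal.antidiagonal n => h q.1.1
  have := fun q : Finset.HasAntidiagonal.antidiagonal n => h' q.1.2
  rw [MvPowerSeries.coeff_mul, coeff_genFun, Nat.card_congr (fiberProdEquiv w w' n),
    Nat.card_sigma, Nat.cast_sum,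
    ← Finset.sum_coe_sort (Finset.HasAntidiagonal.antidiagonal n)]
  refine Finset.sum_congr rfl fun q _ => ?_
  rw [Nat.card_prod, Nat.cast_mul, coeff_genFun, coeff_genFun]

theorem FinitelyManyOfEachWeight.of_finite [Finite α] (w : α → (Var →₀ ℕ)) :
    FinitelyManyOfEachWeight w := fun _ => inferInstance

theorem genFun_unique [Unique α] (w : α → (Var →₀ ℕ)) :
    genFun w = MvPowerSeries.monomial (w default) 1 := by
  ext n
  rw [coeff_genFun, MvPowerSeries.coeff_monomial]
  split_ifs with hn
  · have : Unique {a // w a = n} := ⟨⟨⟨default, hn.symm⟩⟩, fun a => Subtype.ext (Unique.eq_default _)⟩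
    simp
  · have : IsEmpty {a // w a = n} := ⟨fun a => hn (by rw [← a.2, Unique.eq_default a.1])⟩
    simp

theorem genFun_sum (h : FinitelyManyOfEachWeight w) (h' : FinitelyManyOfEachWeight w') :
    genFun (Sum.elim w w') = genFun w + genFun w' := by
  ext n
  have : Finite {a // Sum.elim w w' (.inl a) = n} := h n
  have : Finite {b // Sum.elim w w' (.inr b) = n} := h' n
  rw [map_add, coeff_genFun, coeff_genFun, coeff_genFun,
    Nat.card_congr (Equiv.subtypeSum (p := fun c => Sum.elim w w' c = n)), Nat.card_sum]
  simp

/-- A class whose objects are either a single object of weight `0` or pairs. -/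
theorem genFun_eq_one_add_mul {γ : Type} {w'' : γ → (Var →₀ ℕ)} (h : FinitelyManyOfEachWeight w)
    (h' : FinitelyManyOfEachWeight w') (e : γ ≃ Unit ⊕ α × β)
    (he : ∀ c, Sum.elim (fun _ => 0) (fun p : α × β => w p.1 + w' p.2) (e c) = w'' c) :
    genFun w'' = 1 + genFun w * genFun w' := by
  rw [genFun_congr e he, genFun_sum (.of_finite _) (h.prod h'), genFun_unique, genFun_prod h h']
  simp [MvPowerSeries.monomial_zero_eq_C_apply]

theorem genFun_nsmul_card (w : α → (Var →₀ ℕ)) (l : ℕ) :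
    genFun (fun p : α × Fin l => w p.1) = l • genFun w := by
  ext n
  let e : {p : α × Fin l // w p.1 = n} ≃ {a // w a = n} × Fin l :=
    { toFun p := (⟨p.1.1, p.2⟩, p.1.2)
      invFun p := ⟨(p.1.1, p.2), p.1.2⟩
      left_inv _ := rfl
      right_inv _ := rfl }
  rw [map_nsmul, coeff_genFun, coeff_genFun, Nat.card_congr e, Nat.card_prod]
  simp [mul_comm]

/-- The pointed objects of given weight. -/
def fiberPointedEquiv (w : α → (Var →₀ ℕ)) (s : Var) (n : Var →₀ ℕ) :
    {p : Pointed w s // w p.1.1 = n} ≃ {a // w a = n} × Fin (n s) where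
  toFun p := (⟨p.1.1.1, p.2⟩, ⟨p.1.1.2, by have h1 := p.1.2; rwa [p.2] at h1⟩)
  invFun p := ⟨⟨(p.1.1, p.2), by rw [p.1.2]; exact p.2.2⟩, p.1.2⟩
  left_inv _ := rfl
  right_inv _ := rfl

theorem FinitelyManyOfEachWeight.pointed (h : FinitelyManyOfEachWeight w) (s : Var) :
    FinitelyManyOfEachWeight fun p : Pointed w s => w p.1.1 := by
  intro n
  have := h n
  exact Finite.of_equiv _ (fiberPointedEquiv w s n).symm

theorem coeff_X_mul_pderiv (f : MvPowerSeries Var ℚ) (s : Var) (n : Var →₀ ℕ) :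
    MvPowerSeries.coeff n (MvPowerSeries.X s * MvPowerSeries.pderiv ℚ s f) =
      n s * MvPowerSeries.coeff n f := by
  classical
  rw [MvPowerSeries.X_def, MvPowerSeries.coeff_monomial_mul]
  split_ifs with h
  · obtain ⟨m, rfl⟩ := exists_add_of_le h
    rw [add_tsub_cancel_left, MvPowerSeries.coeff_pderiv, add_comm m]
    simp [mul_comm, add_comm]
  · have h1 : n s = 0 := by
      by_contra hs
      exact h (Finsupp.single_le_iff.2 (Nat.one_le_iff_ne_zero.2 hs))
    simp [h1]

/-- Pointing is the operator `X s * ∂ / ∂ s`. -/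
theorem genFun_pointed (w : α → (Var →₀ ℕ)) (s : Var) :
    genFun (fun p : Pointed w s => w p.1.1) =
      MvPowerSeries.X s * MvPowerSeries.pderiv ℚ s (genFun w) := by
  ext n
  rw [coeff_X_mul_pderiv, coeff_genFun, coeff_genFun, Nat.card_congr (fiberPointedEquiv w s n),
    Nat.card_prod]
  simp [mul_comm]

theorem genFun_tuples (h : FinitelyManyOfEachWeight w) (l : ℕ) :
    FinitelyManyOfEachWeight (fun D : Fin l → α => ∑ i, w (D i)) ∧
      genFun (fun D : Fin l → α => ∑ i, w (D i)) = genFun w ^ l := by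
  induction l with
  | zero =>
    refine ⟨.of_finite _, ?_⟩
    rw [genFun_unique]
    simp [MvPowerSeries.monomial_zero_eq_C_apply]
  | succ l ih =>
    have he : ∀ D : Fin (l + 1) → α, (fun p : α × (Fin l → α) => w p.1 + ∑ i, w (p.2 i))
        ((Fin.consEquiv fun _ => α).symm D) = ∑ i, w (D i) := fun D => by
      rw [Fin.sum_univ_succ]
      rfl
    refine ⟨(h.prod ih.1).of_injective (Fin.consEquiv fun _ => α).symm.injective he, ?_⟩
    rw [genFun_congr (w' := fun p : α × (Fin l → α) => w p.1 + ∑ i, w (p.2 i))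
      (Fin.consEquiv fun _ => α).symm he, genFun_prod h ih.1, ih.2, pow_succ']

theorem FinitelyManyOfEachWeight.list (h : FinitelyManyOfEachWeight w) (h0 : ∀ a, w a ≠ 0) :
    FinitelyManyOfEachWeight fun L : List α => (L.map w).sum := by
  intro n
  -- a list of weight `n` has elements of weight at most `n`, and at most `n.degree` of them
  have hs : {a | w a ≤ n}.Finite := by
    have h1 : {a | w a ≤ n} = ⋃ m ∈ Set.Iic n, {a | w a = m} := by
      ext a
      simp
    rw [h1]
    exact (Set.finite_Iic n).biUnion fun m _ => h m
  have key : ∀ d : ℕ, {L : List α | (L.map w).sum ≤ n ∧ (L.map w).sum.degree ≤ d}.Finite := by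
    intro d
    induction d with
    | zero =>
      refine (Set.finite_singleton []).subset ?_
      rintro (_ | ⟨a, L⟩) ⟨-, hL⟩
      · rfl
      · simp only [List.map_cons, List.sum_cons, map_add, Nat.le_zero, Nat.add_eq_zero_iff,
          Finsupp.degree_eq_zero_iff] at hL
        exact absurd hL.1 (h0 a)
    | succ d ih =>
      refine ((Set.finite_singleton []).union (hs.image2 List.cons ih)).subset ?_
      rintro (_ | ⟨a, L⟩) ⟨hn, hL⟩
      · exact .inl rfl
      · simp only [List.map_cons, List.sum_cons] at hn
        simp only [List.map_cons, List.sum_cons, map_add] at hL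
        have h1 : (w a).degree ≠ 0 := fun h1 => h0 a ((Finsupp.degree_eq_zero_iff _).1 h1)
        exact .inr ⟨a, le_self_add.trans hn, L, ⟨le_add_self.trans hn, by omega⟩, rfl⟩
  exact ((key n.degree).subset fun L hL => ⟨le_of_eq hL, le_of_eq (congrArg _ hL)⟩)

/-- Lists are empty, or consist of a first element and a list. -/
def listEquiv (α : Type) : List α ≃ Unit ⊕ α × List α where
  toFun
    | [] => .inl ()
    | a :: L => .inr (a, L)
  invFun
    | .inl _ => []
    | .inr p => p.1 :: p.2
  left_inv L := by cases L <;> rfl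
  right_inv x := by rcases x with _ | p <;> rfl

theorem constantCoeff_genFun (h0 : ∀ a, w a ≠ 0) :
    MvPowerSeries.constantCoeff (genFun w) = 0 := by
  rw [← MvPowerSeries.coeff_zero_eq_constantCoeff_apply, coeff_genFun]
  have : IsEmpty {a // w a = 0} := ⟨fun a => h0 a.1 a.2⟩
  simp

theorem genFun_list (h : FinitelyManyOfEachWeight w) (h0 : ∀ a, w a ≠ 0) :
    genFun (fun L : List α => (L.map w).sum) = (1 - genFun w)⁻¹ := by
  rw [MvPowerSeries.eq_inv_iff_mul_eq_one (by rw [map_sub, constantCoeff_genFun h0]; simp)]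
  have h1 := genFun_eq_one_add_mul h (h.list h0) (listEquiv α) (w'' := fun L => (L.map w).sum) (by
    rintro (_ | ⟨a, L⟩) <;> simp [listEquiv])
  linear_combination h1

end GeneratingFunctions

/-! ### Trees and decorations -/

/-- An ordered tree is a single vertex, or consists of its first subtree and the rest. -/
def OrderedTree.equiv : OrderedTree ≃ Unit ⊕ OrderedTree × OrderedTree where
  toFun
    | .node [] => .inl ()
    | .node (u :: us) => .inr (u, .node us)
  invFun
    | .inl _ => .node []
    | .inr p => .node (p.1 :: p.2.children)
  left_inv := by rintro ⟨_ | ⟨u, us⟩⟩ <;> rfl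
  right_inv := by rintro (_ | ⟨u, ⟨us⟩⟩) <;> rfl

theorem treeWeight_nil (b : Bool) : treeWeight b (.node []) = 0 := by
  rw [treeWeight_eq]
  rfl

theorem treeWeight_cons (b : Bool) (u : OrderedTree) (us : List OrderedTree) :
    treeWeight b (.node (u :: us)) =
      Finsupp.single (colorVar (!b)) 1 + treeWeight (!b) u + treeWeight b (.node us) := by
  rw [treeWeight_eq, treeWeight_eq b (.node us)]
  simp

theorem finitelyManyOfEachWeight_treeWeight (b : Bool) :
    FinitelyManyOfEachWeight (treeWeight b) := by
  have key : ∀ d : ℕ, ∀ b, {t | (treeWeight b t).degree ≤ d}.Finite := by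
    intro d
    induction d with
    | zero =>
      refine fun b => (Set.finite_singleton (.node [])).subset ?_
      rintro ⟨_ | ⟨u, us⟩⟩ h
      · rfl
      · simp only [Set.mem_ofPred_eq, treeWeight_cons, map_add, Finsupp.degree_single] at h
        omega
    | succ d ih =>
      refine fun b => ((Set.finite_singleton (.node [])).union ((ih (!b)).image2
        (fun u t => .node (u :: t.children)) (ih b))).subset ?_
      rintro ⟨_ | ⟨u, us⟩⟩ h
      · exact .inl rfl
      · simp only [Set.mem_ofPred_eq, treeWeight_cons, map_add, Finsupp.degree_single] at h
        refine .inr ⟨u, ?_, .node us, ?_, rfl⟩ <;> simp only [Set.mem_ofPred_eq] <;> omega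
  intro n
  exact (key n.degree b).subset fun t ht => by rw [Set.mem_ofPred_eq, ht]

/-- The generating function of the trees with root of colour `b`. -/
noncomputable abbrev treeGenFun (b : Bool) : MvPowerSeries Var ℚ := genFun (treeWeight b)

theorem treeGenFun_true : treeGenFun true = Ablack := rfl
theorem treeGenFun_false : treeGenFun false = Awhite := rfl

/-- The decomposition of a tree into its first subtree and the rest. -/
theorem treeGenFun_eq (b : Bool) : treeGenFun b =
    1 + MvPowerSeries.X (colorVar (!b)) * treeGenFun (!b) * treeGenFun b := by
  have h1 := (FinitelyManyOfEachWeight.of_finite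
    fun _ : Unit => Finsupp.single (colorVar (!b)) 1).prod
    (finitelyManyOfEachWeight_treeWeight (!b))
  have h2 := genFun_eq_one_add_mul (w'' := treeWeight b) h1 (finitelyManyOfEachWeight_treeWeight b)
    (OrderedTree.equiv.trans (.sumCongr (.refl _) (.prodCongr (Equiv.punitProd _).symm (.refl _))))
    (by
      rintro ⟨_ | ⟨u, us⟩⟩
      · simp [OrderedTree.equiv, treeWeight_nil]
      · simp [OrderedTree.equiv, treeWeight_cons])
  have h3 := genFun_prod (w := fun _ : Unit => Finsupp.single (colorVar (!b)) 1) (.of_finite _)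
    (finitelyManyOfEachWeight_treeWeight (!b))
  rw [h3, genFun_unique fun _ : Unit => Finsupp.single (colorVar (!b)) 1] at h2
  exact h2

theorem decorationWeight_ne_zero (d : Decoration) : decorationWeight d ≠ 0 := by
  intro h
  have h1 := congrArg (fun v => v Var.black) h
  simp [decorationWeight, colorVar] at h1

/-- A decoration consists of a trunk column and a trunk row, with two trees attached to each. -/
def decorationEquiv :
    Decoration ≃ Unit × ((OrderedTree × OrderedTree) × (OrderedTree × OrderedTree)) where
  toFun d := ((), (d true true, d true false), (d false true, d false false))
  invFun p b side := if b then (if side then p.2.1.1 else p.2.1.2)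
    else (if side then p.2.2.1 else p.2.2.2)
  left_inv d := by
    funext b side
    cases b <;> cases side <;> rfl
  right_inv _ := rfl

theorem genFun_decorationWeight : FinitelyManyOfEachWeight decorationWeight ∧
    genFun decorationWeight = zb * zw * Ablack ^ 2 * Awhite ^ 2 := by
  let wu : Unit → (Var →₀ ℕ) := fun _ =>
    Finsupp.single (colorVar true) 1 + Finsupp.single (colorVar false) 1
  let wt : Bool → OrderedTree × OrderedTree → (Var →₀ ℕ) := fun b p =>
    treeWeight b p.1 + treeWeight b p.2
  let wtt : (OrderedTree × OrderedTree) × (OrderedTree × OrderedTree) → (Var →₀ ℕ) := fun p =>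
    wt true p.1 + wt false p.2
  have h1 := finitelyManyOfEachWeight_treeWeight
  have h2 : ∀ b, FinitelyManyOfEachWeight (wt b) := fun b => (h1 b).prod (h1 b)
  have h3 : FinitelyManyOfEachWeight wu := .of_finite _
  have h4 : FinitelyManyOfEachWeight wtt := (h2 true).prod (h2 false)
  have he : ∀ d : Decoration, (fun p : Unit × _ => wu p.1 + wtt p.2) (decorationEquiv d) =
      decorationWeight d := fun d => by
    simp only [decorationWeight, Fintype.sum_bool, wu, wtt, wt, decorationEquiv, Equiv.coe_fn_mk]
    abel
  refine ⟨(h3.prod h4).of_injective decorationEquiv.injective he, ?_⟩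
  have g2 : ∀ b, genFun (wt b) = treeGenFun b * treeGenFun b := fun b => genFun_prod (h1 b) (h1 b)
  have g3 : genFun wu = zb * zw := by
    rw [genFun_unique, zb, zw, MvPowerSeries.X_def, MvPowerSeries.X_def,
      MvPowerSeries.monomial_mul_monomial, one_mul]
    rfl
  have g4 : genFun wtt = genFun (wt true) * genFun (wt false) := genFun_prod (h2 true) (h2 false)
  rw [genFun_congr (w' := fun p : Unit × _ => wu p.1 + wtt p.2) decorationEquiv he,
    genFun_prod h3 h4, g3, g4, g2, g2, treeGenFun_true, treeGenFun_false]
  ring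

/-- `R` is the square root in the explicit formula for the generating function of trees. -/
theorem exists_sqrt (b : Bool) : ∃ R : MvPowerSeries Var ℚ, MvPowerSeries.constantCoeff R = 1 ∧
    R ^ 2 = (MvPowerSeries.X (colorVar b) - MvPowerSeries.X (colorVar (!b)) + 1) ^ 2 -
      4 * MvPowerSeries.X (colorVar b) ∧
    2 * MvPowerSeries.X (colorVar b) * treeGenFun b =
      MvPowerSeries.X (colorVar b) - MvPowerSeries.X (colorVar (!b)) + 1 - R := by
  refine ⟨MvPowerSeries.X (colorVar b) - MvPowerSeries.X (colorVar (!b)) + 1 -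
    2 * MvPowerSeries.X (colorVar b) * treeGenFun b, by simp, ?_, by ring⟩
  have h1 := treeGenFun_eq b
  have h2 := treeGenFun_eq (!b)
  rw [Bool.not_not] at h2
  generalize (MvPowerSeries.X (colorVar b) : MvPowerSeries Var ℚ) = x at *
  generalize (MvPowerSeries.X (colorVar (!b)) : MvPowerSeries Var ℚ) = y at *
  -- the two equations give a quadratic equation for the first of the generating functions
  have h3 : x * treeGenFun b ^ 2 - (x - y + 1) * treeGenFun b + 1 = 0 := by
    linear_combination -(1 - x * treeGenFun b) * h1 - y * treeGenFun b * h2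
  linear_combination 4 * x * h3

/-! ### The generating function of polyominoes -/

/-- The equation `(l + 1) G = z• ∂ (F ^ (l + 1))` is divided by `l + 1`; in particular `G` does not depend
on `k`. -/
theorem genFun_trunkClass {l k : ℕ} (hk : 0 < k) :
    FinitelyManyOfEachWeight (fun P : TrunkClass (l + 1) k => sizeWeight P.1) ∧
      genFun (fun P : TrunkClass (l + 1) k => sizeWeight P.1) = genFun decorationWeight ^ l *
        (MvPowerSeries.X Var.black *
          MvPowerSeries.pderiv ℚ Var.black (genFun decorationWeight)) := by
  obtain ⟨e, he⟩ := exists_pointed_equiv (l := l + 1) (k := k) l.succ_pos hk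
  obtain ⟨h1, h2⟩ := genFun_tuples genFun_decorationWeight.1 (l + 1)
  constructor
  · exact (h1.pointed Var.black).of_injective (φ := fun P => e (P, 0))
      (fun P P' h => congrArg Prod.fst (e.injective h)) fun P => he _
  · have h3 : genFun (fun p : TrunkClass (l + 1) k × Fin (l + 1) => sizeWeight p.1.1) = _ :=
      (genFun_congr e he).trans (genFun_pointed _ Var.black)
    rw [genFun_nsmul_card (fun P : TrunkClass (l + 1) k => sizeWeight P.1), h2, MvPowerSeries.pderiv_pow, Nat.add_sub_cancel] at h3
    have h4 : (l + 1) • genFun (fun P : TrunkClass (l + 1) k => sizeWeight P.1) =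
        (l + 1) • (genFun decorationWeight ^ l * (MvPowerSeries.X Var.black *
          MvPowerSeries.pderiv ℚ Var.black (genFun decorationWeight))) := by
      rw [h3]
      simp only [nsmul_eq_mul]
      ring
    ext n
    have h5 := congrArg (MvPowerSeries.coeff n) h4
    rw [map_nsmul, map_nsmul] at h5
    exact nsmul_right_injective l.succ_ne_zero h5

/-- Polyominoes are sorted by the parameters of their trunk. -/
theorem bijective_trunkClass : Function.Bijective
    fun x : Σ q : ℕ × ℕ, TrunkClass (q.2 + 1) (q.1 + 1) => x.2.1 := by
  constructor
  · rintro ⟨⟨k, l⟩, ⟨P, f, hf⟩⟩ ⟨⟨k', l'⟩, ⟨P', f', hf'⟩⟩ h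
    obtain rfl : P = P' := h
    obtain ⟨hl, hk, -⟩ := hf.unique hf'
    simp only at hl hk
    obtain rfl : l = l' := by omega
    obtain rfl : k = k' := by omega
    rfl
  · intro P
    obtain ⟨l, k, f, hf⟩ := P.forest.exists_isTrunk
    have hk := P.one_le_of_isTrunk hf
    have hl := hf.l_pos
    obtain ⟨l, rfl⟩ := Nat.exists_eq_add_of_lt hl
    refine ⟨⟨((k - 1).toNat, l), ⟨P, f, ?_⟩⟩, rfl⟩
    simp only
    convert hf using 1
    · omega
    · omega

theorem pppWeight_trunkClass {l k : ℕ} (P : TrunkClass l k) :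
    pppWeight P.1 = Finsupp.single Var.t k + sizeWeight P.1 := by
  obtain ⟨P, f, hf⟩ := P
  have h1 := NondegeneratePPP.intrinsicThickness_eq hf
  rw [Nat.cast_inj] at h1
  rw [pppWeight, sizeWeight, h1, add_comm]

/-- Polyominoes have the generating function of triples of a positive integer, the thickness, a pointed
decoration and a list of decorations. The latter two are related to the polyominoes with trunk of
length `l + 1` only through the equality of their generating functions. -/
theorem genFun_pppWeight : FinitelyManyOfEachWeight pppWeight ∧
    genFun pppWeight = (tvar * (1 - tvar)⁻¹) *
      ((MvPowerSeries.X Var.black *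
        MvPowerSeries.pderiv ℚ Var.black (genFun decorationWeight)) *
          (1 - genFun decorationWeight)⁻¹) := by
  have hd := genFun_decorationWeight.1
  let wp : Pointed decorationWeight Var.black → (Var →₀ ℕ) := fun p => decorationWeight p.1.1
  have hp : FinitelyManyOfEachWeight wp := hd.pointed Var.black
  let wt : Unit → (Var →₀ ℕ) := fun _ => Finsupp.single Var.t 1
  have ht : FinitelyManyOfEachWeight wt := .of_finite _
  have ht0 : ∀ a, wt a ≠ 0 := fun _ => by simp [wt]
  have gt : genFun wt = tvar := genFun_unique wt
  -- a polyomino amounts to its thickness, a pointed decoration and a tuple of decorations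
  have h1 : ∀ q : ℕ × ℕ, ∃ e : TrunkClass (q.2 + 1) (q.1 + 1) ≃
      (Fin q.2 → Decoration) × Pointed decorationWeight Var.black,
      ∀ P, (∑ i, decorationWeight ((e P).1 i)) + wp (e P).2 = sizeWeight P.1 := by
    intro q
    obtain ⟨f1, g1⟩ := genFun_trunkClass (l := q.2) (k := q.1 + 1) q.1.succ_pos
    obtain ⟨f2, g2⟩ := genFun_tuples hd q.2
    refine exists_equiv_of_genFun_eq f1 (f2.prod hp) ?_
    rw [g1, genFun_prod f2 hp, g2, genFun_pointed]
  choose e he using h1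
  let e1 : (Σ q : ℕ × ℕ, (Fin q.2 → Decoration) × Pointed decorationWeight Var.black) ≃
      (Unit × List Unit) × (Pointed decorationWeight Var.black × List Decoration) :=
    { toFun x := (((), List.replicate x.1.1 ()),
        (x.2.2, List.equivSigmaTuple.symm ⟨x.1.2, x.2.1⟩))
      invFun y := ⟨(y.1.2.length, (List.equivSigmaTuple y.2.2).1),
        ((List.equivSigmaTuple y.2.2).2, y.2.1)⟩
      left_inv := by
        rintro ⟨⟨k, l⟩, D, p⟩
        have h1 := List.equivSigmaTuple.apply_symm_apply (⟨l, D⟩ : Σ n, Fin n → Decoration)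
        simp only
        rw [h1]
        exact congrArg (fun k' => (⟨(k', l), (D, p)⟩ : Σ q : ℕ × ℕ,
          (Fin q.2 → Decoration) × Pointed decorationWeight Var.black)) List.length_replicate
      right_inv := by
        rintro ⟨⟨⟨⟩, u⟩, p, L⟩
        have h1 : List.replicate u.length () = u := (List.eq_replicate_of_mem fun _ _ => rfl).symm
        have h2 := List.equivSigmaTuple.symm_apply_apply L
        simp only [h1]
        exact congrArg (fun L' => (((), u), p, L')) h2 }
  let E := (Equiv.ofBijective _ bijective_trunkClass).symm.trans
    ((Equiv.sigmaCongrRight e).trans e1)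
  let wE : (Unit × List Unit) × (Pointed decorationWeight Var.black × List Decoration) →
      (Var →₀ ℕ) := fun y => (wt y.1.1 + (y.1.2.map wt).sum) +
        (wp y.2.1 + (y.2.2.map decorationWeight).sum)
  have hE : ∀ P, wE (E P) = pppWeight P := by
    intro P
    obtain ⟨⟨⟨k, l⟩, P⟩, rfl⟩ := (Equiv.ofBijective _ bijective_trunkClass).surjective P
    simp only [E, Equiv.trans_apply, Equiv.symm_apply_apply]
    change wt () + ((List.replicate k ()).map wt).sum + (wp (e (k, l) P).2 +
      ((List.ofFn (e (k, l) P).1).map decorationWeight).sum) = pppWeight P.1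
    have h2 : wt () + k • wt () = Finsupp.single Var.t (k + 1) := by
      rw [add_comm k 1, Finsupp.single_add]
      simp [wt]
    rw [pppWeight_trunkClass, ← he, List.map_replicate, List.sum_replicate, List.map_ofFn,
      List.sum_ofFn, h2, add_comm (wp _)]
    rfl
  have f1 := ht.prod (ht.list ht0)
  have f2 := hp.prod (hd.list decorationWeight_ne_zero)
  refine ⟨(f1.prod f2).of_injective E.injective hE, ?_⟩
  have g1 := genFun_prod f1 f2
  rw [genFun_prod ht (ht.list ht0), genFun_prod hp (hd.list decorationWeight_ne_zero),
    genFun_list ht ht0, genFun_list hd decorationWeight_ne_zero, gt] at g1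
  rw [genFun_congr E hE, ← genFun_pointed]
  exact g1

end PPP

open PPP in
/-- The inverses are those of formal power series with non-zero constant coefficient. -/
theorem mainTheorem1 :
    -- every non-degenerated periodic parallelogram polyomino has an intrinsic thickness
    (∀ P : NondegeneratePPP, ∃! k : ℕ, P.1.HasIntrinsicThickness k) ∧
    -- the generating functions count finite sets
    FinitelyManyOfEachWeight blackRootedWeight ∧
    FinitelyManyOfEachWeight whiteRootedWeight ∧
    FinitelyManyOfEachWeight pppWeight ∧
    -- the explicit algebraic expressions of the two tree generating functions
    (∃ R : MvPowerSeries Var ℚ, MvPowerSeries.constantCoeff R = 1 ∧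
      R ^ 2 = (zb - zw + 1) ^ 2 - 4 * zb ∧ 2 * zb * Ablack = zb - zw + 1 - R) ∧
    (∃ R : MvPowerSeries Var ℚ, MvPowerSeries.constantCoeff R = 1 ∧
      R ^ 2 = (zw - zb + 1) ^ 2 - 4 * zw ∧ 2 * zw * Awhite = zw - zb + 1 - R) ∧
    -- the generating function of non-degenerated periodic parallelogram polyominoes
    pppGenFun =
      (tvar * (1 - tvar)⁻¹) *
        ((zb * MvPowerSeries.pderiv ℚ Var.black (zb * zw * Ablack ^ 2 * Awhite ^ 2)) *
          (1 - zb * zw * Ablack ^ 2 * Awhite ^ 2)⁻¹) := by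
  refine ⟨NondegeneratePPP.existsUnique_thickness, finitelyManyOfEachWeight_treeWeight true,
    finitelyManyOfEachWeight_treeWeight false, genFun_pppWeight.1, exists_sqrt true,
    exists_sqrt false, ?_⟩
  rw [pppGenFun, genFun_pppWeight.2, genFun_decorationWeight.2]
  rfl
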